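/- Let $k$ be a field. A finite category over $k$ is a $k$-linear category that is $k$-linearly equivalent to the category of finite-dimensional right modules over a finite-dimensional $k$-algebra $R$; it is semisimple if $R$ is semisimple. Let $\mathcal{C}$ be a multi-fusion category over $k$, i.e. a rigid monoidal category whose underlying category is semisimple over $k$ and whose tensor product is $k$-bilinear on morphisms. A finite left $\mathcal{C}$-module is a left $\mathcal{C}$-module category which is a finite category over $k$ and whose action is $k$-bilinear on morphisms and right exact in each variable; a nonzero one is indecomposable if it is not equivalent, as a $k$-linear left $\mathcal{C}$-module, to a direct sum of two nonzero finite left $\mathcal{C}$-modules. For an algebra $A$ in $\mathcal{C}$ let $\mathrm{RMod}_A(\mathcal{C})$ be the left $\mathcal{C}$-module of right $A$-modules in $\mathcal{C}$. Call $A$ semisimple if $\mathrm{RMod}_A(\mathcal{C})$ is semisimple, simple if $\mathrm{RMod}_A(\mathcal{C})$ is an indecomposable semisimple left $\mathcal{C}$-module, and a division algebra if $A$ is a simple object of $\mathrm{RMod}_A(\mathcal{C})$. Call $A$ a matrix algebra if there is a decomposition $A\simeq\bigoplus_{i,j=1}^n A_{ij}$ in $\mathcal{C}$ with $n\ge 1$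 such that (a) each $A_{ii}$ is an algebra in $\mathcal{C}$ that is a simple division algebra; (b) each $A_{ij}$ is an invertible $A_{ii}$-$A_{jj}$-bimodule (for $i=j$ it is the regular bimodule $A_{ii}$), where invertible means that it has a two-sided inverse, up to isomorphism, for the relative tensor product of bimodules; (c) for all $i,j,l$ there is an isomorphism $\varphi_{ijl}:A_{ij}\otimes_{A_{jj}}A_{jl}\to A_{il}$ of $A_{ii}$-$A_{ll}$-bimodules; (d) the multiplication of $A$ is induced by these isomorphisms: its restriction to $A_{ij}\otimes A_{jl}$ is the composite $A_{ij}\otimes A_{jl}\to A_{ij}\otimes_{A_{jj}}A_{jl}\xrightarrow{\varphi_{ijl}}A_{il}\hookrightarrow A$, and its restriction to $A_{ij}\otimes A_{j'l}$ is zero if $j\ne j'$. Then, for every algebra $A$ in $\mathcal{C}$: (1) $A$ is a simple algebra if and only if $A$ is a matrix algebra. (2) $A$ is a semisimple algebra if and only if $A$ is isomorphic to a direct sum of finitely many matrix algebras (the empty sum, i.e. the zero algebra, being allowed). -/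

import Mathlib

open CategoryTheory MonoidalCategory Limits
open scoped MonObj

universe w u v u' v'

namespace MultiFusion

/-! ## Finite and semisimple linear categories -/

section LinearCategories

/-- `F` is a `k`-linear equivalence of `k`-linear categories. -/
structure IsLinearEquivalence (k : Type w) [Field k]
    {M : Type u} [Category.{v} M] [Preadditive M] [Linear k M]
    {N : Type u'} [Category.{v'} N] [Preadditive N] [Linear k N] (F : M ⥤ N) : Prop where
  isEquivalence : F.IsEquivalence
  additive : F.Additive
  linear : F.Linear k

/-- A finite category over `k`: a `k`-linear category which is equivalent to the category of
finite-dimensional right modules over a finite-dimensional `k`-algebra `R`. (Right `R`-modules are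
modules over `Rᵐᵒᵖ`; such a module is finitely generated iff it is finite-dimensional.) -/
class FiniteCategory (k : Type w) [Field k] (M : Type u) [Category.{v} M] [Preadditive M]
    [Linear k M] : Prop where
  exists_equivalence : ∃ (R : Type w) (_ : Ring R) (_ : Algebra k R) (_ : Module.Finite k R)
    (F : M ⥤ FGModuleCat.{w} Rᵐᵒᵖ), IsLinearEquivalence k F

/-- A semisimple category over `k`: a `k`-linear category which is equivalent to the category of
finite-dimensional right modules over a finite-dimensional semisimple `k`-algebra `R`. -/
class SemisimpleCategory (k : Type w) [Field k] (M : Type u) [Category.{v} M] [Preadditive M]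
    [Linear k M] : Prop where
  exists_equivalence : ∃ (R : Type w) (_ : Ring R) (_ : Algebra k R) (_ : Module.Finite k R)
    (_ : IsSemisimpleRing R) (F : M ⥤ FGModuleCat.{w} Rᵐᵒᵖ), IsLinearEquivalence k F

theorem hasCoequalizers_fgModuleCat (R : Type w) [Ring R] :
    HasCoequalizers (FGModuleCat.{w} R) := by
  have h : (ModuleCat.isFG.{w} R).IsClosedUnderColimitsOfShape WalkingParallelPair := by
    refine ⟨?_⟩
    rintro X ⟨F⟩
    have h1 : Module.Finite R (F.diag.obj WalkingParallelPair.one) := F.prop_diag_obj _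
    have he : Epi (F.ι.app WalkingParallelPair.one) := by
      refine ⟨fun f g hfg => F.isColimit.hom_ext ?_⟩
      rintro (_ | _)
      · have hw := F.cocone.w WalkingParallelPairHom.left
        rw [← hw, Category.assoc, Category.assoc]
        exact congrArg _ hfg
      · exact hfg
    exact Module.Finite.of_surjective _ ((ModuleCat.epi_iff_surjective _).1 he)
  exact hasColimitsOfShape_of_closedUnderColimits _ _

/-- A semisimple category over `k` has coequalizers. -/
theorem SemisimpleCategory.hasCoequalizers (k : Type w) [Field k] (M : Type u) [Category.{v} M]
    [Preadditive M] [Linear k M] [SemisimpleCategory k M] : HasCoequalizers M := by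
  obtain ⟨R, _, _, _, _, F, hF⟩ := SemisimpleCategory.exists_equivalence (k := k) (M := M)
  have := hF.isEquivalence
  have := hasCoequalizers_fgModuleCat Rᵐᵒᵖ
  exact Adjunction.hasColimitsOfShape_of_equivalence F

/-- The zero category. -/
def IsZeroCategory (M : Type u) [Category.{v} M] [Preadditive M] : Prop :=
  ∀ X : M, IsZero X

end LinearCategories

/-! ## Finite left module categories -/

section ModuleCategories

open MonoidalLeftAction

variable (k : Type w) [Field k] (C : Type u) [Category.{v} C] [Preadditive C] [Linear k C]
  [MonoidalCategory C] (M : Type u') [Category.{v'} M] [Preadditive M] [Linear k M]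
  [MonoidalLeftAction C M]

/-- A left `C`-module `M` is finite if `M` is a finite category over `k` and the action
`C × M ⥤ M` is `k`-bilinear on morphisms and right exact separately in each variable. -/
structure IsFiniteLeftModule : Prop where
  finite : FiniteCategory k M
  add_actionHomLeft {c c' : C} (f g : c ⟶ c') (m : M) : (f + g) ⊵ₗ m = f ⊵ₗ m + g ⊵ₗ m
  smul_actionHomLeft {c c' : C} (r : k) (f : c ⟶ c') (m : M) : (r • f) ⊵ₗ m = r • (f ⊵ₗ m)
  actionHomRight_add (c : C) {m m' : M} (f g : m ⟶ m') : c ⊴ₗ (f + g) = c ⊴ₗ f + c ⊴ₗ g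
  actionHomRight_smul (c : C) {m m' : M} (r : k) (f : m ⟶ m') : c ⊴ₗ (r • f) = r • (c ⊴ₗ f)
  rightExact_left (m : M) : PreservesFiniteColimits (actionRight (C := C) m)
  rightExact_right (c : C) : PreservesFiniteColimits (actionLeft M c)

/-- A nonzero finite left `C`-module `M` is indecomposable if it is not the direct sum of two
nonzero finite left `C`-modules: whenever `k`-linear `C`-module functors `P₁ : M ⥤ M₁` and
`P₂ : M ⥤ M₂` to finite left `C`-modules form an equivalence `M ⥤ M₁ × M₂`, one of `M₁`, `M₂` is
zero. -/
structure IsIndecomposable : Prop where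
  finite : IsFiniteLeftModule k C M
  nonzero : ¬ IsZeroCategory M
  isZero_or_isZero
    (M₁ : Type u') [Category.{v'} M₁] [Preadditive M₁] [Linear k M₁] [MonoidalLeftAction C M₁]
    (M₂ : Type u') [Category.{v'} M₂] [Preadditive M₂] [Linear k M₂] [MonoidalLeftAction C M₂]
    (_ : IsFiniteLeftModule k C M₁) (_ : IsFiniteLeftModule k C M₂)
    (P₁ : M ⥤ M₁) [P₁.Additive] [P₁.Linear k] [P₁.LeftLinear C]
    (P₂ : M ⥤ M₂) [P₂.Additive] [P₂.Linear k] [P₂.LeftLinear C]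
    (_ : (P₁.prod' P₂).IsEquivalence) : IsZeroCategory M₁ ∨ IsZeroCategory M₂

end ModuleCategories

/-! ## Right modules over an algebra -/

section RightModules

variable {C : Type u} [Category.{v} C] [MonoidalCategory C]

/-- Right modules over an algebra `A` in `C`. -/
structure RMod (A : Mon C) where
  /-- The underlying object. -/
  X : C
  /-- The action. -/
  act : X ⊗ A.X ⟶ X
  act_one : X ◁ η[A.X] ≫ act = (ρ_ X).hom
  act_mul : X ◁ μ[A.X] ≫ act = (α_ X A.X A.X).inv ≫ act ▷ A.X ≫ act

namespace RMod

variable {A : Mon C}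

/-- Morphisms of right `A`-modules. -/
@[ext]
structure Hom (x y : RMod A) where
  /-- The underlying morphism. -/
  hom : x.X ⟶ y.X
  act_hom : x.act ≫ hom = hom ▷ A.X ≫ y.act

instance : Category (RMod A) where
  Hom x y := Hom x y
  id x := ⟨𝟙 x.X, by simp⟩
  comp f g := ⟨f.hom ≫ g.hom, by
    rw [← Category.assoc, f.act_hom, Category.assoc, g.act_hom, comp_whiskerRight,
      Category.assoc]⟩
  id_comp _ := Hom.ext (Category.id_comp _)
  comp_id _ := Hom.ext (Category.comp_id _)
  assoc _ _ _ := Hom.ext (Category.assoc _ _ _)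

@[ext]
theorem hom_ext {x y : RMod A} {f g : x ⟶ y} (h : f.hom = g.hom) : f = g := Hom.ext h

@[simp] theorem id_hom (x : RMod A) : Hom.hom (𝟙 x) = 𝟙 x.X := rfl

@[simp] theorem comp_hom {x y z : RMod A} (f : x ⟶ y) (g : y ⟶ z) :
    (f ≫ g).hom = f.hom ≫ g.hom := rfl

/-- Isomorphisms of right modules from isomorphisms of the underlying objects. -/
@[simps]
def isoMk {x y : RMod A} (e : x.X ≅ y.X) (h : x.act ≫ e.hom = e.hom ▷ A.X ≫ y.act) : x ≅ y where
  hom := ⟨e.hom, h⟩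
  inv := ⟨e.inv, by
    rw [Iso.comp_inv_eq, Category.assoc, h, ← Category.assoc, ← comp_whiskerRight]
    simp⟩
  hom_inv_id := hom_ext e.hom_inv_id
  inv_hom_id := hom_ext e.inv_hom_id

variable (A) in
/-- `A` as a right `A`-module. -/
def regular : RMod A where
  X := A.X
  act := μ[A.X]
  act_one := by simp
  act_mul := by simp

section Linear

variable [Preadditive C] [MonoidalPreadditive C]

instance (x y : RMod A) : Zero (x ⟶ y) := ⟨⟨0, by simp⟩⟩

instance (x y : RMod A) : Add (x ⟶ y) :=
  ⟨fun f g => ⟨f.hom + g.hom, by simp [f.act_hom, g.act_hom]⟩⟩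

instance (x y : RMod A) : Neg (x ⟶ y) :=
  ⟨fun f => ⟨-f.hom, by
    have h : (-f.hom) ▷ A.X = -(f.hom ▷ A.X) :=
      (tensorRight A.X).map_neg (f := f.hom)
    rw [h]; simp [f.act_hom]⟩⟩

@[simp] theorem zero_hom (x y : RMod A) : Hom.hom (0 : x ⟶ y) = 0 := rfl
@[simp] theorem add_hom {x y : RMod A} (f g : x ⟶ y) : (f + g).hom = f.hom + g.hom := rfl
@[simp] theorem neg_hom {x y : RMod A} (f : x ⟶ y) : (-f).hom = -f.hom := rfl

instance : Preadditive (RMod A) where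
  homGroup _ _ :=
    { add_assoc := fun _ _ _ => hom_ext (add_assoc _ _ _)
      zero_add := fun _ => hom_ext (zero_add _)
      add_zero := fun _ => hom_ext (add_zero _)
      neg_add_cancel := fun _ => hom_ext (neg_add_cancel _)
      add_comm := fun _ _ => hom_ext (add_comm _ _)
      nsmul := nsmulRec
      zsmul := zsmulRec }
  add_comp _ _ _ _ _ _ := hom_ext (Preadditive.add_comp _ _ _ _ _ _)
  comp_add _ _ _ _ _ _ := hom_ext (Preadditive.comp_add _ _ _ _ _ _)

variable {k : Type w} [Field k] [Linear k C] [MonoidalLinear k C]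

instance (x y : RMod A) : SMul k (x ⟶ y) :=
  ⟨fun r f => ⟨r • f.hom, by simp [f.act_hom]⟩⟩

@[simp] theorem smul_hom {x y : RMod A} (r : k) (f : x ⟶ y) : (r • f).hom = r • f.hom := rfl

instance : Linear k (RMod A) where
  homModule _ _ :=
    { one_smul := fun _ => hom_ext (one_smul k _)
      mul_smul := fun r s _ => hom_ext (mul_smul r s _)
      smul_zero := fun r => hom_ext (smul_zero r)
      smul_add := fun r _ _ => hom_ext (smul_add r _ _)
      add_smul := fun r s _ => hom_ext (add_smul r s _)
      zero_smul := fun _ => hom_ext (zero_smul k _) }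
  smul_comp _ _ _ _ _ _ := hom_ext (Linear.smul_comp _ _ _ _ _ _)
  comp_smul _ _ _ _ _ _ := hom_ext (Linear.comp_smul _ _ _ _ _ _)

end Linear

/-- The right `A`-module `c ⊗ x`. -/
@[simps]
def tensor (c : C) (x : RMod A) : RMod A where
  X := c ⊗ x.X
  act := (α_ c x.X A.X).hom ≫ c ◁ x.act
  act_one := by
    rw [tensor_whiskerLeft]
    simp [← MonoidalCategory.whiskerLeft_comp, x.act_one]
  act_mul := by
    rw [tensor_whiskerLeft]
    simp only [Category.assoc, Iso.inv_hom_id_assoc, ← MonoidalCategory.whiskerLeft_comp, x.act_mul]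
    simp

/-- `C` acts on right `A`-modules from the left, by the tensor product of `C`. -/
instance : MonoidalLeftAction C (RMod A) where
  actionObj c x := tensor c x
  actionHomLeft {c c'} f x := ⟨f ▷ x.X, by
    change ((α_ c x.X A.X).hom ≫ c ◁ x.act) ≫ f ▷ x.X =
      f ▷ x.X ▷ A.X ≫ (α_ c' x.X A.X).hom ≫ c' ◁ x.act
    simp [whisker_exchange]⟩
  actionHomRight c x y g := ⟨c ◁ g.hom, by
    change ((α_ c x.X A.X).hom ≫ c ◁ x.act) ≫ c ◁ g.hom =
      (c ◁ g.hom) ▷ A.X ≫ (α_ c y.X A.X).hom ≫ c ◁ y.act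
    rw [Category.assoc, ← MonoidalCategory.whiskerLeft_comp, g.act_hom]
    simp⟩
  actionAssocIso c c' x := isoMk (α_ c c' x.X) (by
    change ((α_ (c ⊗ c') x.X A.X).hom ≫ (c ⊗ c') ◁ x.act) ≫ (α_ c c' x.X).hom =
      (α_ c c' x.X).hom ▷ A.X ≫ (α_ c (c' ⊗ x.X) A.X).hom ≫
        c ◁ ((α_ c' x.X A.X).hom ≫ c' ◁ x.act)
    simp)
  actionUnitIso x := isoMk (λ_ x.X) (by
    change ((α_ (𝟙_ C) x.X A.X).hom ≫ 𝟙_ C ◁ x.act) ≫ (λ_ x.X).hom =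
      (λ_ x.X).hom ▷ A.X ≫ x.act
    simp)
  actionHom_def _ _ := rfl
  actionHomRight_id c x := hom_ext (MonoidalCategory.whiskerLeft_id c x.X)
  id_actionHomLeft c x := hom_ext (MonoidalCategory.id_whiskerRight c x.X)
  actionHom_comp {c c' c'' x x' x''} f₁ f₂ g₁ g₂ := hom_ext (by
    change (f₁ ≫ f₂) ▷ x.X ≫ c'' ◁ (g₁.hom ≫ g₂.hom) =
      (f₁ ▷ x.X ≫ c' ◁ g₁.hom) ≫ f₂ ▷ x'.X ≫ c'' ◁ g₂.hom
    simp [whisker_exchange_assoc])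
  actionAssocIso_hom_naturality {c₁ c₂ c₃ c₄ x y} f g h := hom_ext (by
    change ((f ⊗ₘ g) ▷ x.X ≫ (c₂ ⊗ c₄) ◁ h.hom) ≫ (α_ c₂ c₄ y.X).hom =
      (α_ c₁ c₃ x.X).hom ≫ f ▷ (c₃ ⊗ x.X) ≫ c₂ ◁ (g ▷ x.X ≫ c₄ ◁ h.hom)
    simp [MonoidalCategory.tensorHom_def])
  actionUnitIso_hom_naturality {x y} f := hom_ext (by
    change (λ_ x.X).hom ≫ f.hom = 𝟙_ C ◁ f.hom ≫ (λ_ y.X).hom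
    simp)
  whiskerLeft_actionHomLeft c _ _ f x := hom_ext
    (MonoidalLeftAction.whiskerLeft_actionHomLeft c f x.X)
  whiskerRight_actionHomLeft c f x := hom_ext
    (MonoidalLeftAction.whiskerRight_actionHomLeft c f x.X)
  associator_actionHom c₁ c₂ c₃ x := hom_ext
    (MonoidalLeftAction.associator_actionHom c₁ c₂ c₃ x.X)
  leftUnitor_actionHom c x := hom_ext (MonoidalLeftAction.leftUnitor_actionHom c x.X)
  rightUnitor_actionHom c x := hom_ext (MonoidalLeftAction.rightUnitor_actionHom c x.X)

end RMod

end RightModules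

/-! ## Semisimple, simple and division algebras -/

section Algebras

/-- `A` is a division algebra if it is simple as a right module over itself. -/
def IsDivisionAlgebra {C : Type u} [Category.{v} C] [Preadditive C]
    [MonoidalCategory C] [MonoidalPreadditive C] (A : Mon C) : Prop :=
  Simple (RMod.regular A)

variable (k : Type w) [Field k] {C : Type u} [Category.{v} C] [Preadditive C] [Linear k C]
  [MonoidalCategory C] [MonoidalPreadditive C] [MonoidalLinear k C]

/-- `A` is semisimple if its category of right modules is semisimple. -/
def IsSemisimpleAlgebra (A : Mon C) : Prop :=
  SemisimpleCategory k (RMod A)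

/-- `A` is simple if its category of right modules is an indecomposable semisimple left
`C`-module. -/
def IsSimpleAlgebra (A : Mon C) : Prop :=
  SemisimpleCategory k (RMod A) ∧ IsIndecomposable k C (RMod A)

end Algebras

/-! ## Invertible bimodules -/

section Bimodules

variable {C : Type u} [Category.{v} C] [MonoidalCategory C] [RigidCategory C]

instance preservesColimits_tensorLeft (X : C) : PreservesColimitsOfSize.{0, 0} (tensorLeft X) :=
  (tensorLeftAdjunction (HasLeftDual.leftDual X) X).leftAdjoint_preservesColimits

instance preservesColimits_tensorRight (X : C) : PreservesColimitsOfSize.{0, 0} (tensorRight X) :=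
  (tensorRightAdjunction X (HasRightDual.rightDual X)).leftAdjoint_preservesColimits

/-- An `R`-`S`-bimodule is invertible if it has a two-sided inverse for the relative tensor
products `⊗_R` and `⊗_S`, up to isomorphism of bimodules. -/
def IsInvertibleBimod [HasCoequalizers C] {R S : Mon C} (M : Bimod R S) : Prop :=
  ∃ N : Bimod S R, Nonempty (M.tensorBimod N ≅ Bimod.regular R) ∧
    Nonempty (N.tensorBimod M ≅ Bimod.regular S)

end Bimodules

/-! ## Matrix algebras and direct sums -/

section Matrix

variable (k : Type w) [Field k] {C : Type u} [Category.{v} C] [Preadditive C] [Linear k C]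
  [MonoidalCategory C] [MonoidalPreadditive C] [MonoidalLinear k C] [RigidCategory C]

/-- A presentation of `A` as an `n × n` matrix algebra. -/
structure MatrixPresentation [HasCoequalizers C] (A : Mon C) (n : ℕ) where
  /-- The diagonal algebras. -/
  diag : Fin n → Mon C
  simple (i : Fin n) : IsSimpleAlgebra k (diag i)
  division (i : Fin n) : IsDivisionAlgebra (diag i)
  /-- The bimodules `A_{ij}`. -/
  entry (i j : Fin n) : Bimod (diag i) (diag j)
  /-- `A_{ii}`, as a bimodule, is the diagonal algebra. -/
  entryDiag (i : Fin n) : entry i i ≅ Bimod.regular (diag i)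
  invertible (i j : Fin n) : IsInvertibleBimod (entry i j)
  /-- The direct sum of all `A_{ij}` in `C`. -/
  sum : Bicone fun p : Fin n × Fin n => (entry p.1 p.2).X
  isBilimit : sum.IsBilimit
  /-- The decomposition of `A`. -/
  iso : sum.pt ≅ A.X
  /-- The isomorphisms of `A_{ii}`-`A_{ll}`-bimodules from the tensor product of `A_{ij}` and
  `A_{jl}` over `A_{jj}` to `A_{il}`. -/
  comp (i j l : Fin n) : (entry i j).tensorBimod (entry j l) ≅ entry i l
  /-- On the summands `A_{ij}` and `A_{jl}` the multiplication of `A` is the composite of the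
  projection to the relative tensor product with `comp i j l`. -/
  mul_eq (i j l : Fin n) :
    ((sum.ι (i, j) ≫ iso.hom) ⊗ₘ (sum.ι (j, l) ≫ iso.hom)) ≫ μ[A.X] =
      coequalizer.π ((entry i j).actRight ▷ (entry j l).X)
          ((α_ (entry i j).X (diag j).X (entry j l).X).hom ≫
            (entry i j).X ◁ (entry j l).actLeft) ≫
        (comp i j l).hom.hom ≫ sum.ι (i, l) ≫ iso.hom
  /-- On all other pairs of summands the multiplication of `A` is zero. -/
  mul_eq_zero (i j j' l : Fin n) (h : j ≠ j') :
    ((sum.ι (i, j) ≫ iso.hom) ⊗ₘ (sum.ι (j', l) ≫ iso.hom)) ≫ μ[A.X] = 0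

/-- Matrix algebras in a rigid semisimple monoidal category. -/
def IsMatrixAlgebra [SemisimpleCategory k C] (A : Mon C) : Prop :=
  haveI := SemisimpleCategory.hasCoequalizers k C
  ∃ n : ℕ, 1 ≤ n ∧ Nonempty (MatrixPresentation k A n)

/-- `A` is the direct sum of the finite family `R` of algebras: its underlying object is the direct
sum of the underlying objects in such a way that the projections are algebra homomorphisms, i.e.
unit and multiplication are componentwise. -/
def IsDirectSumOfAlgebras (A : Mon C) {m : ℕ} (R : Fin m → Mon C) : Prop :=
  ∃ (b : Bicone fun c => (R c).X) (_ : b.IsBilimit) (e : A.X ≅ b.pt),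
    ∀ c, IsMonHom (e.hom ≫ b.π c)

/-- `A` is a direct sum of finitely many matrix algebras. -/
def IsDirectSumOfMatrixAlgebras [SemisimpleCategory k C] (A : Mon C) : Prop :=
  ∃ (m : ℕ) (R : Fin m → Mon C), (∀ c, IsMatrixAlgebra k (R c)) ∧ IsDirectSumOfAlgebras A R

end Matrix

end MultiFusion

/-! Semisimplicity is handled through von Neumann regularity: every `f` admits a `g` with `f ≫ g ≫ f
= f`. A `k`-linear category is semisimple exactly when it is regular, has finite-dimensional Hom
spaces, split idempotents and finite biproducts, and has an object whose powers contain every object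
as a retract (`IsSplitFinite`). If morphisms between free modules are regular, then each action `N ⊗
A ⟶ N` splits, so `A` is semisimple as soon as its free modules `c ⊗ A` satisfy regularity
(`isSemisimpleAlgebra_iff`).

From semisimple algebras to matrices: split `A`, as a right module, into simple modules `e_j A`.
This gives orthogonal idempotent points `e_j : 𝟙_ C ⟶ A` with sum the unit. If `e_i A e_j ≠ 0`,
simplicity of `e_i A` splits the map `e_i A e_j ⊗ A ⟶ e_i A`, which yields an element of `e_i A e_j
⊗ e_j A e_i` with product `e_i` (`Linked.nonempty_peirceDual`). Such an element makes the
multiplication `e_h A e_j ⊗ e_j A e_i ⟶ e_h A e_i` a split coequalizer, hence the relative tensor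
product over `e_j A e_j`, and it makes "`e_i A e_j ≠ 0`" an equivalence relation on indices. The
idempotents of one class form a matrix algebra; the sums over the classes are central idempotents,
so `A` is the direct sum of these matrix algebras. If `A` is simple there is only one class, since
separating one class from the rest would decompose the module category as a product.

From matrices to simple algebras: a diagonal algebra `A_ii` is a corner `e A e`, and `M ↦ M e` is
bijective on morphisms out of the modules `c ⊗ e A`. The epimorphisms `A_ji ⊗ A_il ⟶ A_jl` split in
`C`, so `A` is a retract of `A ⊗ e A`, and regularity passes from `A_ii` to `A`. The module `e A` is
simple because `A_ii` is a division algebra; by duality every module is then a retract of some `c ⊗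
M`, for any fixed nonzero `M`, which excludes a decomposition (`isIndecomposable_of_simple`). For
direct sums, regularity is checked block by block. -/

namespace MultiFusion

/-! ### Von Neumann regularity and an intrinsic form of semisimplicity. -/

section Regular

/-- Every morphism is von Neumann regular. -/
def IsRegular (M : Type u) [Category.{v} M] : Prop :=
  ∀ ⦃X Y : M⦄ (f : X ⟶ Y), ∃ g : Y ⟶ X, f ≫ g ≫ f = f

/-- Every identity is a finite sum of endomorphisms factoring through `Q`. -/
def IsRetractGenerator {M : Type u} [Category.{v} M] [Preadditive M] (Q : M) : Prop :=
  ∀ X : M, ∃ (n : ℕ) (a : Fin n → (X ⟶ Q)) (b : Fin n → (Q ⟶ X)), ∑ i, a i ≫ b i = 𝟙 X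

/-- An intrinsic form of semisimplicity for `k`-linear categories. -/
structure IsSplitFinite (k : Type w) [Field k] (M : Type u) [Category.{v} M] [Preadditive M]
    [Linear k M] : Prop where
  finite_hom (X Y : M) : Module.Finite k (X ⟶ Y)
  regular : IsRegular M
  isIdempotentComplete : IsIdempotentComplete M
  hasFiniteBiproducts : HasFiniteBiproducts M
  exists_generator : ∃ Q : M, IsRetractGenerator Q

variable {M : Type u} [Category.{v} M] {N : Type u'} [Category.{v'} N]

theorem IsRegular.of_fullyFaithful (h : IsRegular N) (F : M ⥤ N) [F.Full] [F.Faithful] :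
    IsRegular M := by
  intro X Y f
  obtain ⟨g, hg⟩ := h (F.map f)
  refine ⟨F.preimage g, F.map_injective ?_⟩
  simpa using hg

theorem IsRegular.exists_section_of_epi (h : IsRegular M) {X Y : M} (f : X ⟶ Y) [Epi f] :
    ∃ s : Y ⟶ X, s ≫ f = 𝟙 Y := by
  obtain ⟨g, hg⟩ := h f
  refine ⟨g, ?_⟩
  rw [← cancel_epi f, hg, Category.comp_id]

theorem IsRegular.exists_retraction_of_mono (h : IsRegular M) {X Y : M} (f : X ⟶ Y) [Mono f] :
    ∃ r : Y ⟶ X, f ≫ r = 𝟙 X := by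
  obtain ⟨g, hg⟩ := h f
  refine ⟨g, ?_⟩
  rw [← cancel_mono f, Category.assoc, hg, Category.id_comp]

/-- Regularity of a morphism passes to retracts of its source and target. -/
theorem exists_regular_of_retract {X Y X' Y' : M} {i : X ⟶ X'} {r : X' ⟶ X} (hX : i ≫ r = 𝟙 X)
    {j : Y ⟶ Y'} {s : Y' ⟶ Y} (hY : j ≫ s = 𝟙 Y) (f : X ⟶ Y)
    (h : ∃ g : Y' ⟶ X', (r ≫ f ≫ j) ≫ g ≫ (r ≫ f ≫ j) = r ≫ f ≫ j) :
    ∃ g : Y ⟶ X, f ≫ g ≫ f = f := by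
  obtain ⟨g, hg⟩ := h
  refine ⟨j ≫ g ≫ r, ?_⟩
  have h2 := congrArg (fun t => i ≫ t ≫ s) hg
  simp only [Category.assoc, hY, Category.comp_id] at h2
  simp only [← Category.assoc] at h2 ⊢
  simpa only [hX, Category.id_comp] using h2

end Regular

/-! ### Finitely generated modules over a semisimple algebra satisfy the intrinsic conditions. -/

section FGModules

variable (k : Type w) [Field k] (S : Type w) [Ring S] [Algebra k S] [Module.Finite k S]

/-- A linear map is a surjection onto its range followed by an inclusion. A section of the former
and a retraction of the latter compose to a quasi-inverse. -/
theorem isRegular_fgModuleCat [IsSemisimpleRing S] : IsRegular (FGModuleCat.{w} S) := by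
  intro V W f
  let φ := f.hom.hom
  obtain ⟨s, hs⟩ := IsSemisimpleModule.lifting_property φ.rangeRestrict φ.surjective_rangeRestrict
    LinearMap.id
  obtain ⟨r, hr⟩ := IsSemisimpleModule.extension_property φ.range.subtype
    φ.range.subtype_injective LinearMap.id
  refine ⟨FGModuleCat.ofHom (s ∘ₗ r), ?_⟩
  ext x
  have h1 := LinearMap.congr_fun hr (φ.rangeRestrict x)
  have h2 := LinearMap.congr_fun hs (φ.rangeRestrict x)
  have h3 := congrArg Subtype.val h2
  change φ (s (r (φ x))) = φ x
  have h4 : r (φ x) = φ.rangeRestrict x := h1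
  rw [h4]
  exact h3

theorem isIdempotentComplete_fgModuleCat : IsIdempotentComplete (FGModuleCat.{w} S) := by
  refine ⟨fun V p hp => ?_⟩
  let φ := p.hom.hom
  have hφ : ∀ x, φ (φ x) = φ x := fun x =>
    LinearMap.congr_fun (congrArg (fun f => f.hom.hom) hp) x
  refine ⟨FGModuleCat.of S φ.range, FGModuleCat.ofHom φ.range.subtype,
    FGModuleCat.ofHom φ.rangeRestrict, ?_, ?_⟩
  · ext z
    obtain ⟨z, y, rfl⟩ := z
    exact hφ y
  · ext x
    rfl

theorem fgModuleCat_sum_apply {V W : FGModuleCat.{w} S} {n : ℕ} (f : Fin n → (V ⟶ W))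
    (x : V.carrier) : (∑ i, f i).hom.hom x = ∑ i, (f i).hom.hom x :=
  map_sum (AddMonoidHom.mk' (fun g : V ⟶ W => g.hom.hom x) fun _ _ => rfl) f Finset.univ

theorem hasFiniteBiproducts_fgModuleCat : HasFiniteBiproducts (FGModuleCat.{w} S) := by
  refine ⟨fun n => ⟨fun f => ?_⟩⟩
  let P : FGModuleCat.{w} S := FGModuleCat.of S (∀ i, (f i).carrier)
  let b : Bicone f := ⟨P, fun i => FGModuleCat.ofHom (LinearMap.proj i),
    fun i => FGModuleCat.ofHom (LinearMap.single S (fun i => (f i).carrier) i), fun i j => by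
      split_ifs with h
      · subst h
        ext x
        exact Pi.single_eq_same (M := fun i => (f i).carrier) i x
      · ext x
        exact Pi.single_eq_of_ne (M := fun i => (f i).carrier) (Ne.symm h) x⟩
  refine HasBiproduct.mk ⟨b, isBilimitOfTotal b ?_⟩
  refine FGModuleCat.hom_ext (LinearMap.ext fun x => ?_)
  rw [fgModuleCat_sum_apply]
  exact Finset.univ_sum_single (M := fun i => (f i).carrier) x

theorem finite_hom_fgModuleCat (V W : FGModuleCat.{w} S) : Module.Finite k (V ⟶ W) := by
  let : Module k V.carrier := Module.restrictScalars k S _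
  let : Module k W.carrier := Module.restrictScalars k S _
  have : IsScalarTower k S V.carrier := IsScalarTower.restrictScalars k S _
  have : IsScalarTower k S W.carrier := IsScalarTower.restrictScalars k S _
  have : Module.Finite k V.carrier := Module.Finite.trans S _
  have : Module.Finite k W.carrier := Module.Finite.trans S _
  let Φ : (V ⟶ W) →ₗ[k] (V.carrier →ₗ[k] W.carrier) :=
    { toFun := fun f => f.hom.hom.restrictScalars k
      map_add' := fun f g => rfl
      map_smul' := fun r f => rfl }
  refine Module.Finite.of_injective Φ fun f g h => ?_
  ext x
  exact LinearMap.congr_fun h x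

theorem isRetractGenerator_fgModuleCat [IsSemisimpleRing S] :
    IsRetractGenerator (FGModuleCat.of S S) := by
  intro V
  obtain ⟨n, f, hf⟩ := Module.Finite.exists_fin' S V.carrier
  obtain ⟨s, hs⟩ := IsSemisimpleModule.lifting_property f hf LinearMap.id
  refine ⟨n, fun i => FGModuleCat.ofHom (LinearMap.proj i ∘ₗ s),
    fun i => FGModuleCat.ofHom (f ∘ₗ LinearMap.single S (fun _ => S) i), ?_⟩
  ext x
  rw [fgModuleCat_sum_apply]
  change ∑ i, f (Pi.single i (s x i)) = x
  rw [← map_sum, Finset.univ_sum_single]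
  exact LinearMap.congr_fun hs x

theorem isSplitFinite_fgModuleCat [IsSemisimpleRing S] :
    IsSplitFinite k (FGModuleCat.{w} S) where
  finite_hom := finite_hom_fgModuleCat k S
  regular := isRegular_fgModuleCat S
  isIdempotentComplete := isIdempotentComplete_fgModuleCat S
  hasFiniteBiproducts := hasFiniteBiproducts_fgModuleCat S
  exists_generator := ⟨_, isRetractGenerator_fgModuleCat S⟩

end FGModules

section Transfer

variable {k : Type w} [Field k] {M : Type u} [Category.{v} M] [Preadditive M] [Linear k M]
  {N : Type u'} [Category.{v'} N] [Preadditive N] [Linear k N]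

theorem IsSplitFinite.of_isLinearEquivalence (h : IsSplitFinite k N) {F : M ⥤ N}
    (hF : IsLinearEquivalence k F) : IsSplitFinite k M := by
  have := hF.isEquivalence
  have := hF.additive
  have := hF.linear
  have := h.hasFiniteBiproducts
  refine ⟨fun X Y => ?_, h.regular.of_fullyFaithful F, ?_, ?_, ?_⟩
  · have := h.finite_hom (F.obj X) (F.obj Y)
    exact Module.Finite.of_injective (F.mapLinearMap k (X := X) (Y := Y)) F.map_injective
  · exact (Idempotents.isIdempotentComplete_iff_of_equivalence F.asEquivalence).2 h.isIdempotentComplete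
  · have : HasFiniteProducts M :=
      ⟨fun n => Adjunction.hasLimitsOfShape_of_equivalence F⟩
    exact HasFiniteBiproducts.of_hasFiniteProducts
  · obtain ⟨Q, hQ⟩ := h.exists_generator
    refine ⟨F.objPreimage Q, fun X => ?_⟩
    obtain ⟨n, a, b, hab⟩ := hQ (F.obj X)
    let e := F.objObjPreimageIso Q
    refine ⟨n, fun i => F.preimage (a i ≫ e.inv), fun i => F.preimage (e.hom ≫ b i),
      F.map_injective ?_⟩
    simpa [F.map_sum] using hab

theorem SemisimpleCategory.isSplitFinite [SemisimpleCategory k M] : IsSplitFinite k M := by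
  obtain ⟨R, _, _, _, _, F, hF⟩ := SemisimpleCategory.exists_equivalence (k := k) (M := M)
  have : Module.Finite k Rᵐᵒᵖ := Module.Finite.equiv (MulOpposite.opLinearEquiv k)
  exact (isSplitFinite_fgModuleCat k Rᵐᵒᵖ).of_isLinearEquivalence hF

end Transfer

/-! ### Reconstruction of a semisimple category from the endomorphism ring of a generator. -/

section Morita

variable {k : Type w} [Field k] {M : Type u} [Category.{v} M] [Preadditive M] [Linear k M]

/-- Coordinates embed `V` into a power of `k`. This brings `End Q` into the universe of `k`, as the
definition of a semisimple category requires. -/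
theorem small_of_finite (V : Type v) [AddCommGroup V] [Module k V] [Module.Finite k V] :
    Small.{w} V :=
  small_of_injective (Module.finBasis k V).equivFun.injective

/-- The Jacobson radical vanishes: if `x` lies in it and `x y x = x`, then `y x` is an idempotent of
the radical, so `1 - y x` has a left inverse `z`; multiplying `z (1 - y x) = 1` by `y x` gives `y x
= 0`, hence `x = 0`. -/
theorem isSemisimpleRing_of_regular (E : Type v) [Ring E] [Algebra k E] [Module.Finite k E]
    (h : ∀ x : E, ∃ y, x * y * x = x) : IsSemisimpleRing E := by
  have : IsArtinianRing E := IsArtinianRing.of_finite k E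
  rw [IsArtinianRing.isSemisimpleRing_iff_jacobson, eq_bot_iff]
  intro x hx
  obtain ⟨y, hy⟩ := h x
  rw [← Ideal.jacobson_bot] at hx
  obtain ⟨z, hz⟩ := Ideal.mem_jacobson_iff.1 hx (-y)
  have h1 : z - z * (y * x) = 1 := by
    rw [Ideal.mem_bot] at hz
    rw [← sub_eq_zero, ← hz]
    noncomm_ring
  have h2 : y * x = 0 := by
    calc y * x = (z - z * (y * x)) * (y * x) := by rw [h1, one_mul]
      _ = z * y * x - z * (y * (x * y * x)) := by noncomm_ring
      _ = 0 := by rw [hy]; noncomm_ring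
  rw [Ideal.mem_bot, ← hy, mul_assoc, h2, mul_zero]

variable (Q : M) [∀ X : M, Small.{w} (Q ⟶ X)]

/-- The morphisms from `Q` to `X`, in a prescribed universe. -/
def SmallHom (X : M) : Type w := Shrink.{w} (Q ⟶ X)

namespace SmallHom

noncomputable instance (X : M) : AddCommGroup (SmallHom Q X) :=
  inferInstanceAs (AddCommGroup (Shrink.{w} (Q ⟶ X)))

/-- The underlying morphism. -/
noncomputable def equiv (X : M) : SmallHom Q X ≃+ (Q ⟶ X) := Shrink.addEquiv

variable {R : Type w} [Ring R] [Algebra k R] (φ : R ≃ₐ[k] End Q)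

/-- Morphisms out of `Q` form a right module over `End Q`. -/
@[reducible] noncomputable def module (X : M) : Module Rᵐᵒᵖ (SmallHom Q X) where
  smul r x := (equiv Q X).symm (φ r.unop ≫ equiv Q X x)
  one_smul x := (equiv Q X).injective (by
    change equiv Q X ((equiv Q X).symm (φ 1 ≫ equiv Q X x)) = _
    rw [map_one, AddEquiv.apply_symm_apply]
    exact Category.id_comp _)
  mul_smul r s x := (equiv Q X).injective (by
    change equiv Q X ((equiv Q X).symm (φ (s.unop * r.unop) ≫ equiv Q X x)) =
      equiv Q X ((equiv Q X).symm (φ r.unop ≫ equiv Q X ((equiv Q X).symm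
        (φ s.unop ≫ equiv Q X x))))
    simp only [map_mul, AddEquiv.apply_symm_apply]
    exact Category.assoc _ _ _)
  smul_zero r := (equiv Q X).injective (by
    change equiv Q X ((equiv Q X).symm (φ r.unop ≫ equiv Q X 0)) = equiv Q X 0
    simp)
  smul_add r x y := (equiv Q X).injective (by
    change equiv Q X ((equiv Q X).symm (φ r.unop ≫ equiv Q X (x + y))) =
      equiv Q X ((equiv Q X).symm (φ r.unop ≫ equiv Q X x) +
        (equiv Q X).symm (φ r.unop ≫ equiv Q X y))
    simp)
  add_smul r s x := (equiv Q X).injective (by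
    change equiv Q X ((equiv Q X).symm (φ (r.unop + s.unop) ≫ equiv Q X x)) =
      equiv Q X ((equiv Q X).symm (φ r.unop ≫ equiv Q X x) +
        (equiv Q X).symm (φ s.unop ≫ equiv Q X x))
    simp only [map_add, AddEquiv.apply_symm_apply]
    exact Preadditive.add_comp _ _ _ _ _ _)
  zero_smul x := (equiv Q X).injective (by
    change equiv Q X ((equiv Q X).symm (φ 0 ≫ equiv Q X x)) = equiv Q X 0
    simp only [map_zero, AddEquiv.apply_symm_apply]
    exact zero_comp)

theorem equiv_smul (X : M) (r : Rᵐᵒᵖ) (x : SmallHom Q X) :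
    letI := module Q φ X
    equiv Q X (r • x) = φ r.unop ≫ equiv Q X x :=
  (equiv Q X).apply_symm_apply _

theorem module_finite [∀ X : M, Module.Finite k (Q ⟶ X)] (X : M) :
    letI := module Q φ X
    Module.Finite Rᵐᵒᵖ (SmallHom Q X) := by
  let := module Q φ X
  let : Module k (SmallHom Q X) := Module.restrictScalars k Rᵐᵒᵖ _
  have : IsScalarTower k Rᵐᵒᵖ (SmallHom Q X) := IsScalarTower.restrictScalars k Rᵐᵒᵖ _
  have h : ∀ (r : k) (x : SmallHom Q X), equiv Q X (r • x) = r • equiv Q X x := by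
    intro r x
    change equiv Q X (algebraMap k Rᵐᵒᵖ r • x) = _
    rw [equiv_smul, MulOpposite.algebraMap_apply, MulOpposite.unop_op, AlgEquiv.commutes,
      Algebra.algebraMap_eq_smul_one]
    exact (Linear.smul_comp _ _ _ _ _ _).trans (congrArg _ (Category.id_comp _))
  let e : SmallHom Q X ≃ₗ[k] (Q ⟶ X) := { equiv Q X with map_smul' := h }
  have : Module.Finite k (SmallHom Q X) := Module.Finite.equiv e.symm
  exact Module.Finite.of_restrictScalars_finite k Rᵐᵒᵖ _

end SmallHom

variable {R : Type w} [Ring R] [Algebra k R] (φ : R ≃ₐ[k] End Q)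
  [∀ X : M, Module.Finite k (Q ⟶ X)]

/-- The morphisms from `Q` to `X`, as a right module over `R ≃ End Q`. -/
noncomputable def homModule (X : M) : FGModuleCat.{w} Rᵐᵒᵖ :=
  letI := SmallHom.module Q φ X
  haveI := SmallHom.module_finite Q φ X
  FGModuleCat.of Rᵐᵒᵖ (SmallHom Q X)

/-- Composition with `f`, as a morphism of right modules. -/
noncomputable def homModuleMap {X Y : M} (f : X ⟶ Y) : homModule Q φ X ⟶ homModule Q φ Y :=
  letI := SmallHom.module Q φ X
  letI := SmallHom.module Q φ Y
  haveI := SmallHom.module_finite Q φ X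
  haveI := SmallHom.module_finite Q φ Y
  FGModuleCat.ofHom
    { toFun := fun x => (SmallHom.equiv Q Y).symm (SmallHom.equiv Q X x ≫ f)
      map_add' := fun x y => by simp
      map_smul' := fun r x => (SmallHom.equiv Q Y).injective (by
        simp [SmallHom.equiv_smul]) }

/-- The functor of morphisms out of `Q`, valued in right modules over `R ≃ End Q`. -/
noncomputable def homFunctor : M ⥤ FGModuleCat.{w} Rᵐᵒᵖ where
  obj := homModule Q φ
  map := homModuleMap Q φ
  map_id X := by
    ext x
    change (SmallHom.equiv Q X).symm (SmallHom.equiv Q X x ≫ 𝟙 X) = x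
    rw [Category.comp_id]
    exact (SmallHom.equiv Q X).symm_apply_apply x
  map_comp {X Y Z} f g := by
    ext x
    change (SmallHom.equiv Q Z).symm (SmallHom.equiv Q X x ≫ f ≫ g) =
      (SmallHom.equiv Q Z).symm (SmallHom.equiv Q Y ((SmallHom.equiv Q Y).symm
        (SmallHom.equiv Q X x ≫ f)) ≫ g)
    simp

theorem homFunctor_map_apply {X Y : M} (f : X ⟶ Y) (x : SmallHom Q X) :
    SmallHom.equiv Q Y (((homFunctor Q φ).map f).hom.hom x) = SmallHom.equiv Q X x ≫ f :=
  (SmallHom.equiv Q Y).apply_symm_apply _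

instance : (homFunctor Q φ).Additive where
  map_add {X Y f g} := by
    ext x
    refine (SmallHom.equiv Q Y).injective ?_
    refine (homFunctor_map_apply Q φ (f + g) x).trans ((Preadditive.comp_add _ _ _ _ _ _).trans ?_)
    rw [← homFunctor_map_apply Q φ f x, ← homFunctor_map_apply Q φ g x]
    exact ((SmallHom.equiv Q Y).map_add _ _).symm

instance : (homFunctor Q φ).Linear k where
  map_smul {X Y} f r := by
    ext x
    refine (SmallHom.equiv Q Y).injective ?_
    refine (homFunctor_map_apply Q φ (r • f) x).trans ((Linear.comp_smul _ _ _ _ _ _).trans ?_)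
    rw [← homFunctor_map_apply Q φ f x]
    let := SmallHom.module Q φ Y
    refine Eq.symm ((SmallHom.equiv_smul Q φ Y (algebraMap k Rᵐᵒᵖ r) _).trans ?_)
    rw [MulOpposite.algebraMap_apply, MulOpposite.unop_op, AlgEquiv.commutes,
      Algebra.algebraMap_eq_smul_one]
    exact (Linear.smul_comp _ _ _ _ _ _).trans (congrArg _ (Category.id_comp _))

theorem homFunctor_faithful (hQ : IsRetractGenerator Q) : (homFunctor Q φ).Faithful where
  map_injective {X Y f g} h := by
    obtain ⟨n, a, b, hab⟩ := hQ X
    rw [← Category.id_comp f, ← Category.id_comp g, ← hab, Preadditive.sum_comp,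
      Preadditive.sum_comp]
    refine Finset.sum_congr rfl fun i _ => ?_
    rw [Category.assoc, Category.assoc]
    congr 1
    have h1 := homFunctor_map_apply Q φ f ((SmallHom.equiv Q X).symm (b i))
    rw [h, homFunctor_map_apply, AddEquiv.apply_symm_apply] at h1
    exact h1.symm

/-- If `∑ a_i ≫ b_i = 𝟙 X`, then every `x : Q ⟶ X` is a combination of the `b_i` with coefficients
`x ≫ a_i` in `End Q`. A module map is therefore determined by its values on the `b_i`, and these
assemble into a morphism. -/
theorem homFunctor_full (hQ : IsRetractGenerator Q) : (homFunctor Q φ).Full where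
  map_surjective {X Y} ψ := by
    obtain ⟨n, a, b, hab⟩ := hQ X
    let := SmallHom.module Q φ X
    let := SmallHom.module Q φ Y
    let ψ' : SmallHom Q X →ₗ[Rᵐᵒᵖ] SmallHom Q Y := ψ.hom.hom
    refine ⟨∑ i, a i ≫ SmallHom.equiv Q Y (ψ' ((SmallHom.equiv Q X).symm (b i))), ?_⟩
    ext x
    refine (SmallHom.equiv Q Y).injective ?_
    refine (homFunctor_map_apply Q φ _ x).trans ?_
    change _ = SmallHom.equiv Q Y (ψ' x)
    have hx : x = ∑ i, MulOpposite.op (φ.symm (SmallHom.equiv Q X x ≫ a i)) •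
        (SmallHom.equiv Q X).symm (b i) := by
      refine (SmallHom.equiv Q X).injective ?_
      simp only [map_sum, SmallHom.equiv_smul, MulOpposite.unop_op, AlgEquiv.apply_symm_apply,
        AddEquiv.apply_symm_apply, Category.assoc]
      rw [← Preadditive.comp_sum, hab, Category.comp_id]
    conv_rhs => rw [hx]
    simp only [map_sum, map_smul, SmallHom.equiv_smul, MulOpposite.unop_op,
      AlgEquiv.apply_symm_apply, Preadditive.comp_sum, Category.assoc]

/-- A finitely generated `V` is a summand of a free module, and free modules come from powers of
`Q`. The corresponding idempotent lifts to the power of `Q` by full faithfulness and splits there.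
-/
theorem homFunctor_essSurj (hQ : IsRetractGenerator Q) [IsSemisimpleRing R]
    [IsIdempotentComplete M] [HasFiniteBiproducts M] : (homFunctor Q φ).EssSurj where
  mem_essImage V := by
    have := homFunctor_faithful Q φ hQ
    have := homFunctor_full Q φ hQ
    obtain ⟨n, f, hf⟩ := Module.Finite.exists_fin' Rᵐᵒᵖ V.carrier
    let X : M := ⨁ fun _ : Fin n => Q
    let := SmallHom.module Q φ X
    let c : Fin n → (SmallHom Q X →ₗ[Rᵐᵒᵖ] Rᵐᵒᵖ) := fun i =>
      { toFun := fun x => MulOpposite.op (φ.symm (SmallHom.equiv Q X x ≫ biproduct.π _ i))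
        map_add' := fun x y => by
          rw [map_add, Preadditive.add_comp]
          exact congrArg MulOpposite.op (map_add φ.symm _ _)
        map_smul' := fun r x => by
          rw [SmallHom.equiv_smul, Category.assoc]
          refine MulOpposite.unop_injective (φ.injective ?_)
          simp only [MulOpposite.unop_op, AlgEquiv.apply_symm_apply, RingHom.id_apply,
            smul_eq_mul, MulOpposite.unop_mul, map_mul]
          rfl }
    let q : SmallHom Q X →ₗ[Rᵐᵒᵖ] V.carrier := f ∘ₗ LinearMap.pi c
    have hq : Function.Surjective q := by
      refine hf.comp fun r => ⟨(SmallHom.equiv Q X).symm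
        (biproduct.lift fun i => φ (r i).unop), ?_⟩
      ext i
      change MulOpposite.op (φ.symm _) = r i
      refine MulOpposite.unop_injective (φ.injective ?_)
      simp
    obtain ⟨s, hs⟩ := IsSemisimpleModule.lifting_property q hq LinearMap.id
    let g : (homFunctor Q φ).obj X ⟶ V := ConcreteCategory.ofHom q
    let t : V ⟶ (homFunctor Q φ).obj X := ConcreteCategory.ofHom s
    have htg : t ≫ g = 𝟙 V := by
      ext x
      exact LinearMap.congr_fun hs x
    -- The idempotent cutting out `V` comes from an idempotent `p` of `X`, whose image `Y` is the
    -- required preimage.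
    obtain ⟨p, hp⟩ := (homFunctor Q φ).map_surjective (g ≫ t)
    have hpp : p ≫ p = p := (homFunctor Q φ).map_injective (by
      rw [Functor.map_comp, hp, Category.assoc, reassoc_of% htg])
    obtain ⟨Y, i, e, hie, hei⟩ := IsIdempotentComplete.idempotents_split X p hpp
    refine ⟨Y, ⟨⟨(homFunctor Q φ).map i ≫ g, t ≫ (homFunctor Q φ).map e, ?_, ?_⟩⟩⟩
    · rw [Category.assoc, ← Category.assoc g, ← hp, ← Functor.map_comp, ← Functor.map_comp,
        ← hei, Category.assoc, hie, Category.comp_id, hie, CategoryTheory.Functor.map_id]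
    · rw [Category.assoc, ← Category.assoc ((homFunctor Q φ).map e), ← Functor.map_comp, hei, hp,
        Category.assoc, htg, Category.comp_id, htg]

end Morita

/-- Converse of `SemisimpleCategory.isSplitFinite`; the algebra is `End Q`, semisimple because
regularity of the category makes it a von Neumann regular ring. -/
theorem IsSplitFinite.semisimpleCategory {k : Type w} [Field k] {M : Type u} [Category.{v} M]
    [Preadditive M] [Linear k M] (h : IsSplitFinite k M) : SemisimpleCategory k M := by
  obtain ⟨Q, hQ⟩ := h.exists_generator
  have := h.finite_hom
  have := h.isIdempotentComplete
  have := h.hasFiniteBiproducts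
  have : ∀ X : M, Small.{w} (Q ⟶ X) := fun X => small_of_finite (k := k) _
  have : Small.{w} (End Q) := this Q
  have : Module.Finite k (End Q) := h.finite_hom Q Q
  have : IsSemisimpleRing (End Q) := isSemisimpleRing_of_regular (k := k) _ fun x => by
    obtain ⟨y, hy⟩ := h.regular x
    exact ⟨y, hy⟩
  let φ := Shrink.algEquiv k (End Q)
  have : Module.Finite k (Shrink.{w} (End Q)) := Module.Finite.equiv φ.symm.toLinearEquiv
  have : IsSemisimpleRing (Shrink.{w} (End Q)) := φ.symm.toRingEquiv.isSemisimpleRing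
  refine ⟨Shrink.{w} (End Q), inferInstance, inferInstance, inferInstance, inferInstance,
    homFunctor Q φ, ⟨?_, inferInstance, inferInstance⟩⟩
  exact ⟨homFunctor_faithful Q φ hQ, homFunctor_full Q φ hQ, homFunctor_essSurj Q φ hQ⟩

end MultiFusion

namespace MultiFusion

namespace RMod

/-! ### Free modules, points of an algebra and multiplication by points. -/

section Points

variable {C : Type u} [Category.{v} C] [MonoidalCategory C] {A : Mon C}

/-- A reducible form of `RMod.regular`. -/
abbrev self (A : Mon C) : RMod A where
  X := A.X
  act := μ[A.X]
  act_one := by simp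
  act_mul := by simp

/-- A reducible form of `RMod.tensor`. -/
abbrev ltensor (c : C) (x : RMod A) : RMod A where
  X := c ⊗ x.X
  act := (α_ c x.X A.X).hom ≫ c ◁ x.act
  act_one := (tensor c x).act_one
  act_mul := (tensor c x).act_mul

/-- The action of `c` on a morphism of modules. -/
@[simps]
def whisker (c : C) {M N : RMod A} (f : M ⟶ N) : ltensor c M ⟶ ltensor c N where
  hom := c ◁ f.hom
  act_hom := by
    rw [Category.assoc, ← MonoidalCategory.whiskerLeft_comp, f.act_hom]
    simp

@[simp] theorem whisker_id (c : C) (M : RMod A) : whisker c (𝟙 M) = 𝟙 _ := hom_ext (by simp)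

@[simp] theorem whisker_comp (c : C) {M N K : RMod A} (f : M ⟶ N) (g : N ⟶ K) :
    whisker c (f ≫ g) = whisker c f ≫ whisker c g := hom_ext (by simp)

/-- The action of a morphism on a module. -/
@[simps]
def whiskerHom {c c' : C} (f : c ⟶ c') (M : RMod A) : ltensor c M ⟶ ltensor c' M where
  hom := f ▷ M.X
  act_hom := by simp [whisker_exchange]

/-- The associativity isomorphism of the action. -/
abbrev tensorAssoc (c c' : C) (M : RMod A) : ltensor (c ⊗ c') M ≅ ltensor c (ltensor c' M) :=
  isoMk (α_ c c' M.X) (by simp)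

/-- The morphism `c ⊗ A ⟶ M` of modules given by a morphism `c ⟶ M`. -/
@[simps]
def freeDesc {c : C} {M : RMod A} (x : c ⟶ M.X) : ltensor c (self A) ⟶ M where
  hom := x ▷ A.X ≫ M.act
  act_hom := by
    rw [Category.assoc, whisker_exchange_assoc, M.act_mul]
    simp

/-- The unit of the free module. -/
def freeUnit (A : Mon C) (c : C) : c ⟶ c ⊗ A.X := (ρ_ c).inv ≫ c ◁ η[A.X]

@[simp]
theorem freeUnit_freeDesc {c : C} {M : RMod A} (x : c ⟶ M.X) :
    freeUnit A c ≫ x ▷ A.X ≫ M.act = x := by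
  rw [freeUnit, Category.assoc, whisker_exchange_assoc, M.act_one]
  simp

/-- With `freeUnit_freeDesc` this is the adjunction between `c ↦ c ⊗ A` and the forgetful functor.
-/
theorem freeDesc_freeUnit {c : C} {M : RMod A} (f : ltensor c (self A) ⟶ M) :
    freeDesc (freeUnit A c ≫ f.hom) = f := by
  apply hom_ext
  rw [freeDesc_hom, comp_whiskerRight, Category.assoc, ← f.act_hom, freeUnit]
  simp only [comp_whiskerRight, whisker_assoc, Category.assoc, Iso.inv_hom_id_assoc]
  rw [← MonoidalCategory.whiskerLeft_comp_assoc, MonObj.one_mul]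
  simp

theorem free_hom_ext {c : C} {M : RMod A} {f g : ltensor c (self A) ⟶ M}
    (h : freeUnit A c ≫ f.hom = freeUnit A c ≫ g.hom) : f = g := by
  rw [← freeDesc_freeUnit f, h, freeDesc_freeUnit]

/-- The morphism `A ⟶ M` of modules given by a point of `M`. -/
@[simps]
def ofPoint {M : RMod A} (x : 𝟙_ C ⟶ M.X) : self A ⟶ M where
  hom := (λ_ A.X).inv ≫ x ▷ A.X ≫ M.act
  act_hom := by
    simp only [comp_whiskerRight, Category.assoc]
    rw [leftUnitor_inv_naturality_assoc, whisker_exchange_assoc, M.act_mul]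
    simp

/-- The point given by a morphism out of `A`. -/
def point {M : RMod A} (f : self A ⟶ M) : 𝟙_ C ⟶ M.X := η[A.X] ≫ f.hom

@[simp] theorem point_ofPoint {M : RMod A} (x : 𝟙_ C ⟶ M.X) : point (ofPoint x) = x := by
  rw [point, ofPoint_hom, leftUnitor_inv_naturality_assoc, whisker_exchange_assoc, M.act_one]
  simp [unitors_inv_equal]

@[simp] theorem ofPoint_point {M : RMod A} (f : self A ⟶ M) : ofPoint (point f) = f := by
  apply hom_ext
  rw [ofPoint_hom, point, comp_whiskerRight, Category.assoc, ← f.act_hom]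
  simp

theorem point_comp {M N : RMod A} (f : self A ⟶ M) (g : M ⟶ N) : point (f ≫ g) = point f ≫ g.hom := by
  simp [point]

theorem ofPoint_comp {M N : RMod A} (x : 𝟙_ C ⟶ M.X) (g : M ⟶ N) :
    ofPoint x ≫ g = ofPoint (x ≫ g.hom) := by
  rw [← ofPoint_point (ofPoint x ≫ g), point_comp, point_ofPoint]

/-- Right multiplication by a point of `A`. -/
def mulRight (M : RMod A) (e : 𝟙_ C ⟶ A.X) : M.X ⟶ M.X := (ρ_ M.X).inv ≫ M.X ◁ e ≫ M.act

theorem mulRight_hom {M N : RMod A} (f : M ⟶ N) (e : 𝟙_ C ⟶ A.X) :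
    M.mulRight e ≫ f.hom = f.hom ≫ N.mulRight e := by
  simp only [mulRight, Category.assoc, f.act_hom]
  rw [whisker_exchange_assoc, rightUnitor_inv_naturality_assoc]

@[simp] theorem mulRight_one (M : RMod A) : M.mulRight η[A.X] = 𝟙 _ := by
  simp [mulRight, M.act_one]

theorem act_mulRight (M : RMod A) (e : 𝟙_ C ⟶ A.X) :
    M.act ≫ M.mulRight e = M.X ◁ (self A).mulRight e ≫ M.act := by
  simp only [mulRight]
  rw [MonoidalCategory.whiskerLeft_comp, MonoidalCategory.whiskerLeft_comp, Category.assoc,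
    Category.assoc, M.act_mul, rightUnitor_inv_naturality_assoc, ← whisker_exchange_assoc]
  simp

/-- Associativity in the form `(m e) a = m (e a)`: `ofPoint e` is left multiplication by `e` on `A`.
-/
theorem mulRight_whiskerRight_act (M : RMod A) (e : 𝟙_ C ⟶ A.X) :
    M.mulRight e ▷ A.X ≫ M.act = M.X ◁ (ofPoint (M := self A) e).hom ≫ M.act := by
  simp only [mulRight, ofPoint_hom]
  simp [M.act_mul]

theorem mulRight_mulRight (M : RMod A) (e e' : 𝟙_ C ⟶ A.X) :
    M.mulRight e ≫ M.mulRight e' = M.mulRight (e ≫ (self A).mulRight e') := by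
  conv_lhs => rw [mulRight]
  simp only [Category.assoc, act_mulRight]
  simp [mulRight]

theorem mulRight_ltensor (c : C) (M : RMod A) (e : 𝟙_ C ⟶ A.X) :
    (ltensor c M).mulRight e = c ◁ M.mulRight e := by
  simp [mulRight]

@[simp]
theorem point_mulRight (M : RMod A) (f : self A ⟶ M) (e : 𝟙_ C ⟶ A.X) :
    point f ≫ M.mulRight e = e ≫ f.hom := by
  rw [point, Category.assoc, ← mulRight_hom, mulRight]
  simp only [← Category.assoc]
  congr 1
  simp only [Category.assoc]
  rw [rightUnitor_inv_naturality_assoc, ← whisker_exchange_assoc]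
  simp [← unitors_inv_equal]

@[simp]
theorem one_mulRight (e : 𝟙_ C ⟶ A.X) : η[A.X] ≫ (self A).mulRight e = e := by
  have := point_mulRight (self A) (𝟙 (self A)) e
  simpa [point] using this

/-- The action of `A` on `N`, as a morphism of modules. -/
@[simps]
def actHom (N : RMod A) : ltensor N.X (self A) ⟶ N where
  hom := N.act
  act_hom := by
    rw [Category.assoc, N.act_mul]
    simp

@[simp] theorem freeUnit_act (N : RMod A) : freeUnit A N.X ≫ N.act = 𝟙 _ := by
  simp [freeUnit, N.act_one]

theorem freeUnit_whiskerRight_act (c : C) :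
    freeUnit A c ▷ A.X ≫ (α_ c A.X A.X).hom ≫ c ◁ μ[A.X] = 𝟙 _ := by
  have := congrArg Hom.hom (freeDesc_freeUnit (𝟙 (ltensor c (self A))))
  simpa using this

theorem isIdempotentComplete [IsIdempotentComplete C] : IsIdempotentComplete (RMod A) := by
  refine ⟨fun M p hp => ?_⟩
  have hp' : p.hom ≫ p.hom = p.hom := congrArg Hom.hom hp
  obtain ⟨Y, i, e, hie, hei⟩ := IsIdempotentComplete.idempotents_split M.X p.hom hp'
  have hi : i ≫ p.hom = i := by rw [← hei, ← Category.assoc, hie, Category.id_comp]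
  have he : p.hom ≫ e = e := by rw [← hei, Category.assoc, hie, Category.comp_id]
  have key : i ▷ A.X ≫ M.act ≫ p.hom = i ▷ A.X ≫ M.act := by
    rw [p.act_hom, ← comp_whiskerRight_assoc, hi]
  let N : RMod A :=
    { X := Y
      act := i ▷ A.X ≫ M.act ≫ e
      act_one := by
        rw [whisker_exchange_assoc, reassoc_of% M.act_one]
        simp [hie]
      act_mul := by
        simp only [comp_whiskerRight, Category.assoc]
        rw [whisker_exchange_assoc, reassoc_of% M.act_mul, ← comp_whiskerRight_assoc e i, hei,
          ← reassoc_of% p.act_hom, he]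
        simp }
  refine ⟨N, ⟨i, ?_⟩, ⟨e, ?_⟩, hom_ext hie, hom_ext hei⟩
  · change (i ▷ A.X ≫ M.act ≫ e) ≫ i = i ▷ A.X ≫ M.act
    rw [Category.assoc, Category.assoc, hei, key]
  · change M.act ≫ e = e ▷ A.X ≫ i ▷ A.X ≫ M.act ≫ e
    rw [← comp_whiskerRight_assoc, hei, ← reassoc_of% p.act_hom, he]

end Points

end RMod

end MultiFusion

namespace MultiFusion

namespace RMod

/-! ### Regularity of all modules from regularity of free modules. -/

section Additive

variable {C : Type u} [Category.{v} C] [MonoidalCategory C] [Preadditive C]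
  [MonoidalPreadditive C] {A : Mon C}

/-- The underlying morphism, as an additive map. -/
def homAddHom (M N : RMod A) : (M ⟶ N) →+ (M.X ⟶ N.X) := AddMonoidHom.mk' (fun f => f.hom) fun _ _ => rfl

@[simp] theorem sum_hom {M N : RMod A} {J : Type*} (s : Finset J) (f : J → (M ⟶ N)) :
    (∑ i ∈ s, f i).hom = ∑ i ∈ s, (f i).hom := map_sum (homAddHom M N) f s

theorem whiskerHom_sum {J : Type*} (s : Finset J) {c c' : C} (f : J → (c ⟶ c')) (M : RMod A) :
    whiskerHom (∑ i ∈ s, f i) M = ∑ i ∈ s, whiskerHom (f i) M :=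
  hom_ext (by rw [sum_hom]; exact sum_whiskerRight _ _ _)

theorem mulRight_add (M : RMod A) (e e' : 𝟙_ C ⟶ A.X) :
    M.mulRight (e + e') = M.mulRight e + M.mulRight e' := by
  simp [mulRight]

/-- Right multiplication, as an additive map. -/
def mulRightHom (M : RMod A) : (𝟙_ C ⟶ A.X) →+ (M.X ⟶ M.X) :=
  AddMonoidHom.mk' M.mulRight M.mulRight_add

@[simp] theorem mulRight_zero (M : RMod A) : M.mulRight 0 = 0 := map_zero M.mulRightHom

theorem mulRight_sum (M : RMod A) {J : Type*} (s : Finset J) (e : J → (𝟙_ C ⟶ A.X)) :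
    M.mulRight (∑ i ∈ s, e i) = ∑ i ∈ s, M.mulRight (e i) := map_sum M.mulRightHom e s

/-- Every morphism between free modules is regular. -/
def IsFreeRegular (A : Mon C) : Prop :=
  ∀ (c c' : C) (f : ltensor c (self A) ⟶ ltensor c' (self A)), ∃ g, f ≫ g ≫ f = f

/-- The action `N ⊗ A ⟶ N` is the cokernel of a map `f` between free modules, the start of the bar
resolution. If `f` is regular, its cokernel splits off, and this splitting is the section. -/
theorem IsFreeRegular.exists_section_actHom (h : IsFreeRegular A) (N : RMod A) :
    ∃ s : N ⟶ ltensor N.X (self A), s ≫ actHom N = 𝟙 N := by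
  -- On elements, `n ⊗ a ⊗ b ↦ n a ⊗ b - n ⊗ a b`.
  let f : ltensor (N.X ⊗ A.X) (self A) ⟶ ltensor N.X (self A) :=
    freeDesc (M := ltensor N.X (self A)) (N.act ≫ freeUnit A N.X - 𝟙 _)
  have hu : ∀ {K : RMod A} (t : ltensor N.X (self A) ⟶ K), freeUnit A (N.X ⊗ A.X) ≫ (f ≫ t).hom =
      N.act ≫ freeUnit A N.X ≫ t.hom - t.hom := by
    intro K t
    have h1 := freeUnit_freeDesc (M := ltensor N.X (self A)) (N.act ≫ freeUnit A N.X - 𝟙 _)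
    have h2 : freeUnit A (N.X ⊗ A.X) ≫ f.hom = N.act ≫ freeUnit A N.X - 𝟙 _ := h1
    rw [comp_hom, ← Category.assoc, h2, Preadditive.sub_comp, Category.assoc, Category.id_comp]
  have hf : f ≫ actHom N = 0 := free_hom_ext (by
    rw [hu]
    simp)
  obtain ⟨g, hg⟩ := h _ _ f
  let t : ltensor N.X (self A) ⟶ ltensor N.X (self A) := 𝟙 _ - g ≫ f
  have ht : f ≫ t = 0 := by
    simp only [t, Preadditive.comp_sub, Category.comp_id, hg, sub_self]
  -- Since `f ≫ t = 0`, the map `t` takes equal values on `n a ⊗ 1` and `n ⊗ a`. It thus factors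
  -- through the action, and the induced map on `N` is the section.
  have hs : N.act ≫ freeUnit A N.X ≫ t.hom = t.hom := by
    have := hu t
    rw [ht, zero_hom, comp_zero] at this
    exact (sub_eq_zero.1 this.symm)
  refine ⟨⟨freeUnit A N.X ≫ t.hom, ?_⟩, hom_ext ?_⟩
  · rw [hs, comp_whiskerRight, Category.assoc, ← t.act_hom,
      ← Category.assoc, freeUnit_whiskerRight_act, Category.id_comp]
  · have : t ≫ actHom N = actHom N := by
      simp only [t, Preadditive.sub_comp, Category.id_comp, Category.assoc, hf, comp_zero, sub_zero]
    have h2 := congrArg (fun q => freeUnit A N.X ≫ Hom.hom q) this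
    simpa using h2

theorem IsFreeRegular.isRegular (h : IsFreeRegular A) : IsRegular (RMod A) := by
  intro M N f
  obtain ⟨s, hs⟩ := h.exists_section_actHom M
  obtain ⟨t, ht⟩ := h.exists_section_actHom N
  exact exists_regular_of_retract hs ht f (h _ _ _)

theorem hasFiniteBiproducts [HasFiniteBiproducts C] : HasFiniteBiproducts (RMod A) := by
  refine ⟨fun n => ⟨fun f => ?_⟩⟩
  let X := fun i => (f i).X
  let P : RMod A :=
    { X := ⨁ X
      act := biproduct.lift fun j => biproduct.π X j ▷ A.X ≫ (f j).act
      act_one := by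
        refine biproduct.hom_ext _ _ fun j => ?_
        rw [Category.assoc, biproduct.lift_π, whisker_exchange_assoc, (f j).act_one,
          rightUnitor_naturality]
      act_mul := by
        refine biproduct.hom_ext _ _ fun j => ?_
        simp only [Category.assoc, biproduct.lift_π]
        rw [whisker_exchange_assoc, (f j).act_mul, ← comp_whiskerRight_assoc, biproduct.lift_π]
        simp }
  let p : ∀ j, P ⟶ f j := fun j => ⟨biproduct.π X j, biproduct.lift_π _ _⟩
  let q : ∀ j, f j ⟶ P := fun j => ⟨biproduct.ι X j, by
    refine biproduct.hom_ext _ _ fun i => ?_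
    rw [Category.assoc, Category.assoc, biproduct.lift_π, ← comp_whiskerRight_assoc]
    by_cases h : j = i
    · subst h
      simp [X]
    · rw [biproduct.ι_π_ne _ h]
      simp⟩
  refine HasBiproduct.mk ⟨⟨P, p, q, fun i j => hom_ext ?_⟩, isBilimitOfTotal _ (hom_ext ?_)⟩
  · split_ifs with h
    · subst h
      exact biproduct.ι_π_self X i
    · exact biproduct.ι_π_ne X h
  rw [sum_hom]
  exact biproduct.total

end Additive

section Linear

variable {k : Type w} [Field k] {C : Type u} [Category.{v} C] [MonoidalCategory C] [Preadditive C]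
  [MonoidalPreadditive C] [Linear k C] [MonoidalLinear k C] {A : Mon C}

/-- As `N` is a retract of `N ⊗ A`, a generator `Q` of `C` yields the generator `Q ⊗ A` of modules.
-/
theorem IsFreeRegular.isSplitFinite (hC : IsSplitFinite k C)
    (h : IsFreeRegular A) : IsSplitFinite k (RMod A) := by
  have := hC.isIdempotentComplete
  have := hC.hasFiniteBiproducts
  refine ⟨fun M N => ?_, h.isRegular, isIdempotentComplete, hasFiniteBiproducts, ?_⟩
  · have := hC.finite_hom M.X N.X
    let Φ : (M ⟶ N) →ₗ[k] (M.X ⟶ N.X) :=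
      { toFun := fun f => f.hom
        map_add' := fun _ _ => rfl
        map_smul' := fun _ _ => rfl }
    exact Module.Finite.of_injective Φ fun f g => hom_ext
  · obtain ⟨Q, hQ⟩ := hC.exists_generator
    refine ⟨ltensor Q (self A), fun N => ?_⟩
    obtain ⟨n, a, b, hab⟩ := hQ N.X
    obtain ⟨s, hs⟩ := h.exists_section_actHom N
    refine ⟨n, fun i => s ≫ whiskerHom (a i) _, fun i => whiskerHom (b i) _ ≫ actHom N, ?_⟩
    calc _ = s ≫ whiskerHom (∑ i, a i ≫ b i) (self A) ≫ actHom N := by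
          rw [whiskerHom_sum, Preadditive.sum_comp, Preadditive.comp_sum]
          refine Finset.sum_congr rfl fun i _ => hom_ext ?_
          simp
      _ = s ≫ actHom N := by
          rw [hab]
          congr 1
          apply hom_ext
          simp
      _ = 𝟙 N := hs

-- The working criterion: all later semisimplicity claims are checked on morphisms between free
-- modules, and no longer mention `k`.
variable (k) in
theorem isSemisimpleAlgebra_iff [SemisimpleCategory k C] :
    IsSemisimpleAlgebra k A ↔ IsFreeRegular A := by
  refine ⟨fun h => ?_, fun h => ?_⟩
  · have : SemisimpleCategory k (RMod A) := h
    have h2 : IsSplitFinite k (RMod A) := SemisimpleCategory.isSplitFinite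
    exact fun c c' f => h2.regular f
  · exact (h.isSplitFinite (k := k) SemisimpleCategory.isSplitFinite).semisimpleCategory

end Linear

/-! ### Modules over a semisimple algebra form a finite left module category. -/

section Finite

open MonoidalLeftAction

variable {C : Type u} [Category.{v} C] [MonoidalCategory C] {A : Mon C}

/-- The forgetful functor from modules. -/
def forget (A : Mon C) : RMod A ⥤ C where
  obj M := M.X
  map f := f.hom

/-- Because `- ⊗ A` preserves the colimit, compatibility of the induced map with the actions can be
tested on the legs of the cocone. -/
theorem forget_reflectsColimits [∀ X : C, PreservesColimitsOfSize.{0, 0} (tensorRight X)]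
    {J : Type} [SmallCategory J] (K : J ⥤ RMod A) : ReflectsColimit K (forget A) := by
  refine ⟨fun {t} ht => ⟨?_⟩⟩
  have ht' := isColimitOfPreserves (tensorRight A.X) ht
  have key : ∀ (s : Cocone K) (d : t.pt.X ⟶ s.pt.X)
      (_ : ∀ j, Hom.hom (x := K.obj j) (y := t.pt) (t.ι.app j) ≫ d =
        Hom.hom (x := K.obj j) (y := s.pt) (s.ι.app j)), t.pt.act ≫ d = d ▷ A.X ≫ s.pt.act := by
    intro s d hd
    refine ht'.hom_ext fun j => ?_
    let f : K.obj j ⟶ t.pt := t.ι.app j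
    let g : K.obj j ⟶ s.pt := s.ι.app j
    have hj : f.hom ≫ d = g.hom := hd j
    change f.hom ▷ A.X ≫ t.pt.act ≫ d = f.hom ▷ A.X ≫ d ▷ A.X ≫ s.pt.act
    rw [← reassoc_of% f.act_hom, hj, g.act_hom, ← comp_whiskerRight_assoc, hj]
  exact
    { desc := fun s => ⟨ht.desc ((forget A).mapCocone s), key s _ fun j => ht.fac _ j⟩
      fac := fun s j => hom_ext (ht.fac ((forget A).mapCocone s) j)
      uniq := fun s m hm => hom_ext (ht.uniq ((forget A).mapCocone s) m.hom fun j =>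
        congrArg Hom.hom (hm j)) }

/-- The unit isomorphism of the action. -/
abbrev tensorUnit (M : RMod A) : ltensor (𝟙_ C) M ≅ M :=
  isoMk (λ_ M.X) (by simp)

/-- Duality for the action on modules. -/
def tensorHomEquiv (c c' : C) [ExactPairing c c'] (M N : RMod A) :
    (ltensor c' M ⟶ N) ≃ (M ⟶ ltensor c N) where
  toFun f := (tensorUnit M).inv ≫ whiskerHom (η_ c c') M ≫ (tensorAssoc c c' M).hom ≫ whisker c f
  invFun f := whisker c' f ≫ (tensorAssoc c' c N).inv ≫ whiskerHom (ε_ c c') N ≫ (tensorUnit N).hom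
  left_inv f := hom_ext ((tensorLeftHomEquiv M.X c c' N.X).left_inv f.hom)
  right_inv f := hom_ext ((tensorLeftHomEquiv M.X c c' N.X).right_inv f.hom)

/-- Acting by `c` is left adjoint to acting by its left dual. -/
theorem preservesColimits_actionLeft (c : C) [HasLeftDual c] :
    PreservesColimitsOfSize.{0, 0} (actionLeft (RMod A) c) := by
  have adj : actionLeft (RMod A) c ⊣ actionLeft (RMod A) (HasLeftDual.leftDual c) :=
    Adjunction.mkOfHomEquiv
      { homEquiv := fun M N => tensorHomEquiv (HasLeftDual.leftDual c) c M N
        homEquiv_naturality_left_symm := fun {M M' N} f g =>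
          hom_ext (tensorLeftHomEquiv_symm_naturality f.hom g.hom)
        homEquiv_naturality_right := fun {M N N'} f g =>
          hom_ext (tensorLeftHomEquiv_naturality f.hom g.hom) }
  exact adj.leftAdjoint_preservesColimits

theorem preservesFiniteColimits_actionRight
    [∀ X : C, PreservesColimitsOfSize.{0, 0} (tensorRight X)] (M : RMod A) :
    PreservesFiniteColimits (actionRight (C := C) M) := by
  refine ⟨fun J _ _ => ⟨fun {K} => ?_⟩⟩
  have := forget_reflectsColimits (A := A) (K ⋙ actionRight (C := C) M)
  have : PreservesColimit K (actionRight (C := C) M ⋙ forget A) :=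
    inferInstanceAs (PreservesColimit K (tensorRight M.X))
  exact preservesColimit_of_reflects_of_preserves _ (forget A)

theorem isFiniteLeftModule (k : Type w) [Field k] [Preadditive C] [Linear k C]
    [MonoidalPreadditive C] [MonoidalLinear k C] [RigidCategory C] [SemisimpleCategory k (RMod A)] :
    IsFiniteLeftModule k C (RMod A) where
  finite := by
    obtain ⟨R, h1, h2, h3, _, F, hF⟩ :=
      SemisimpleCategory.exists_equivalence (k := k) (M := RMod A)
    exact ⟨⟨R, h1, h2, h3, F, hF⟩⟩
  add_actionHomLeft f g M := hom_ext (MonoidalPreadditive.add_whiskerRight _ _)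
  smul_actionHomLeft r f M := hom_ext (MonoidalLinear.smul_whiskerRight r f M.X)
  actionHomRight_add c _ _ f g := hom_ext (MonoidalPreadditive.whiskerLeft_add _ _)
  actionHomRight_smul c _ _ r f := hom_ext (MonoidalLinear.whiskerLeft_smul c r f.hom)
  rightExact_left M := preservesFiniteColimits_actionRight M
  rightExact_right c := by
    have := preservesColimits_actionLeft (A := A) c
    exact ⟨fun _ _ _ => inferInstance⟩

end Finite

end RMod

end MultiFusion

namespace MultiFusion

/-! ### Split idempotents, corners `e A e` and the functor `M ↦ M e`. -/

section Splittings

/-- A splitting of an idempotent. -/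
structure IdemSplitting {C : Type u} [Category.{v} C] {X : C} (p : X ⟶ X) where
  /-- The image. -/
  obj : C
  /-- The inclusion. -/
  incl : obj ⟶ X
  /-- The projection. -/
  proj : X ⟶ obj
  incl_proj : incl ≫ proj = 𝟙 obj
  proj_incl : proj ≫ incl = p

attribute [simp] IdemSplitting.incl_proj IdemSplitting.proj_incl

variable {C : Type u} [Category.{v} C]

namespace IdemSplitting

variable {X : C} {p : X ⟶ X} (S : IdemSplitting p)

instance : Mono S.incl := ⟨fun f g h => by
  have := congrArg (fun t => t ≫ S.proj) h
  simpa using this⟩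

@[simp] theorem incl_idem : S.incl ≫ p = S.incl :=
  (congrArg (S.incl ≫ ·) S.proj_incl.symm).trans (by rw [reassoc_of% S.incl_proj])

@[simp] theorem idem_proj : p ≫ S.proj = S.proj :=
  (congrArg (· ≫ S.proj) S.proj_incl.symm).trans
    (by rw [Category.assoc, S.incl_proj, Category.comp_id])

end IdemSplitting

/-- A choice of splitting. -/
noncomputable def splitting [IsIdempotentComplete C] {X : C} (p : X ⟶ X) (hp : p ≫ p = p) :
    IdemSplitting p :=
  Classical.choice (by
    obtain ⟨Y, i, e, h1, h2⟩ := IsIdempotentComplete.idempotents_split X p hp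
    exact ⟨⟨Y, i, e, h1, h2⟩⟩)

/-- In a regular category monomorphisms split, so subobjects are images of idempotents and
simplicity can be read off from the endomorphism ring. -/
theorem IsRegular.simple_iff [Preadditive C] [IsIdempotentComplete C] (h : IsRegular C) {X : C} :
    Simple X ↔ 𝟙 X ≠ 0 ∧ ∀ p : X ⟶ X, p ≫ p = p → p = 0 ∨ p = 𝟙 X := by
  constructor
  · intro hX
    refine ⟨id_nonzero X, fun p hp => or_iff_not_imp_left.2 fun h0 => ?_⟩
    let S := splitting p hp
    have hS : S.incl ≠ 0 := fun h1 => h0 (by rw [← S.proj_incl, h1, comp_zero])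
    have := isIso_of_mono_of_nonzero hS
    rw [← cancel_epi S.incl, S.incl_idem, Category.comp_id]
  · rintro ⟨h1, h2⟩
    refine ⟨fun {Y} f _ => ⟨fun hf h0 => h1 ?_, fun hf => ?_⟩⟩
    · exact (IsIso.inv_hom_id f).symm.trans ((congrArg (inv f ≫ ·) h0).trans comp_zero)
    · obtain ⟨g, hg⟩ := h.exists_retraction_of_mono f
      refine ⟨g, hg, ?_⟩
      refine (h2 (g ≫ f) (by rw [Category.assoc, reassoc_of% hg])).resolve_left fun h0 => hf ?_
      rw [← Category.id_comp f, ← hg, Category.assoc, h0, comp_zero]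

/-- For a quasi-inverse `g`, the idempotent `g ≫ f` of the simple object `Y` is `0` or `𝟙 Y`; the
first would force `f = f ≫ g ≫ f = 0`. -/
theorem IsRegular.exists_section_of_simple [Preadditive C] [IsIdempotentComplete C]
    (h : IsRegular C) {X Y : C} [Simple Y] (f : X ⟶ Y) (hf : f ≠ 0) : ∃ s : Y ⟶ X, s ≫ f = 𝟙 Y := by
  obtain ⟨g, hg⟩ := h f
  refine ⟨g, ((h.simple_iff.1 ‹_›).2 (g ≫ f) (by simp [hg])).resolve_left fun h0 => hf ?_⟩
  rw [← hg, h0, comp_zero]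

end Splittings

open RMod

/-- `D` is the corner `e A e` of `A`, where the idempotent `e` is the unit of `D`. -/
structure Corner {C : Type u} [Category.{v} C] [MonoidalCategory C] (A D : Mon C) where
  /-- The inclusion. -/
  incl : D.X ⟶ A.X
  /-- The projection. -/
  proj : A.X ⟶ D.X
  incl_proj : incl ≫ proj = 𝟙 _
  mul_incl : (incl ⊗ₘ incl) ≫ μ[A.X] = μ[D.X] ≫ incl
  proj_incl : proj ≫ incl =
    (ofPoint (M := self A) (η[D.X] ≫ incl)).hom ≫ (self A).mulRight (η[D.X] ≫ incl)

namespace Corner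

variable {C : Type u} [Category.{v} C] [MonoidalCategory C] {A D : Mon C} (K : Corner A D)

/-- The idempotent. -/
def e : 𝟙_ C ⟶ A.X := η[D.X] ≫ K.incl

theorem proj_incl' : K.proj ≫ K.incl = (ofPoint (M := self A) K.e).hom ≫ (self A).mulRight K.e :=
  K.proj_incl

theorem whisker_mul_incl : K.incl ▷ D.X ≫ A.X ◁ K.incl ≫ μ[A.X] = μ[D.X] ≫ K.incl := by
  rw [← K.mul_incl, MonoidalCategory.tensorHom_def, Category.assoc]

@[simp] theorem incl_mulRight : K.incl ≫ (self A).mulRight K.e = K.incl := by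
  rw [mulRight, e, rightUnitor_inv_naturality_assoc, MonoidalCategory.whiskerLeft_comp_assoc,
    ← whisker_exchange_assoc, K.whisker_mul_incl]
  simp

@[simp] theorem incl_mulLeft : K.incl ≫ (ofPoint (M := self A) K.e).hom = K.incl := by
  rw [ofPoint_hom, e, leftUnitor_inv_naturality_assoc, comp_whiskerRight_assoc,
    whisker_exchange_assoc, whisker_exchange_assoc, K.whisker_mul_incl]
  simp

@[simp] theorem mulRight_idem (M : RMod A) : M.mulRight K.e ≫ M.mulRight K.e = M.mulRight K.e := by
  rw [mulRight_mulRight]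
  congr 1
  rw [e, Category.assoc]
  exact congrArg _ K.incl_mulRight

theorem whisker_act_mulRight (M : RMod A) :
    M.X ◁ K.incl ≫ M.act ≫ M.mulRight K.e = M.X ◁ K.incl ≫ M.act := by
  rw [act_mulRight, ← MonoidalCategory.whiskerLeft_comp_assoc, K.incl_mulRight]

theorem mono_whiskerLeft_incl (c : C) : Mono (c ◁ K.incl) := by
  refine ⟨fun f g h => ?_⟩
  have := congrArg (· ≫ c ◁ K.proj) h
  simpa [← MonoidalCategory.whiskerLeft_comp, K.incl_proj] using this

/-- The projective module `e A`, as a retract of the regular module. -/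
structure Projective where
  /-- The module. -/
  obj : RMod A
  /-- The inclusion. -/
  i : obj ⟶ self A
  /-- The projection. -/
  r : self A ⟶ obj
  i_r : i ≫ r = 𝟙 obj
  r_i : r ≫ i = ofPoint K.e

namespace Projective

variable {K} (P : K.Projective)

theorem incl_r_i : K.incl ≫ P.r.hom ≫ P.i.hom = K.incl := by
  rw [← comp_hom, P.r_i, K.incl_mulLeft]

theorem i_mulLeft : P.i.hom ≫ (ofPoint (M := self A) K.e).hom = P.i.hom := by
  rw [← P.r_i, comp_hom, ← Category.assoc, ← comp_hom, P.i_r, id_hom, Category.id_comp]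

theorem i_proj_incl : P.i.hom ≫ K.proj ≫ K.incl = P.obj.mulRight K.e ≫ P.i.hom := by
  rw [K.proj_incl', ← Category.assoc, P.i_mulLeft, mulRight_hom]

theorem point_r_mulRight : point P.r ≫ P.obj.mulRight K.e = point P.r := by
  have h : P.r = ofPoint (M := self A) K.e ≫ P.r := by
    rw [← P.r_i, Category.assoc, P.i_r, Category.comp_id]
  rw [point_mulRight]
  conv_rhs => rw [h, point_comp, point_ofPoint]

end Projective

variable [IsIdempotentComplete C]

/-- The image of right multiplication by `e`. -/
noncomputable def fixed (M : RMod A) : IdemSplitting (M.mulRight K.e) :=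
  splitting _ (K.mulRight_idem M)

/-- The action of `e A e` on `M e`. -/
noncomputable def fixedAct (M : RMod A) : (K.fixed M).obj ⊗ D.X ⟶ (K.fixed M).obj :=
  (K.fixed M).incl ▷ D.X ≫ M.X ◁ K.incl ≫ M.act ≫ (K.fixed M).proj

theorem fixedAct_incl (M : RMod A) :
    K.fixedAct M ≫ (K.fixed M).incl = (K.fixed M).incl ▷ D.X ≫ M.X ◁ K.incl ≫ M.act := by
  simp only [fixedAct, Category.assoc, IdemSplitting.proj_incl, whisker_act_mulRight]

/-- `M e` as a module over `e A e`. -/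
noncomputable abbrev fixedObj (M : RMod A) : RMod D where
  X := (K.fixed M).obj
  act := K.fixedAct M
  act_one := by
    have h : (K.fixed M).incl ≫ (ρ_ M.X).inv ≫ M.X ◁ K.e ≫ M.act = (K.fixed M).incl :=
      (K.fixed M).incl_idem
    rw [rightUnitor_inv_naturality_assoc, Iso.inv_comp_eq] at h
    rw [← cancel_mono (K.fixed M).incl, Category.assoc, fixedAct_incl, whisker_exchange_assoc,
      ← MonoidalCategory.whiskerLeft_comp_assoc]
    exact h
  act_mul := by
    rw [← cancel_mono (K.fixed M).incl]
    simp only [Category.assoc, fixedAct_incl]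
    rw [← comp_whiskerRight_assoc, fixedAct_incl, whisker_exchange_assoc,
      ← MonoidalCategory.whiskerLeft_comp_assoc, ← K.mul_incl,
      MonoidalCategory.whiskerLeft_comp_assoc, M.act_mul]
    simp only [comp_whiskerRight, Category.assoc]
    rw [← whisker_exchange_assoc M.act K.incl]
    simp [MonoidalCategory.tensorHom_def]

theorem fixed_incl_hom {M N : RMod A} (f : M ⟶ N) :
    ((K.fixed M).incl ≫ f.hom ≫ (K.fixed N).proj) ≫ (K.fixed N).incl =
      (K.fixed M).incl ≫ f.hom := by
  simp only [Category.assoc, IdemSplitting.proj_incl]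
  rw [← mulRight_hom, reassoc_of% (K.fixed M).incl_idem]

/-- The map `M e ⟶ N e` induced by a map of modules. -/
noncomputable def fixedMap {M N : RMod A} (f : M ⟶ N) : K.fixedObj M ⟶ K.fixedObj N where
  hom := (K.fixed M).incl ≫ f.hom ≫ (K.fixed N).proj
  act_hom := by
    rw [← cancel_mono (K.fixed N).incl]
    change (K.fixedAct M ≫ _) ≫ _ = (_ ≫ K.fixedAct N) ≫ _
    rw [Category.assoc, fixed_incl_hom, Category.assoc, fixedAct_incl, reassoc_of% @fixedAct_incl,
      f.act_hom, ← comp_whiskerRight_assoc, fixed_incl_hom]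
    simp [whisker_exchange_assoc]

theorem fixedMap_incl {M N : RMod A} (f : M ⟶ N) :
    (K.fixedMap f).hom ≫ (K.fixed N).incl = (K.fixed M).incl ≫ f.hom := K.fixed_incl_hom f

theorem fixed_hom_ext {M : RMod D} {N : RMod A} {f g : M ⟶ K.fixedObj N}
    (h : f.hom ≫ (K.fixed N).incl = g.hom ≫ (K.fixed N).incl) : f = g :=
  hom_ext ((cancel_mono _).1 h)

/-- The functor `M ↦ M e`. -/
noncomputable def functor : RMod A ⥤ RMod D where
  obj := K.fixedObj
  map := K.fixedMap
  map_id M := K.fixed_hom_ext (by rw [fixedMap_incl]; simp)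
  map_comp f g := K.fixed_hom_ext (by
    rw [fixedMap_incl, comp_hom, comp_hom, Category.assoc, fixedMap_incl,
      ← Category.assoc (K.fixedMap f).hom, fixedMap_incl, Category.assoc])

theorem nonempty_projective : Nonempty K.Projective := by
  have := RMod.isIdempotentComplete (A := A)
  have h : ofPoint (M := self A) K.e ≫ ofPoint (M := self A) K.e = ofPoint (M := self A) K.e := by
    rw [ofPoint_comp]
    congr 1
    rw [e, Category.assoc]
    exact congrArg _ K.incl_mulLeft
  obtain ⟨Y, i, r, h1, h2⟩ := IsIdempotentComplete.idempotents_split (self A)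
    (ofPoint (M := self A) K.e) h
  exact ⟨⟨Y, i, r, h1, h2⟩⟩

theorem fixedMap_comp {M N L : RMod A} (f : M ⟶ N) (g : N ⟶ L) :
    K.fixedMap (f ≫ g) = K.fixedMap f ≫ K.fixedMap g := K.functor.map_comp f g

theorem fixedMap_id (M : RMod A) : K.fixedMap (𝟙 M) = 𝟙 _ := K.functor.map_id M

section

variable {K} (P : K.Projective) (c : C)

/-- The map from `(c ⊗ e A) e` to `c ⊗ e A e`. -/
noncomputable def fixedIsoHom : (K.fixed (ltensor c P.obj)).obj ⟶ c ⊗ D.X :=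
  (K.fixed (ltensor c P.obj)).incl ≫ c ◁ (P.i.hom ≫ K.proj)

theorem fixedIsoHom_incl : fixedIsoHom P c ≫ c ◁ K.incl =
    (K.fixed (ltensor c P.obj)).incl ≫ c ◁ P.i.hom := by
  have h : (K.fixed (ltensor c P.obj)).incl ≫ c ◁ P.obj.mulRight K.e =
      (K.fixed (ltensor c P.obj)).incl := by
    rw [← mulRight_ltensor]
    exact (K.fixed (ltensor c P.obj)).incl_idem
  rw [fixedIsoHom, Category.assoc, ← MonoidalCategory.whiskerLeft_comp, Category.assoc,
    P.i_proj_incl, MonoidalCategory.whiskerLeft_comp, reassoc_of% h]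

/-- `(c ⊗ e A) e` is the free module `c ⊗ e A e`. -/
noncomputable def fixedIso : K.fixedObj (ltensor c P.obj) ≅ ltensor c (self D) :=
  isoMk
    { hom := fixedIsoHom P c
      inv := c ◁ (K.incl ≫ P.r.hom) ≫ (K.fixed (ltensor c P.obj)).proj
      hom_inv_id := by
        rw [MonoidalCategory.whiskerLeft_comp, Category.assoc, reassoc_of% fixedIsoHom_incl P c,
          ← MonoidalCategory.whiskerLeft_comp_assoc, ← comp_hom, P.i_r]
        simp
      inv_hom_id := by
        have := mono_whiskerLeft_incl (K := K) c
        rw [← cancel_mono (c ◁ K.incl), Category.assoc, fixedIsoHom_incl, Category.assoc,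
          ← Category.assoc (K.fixed (ltensor c P.obj)).proj, IdemSplitting.proj_incl,
          mulRight_ltensor, ← MonoidalCategory.whiskerLeft_comp,
          ← MonoidalCategory.whiskerLeft_comp, mulRight_hom, Category.assoc,
          reassoc_of% P.incl_r_i, K.incl_mulRight, Category.id_comp] }
    (by
      have := mono_whiskerLeft_incl (K := K) c
      have h1 := (whisker c P.i).act_hom
      simp only [whisker_hom] at h1
      rw [← cancel_mono (c ◁ K.incl), Category.assoc]
      change K.fixedAct (ltensor c P.obj) ≫ fixedIsoHom P c ≫ c ◁ K.incl =
        (fixedIsoHom P c ▷ D.X ≫ (α_ c D.X D.X).hom ≫ c ◁ μ[D.X]) ≫ c ◁ K.incl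
      rw [fixedIsoHom_incl, ← Category.assoc, fixedAct_incl, Category.assoc, Category.assoc, h1,
        Category.assoc, Category.assoc, ← MonoidalCategory.whiskerLeft_comp,
        ← K.whisker_mul_incl, whisker_exchange_assoc, ← comp_whiskerRight_assoc,
        ← fixedIsoHom_incl]
      simp)

/-- Both sides are `Hom_C(c, M e)`: a map out of `c ⊗ e A` is determined by the image of the
generator `e`, which lies in `M e`, and a map out of `c ⊗ e A e` is determined by the image of the
unit. -/
theorem fixedMap_bijective (M : RMod A) :
    Function.Bijective fun h : ltensor c P.obj ⟶ M => K.fixedMap h := by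
  constructor
  · intro h h' heq
    have hh : (K.fixed (ltensor c P.obj)).incl ≫ h.hom =
        (K.fixed (ltensor c P.obj)).incl ≫ h'.hom := by
      rw [← fixedMap_incl, ← fixedMap_incl]
      exact congrArg (fun t => Hom.hom t ≫ (K.fixed M).incl) heq
    have h1 : c ◁ point P.r ≫ h.hom = c ◁ point P.r ≫ h'.hom := by
      have h2 : c ◁ point P.r = c ◁ point P.r ≫ (K.fixed (ltensor c P.obj)).proj ≫
          (K.fixed (ltensor c P.obj)).incl := by
        rw [IdemSplitting.proj_incl, mulRight_ltensor, ← MonoidalCategory.whiskerLeft_comp,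
          P.point_r_mulRight]
      rw [h2, Category.assoc, Category.assoc, hh, Category.assoc, Category.assoc]
    have h3 : whisker c P.r ≫ h = whisker c P.r ≫ h' := by
      refine free_hom_ext ?_
      rw [comp_hom, comp_hom, whisker_hom, freeUnit, Category.assoc, Category.assoc,
        ← MonoidalCategory.whiskerLeft_comp_assoc, ← MonoidalCategory.whiskerLeft_comp_assoc]
      exact congrArg _ h1
    have h4 : whisker c P.i ≫ whisker c P.r = 𝟙 _ := by
      rw [← whisker_comp, P.i_r, whisker_id]
    rw [← Category.id_comp h, ← h4, Category.assoc, h3, ← Category.assoc, h4, Category.id_comp]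
  · intro φ
    let φ' : ltensor c (self D) ⟶ K.fixedObj M := (fixedIso P c).inv ≫ φ
    -- The prospective image of the generator: the value of `φ` on the unit of `e A e`.
    let x : c ⟶ M.X := (freeUnit D c ≫ φ'.hom) ≫ (K.fixed M).incl
    have hφ : φ = (fixedIso P c).hom ≫ φ' := ((fixedIso P c).hom_inv_id_assoc φ).symm
    refine ⟨whisker c P.i ≫ freeDesc x, K.fixed_hom_ext ?_⟩
    have h1 : φ'.hom ≫ (K.fixed M).incl = c ◁ K.incl ≫ x ▷ A.X ≫ M.act := by
      rw [← freeDesc_freeUnit φ', freeDesc_hom]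
      change (_ ≫ K.fixedAct M) ≫ _ = _
      rw [Category.assoc, fixedAct_incl, ← comp_whiskerRight_assoc, ← whisker_exchange_assoc]
    change (K.fixedMap _).hom ≫ _ = _
    rw [fixedMap_incl, hφ]
    change _ = (fixedIsoHom P c ≫ φ'.hom) ≫ _
    rw [Category.assoc, h1, reassoc_of% fixedIsoHom_incl P c]
    rfl

end

end Corner

end MultiFusion

namespace MultiFusion

open RMod

namespace Corner

variable {C : Type u} [Category.{v} C] [MonoidalCategory C]

/-! ### Transfer of regularity and simplicity between an algebra and a corner. -/

section Regularity

variable [IsIdempotentComplete C]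
  {A D : Mon C} {K : Corner A D} (P : K.Projective)

-- Free `D`-modules are the images of `c ⊗ e A`, and quasi-inverses are carried over by the functor
-- `M ↦ M e`, full on these modules.
include P in
theorem isFreeRegular_corner (hA : IsRegular (RMod A)) : IsFreeRegular D := by
  intro c c' f
  obtain ⟨h, hh⟩ := (fixedMap_bijective P c _).2 ((fixedIso P c).hom ≫ f ≫ (fixedIso P c').inv)
  obtain ⟨g, hg⟩ := hA h
  have h2 := congrArg K.fixedMap hg
  simp only [fixedMap_comp] at h2
  refine exists_regular_of_retract (fixedIso P c).inv_hom_id (fixedIso P c').inv_hom_id f ?_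
  exact ⟨K.fixedMap g, by rw [← hh]; exact h2⟩

/-- The hypothesis says that `e` is a full idempotent. Then `c ⊗ A` is a retract of `(c ⊗ Z) ⊗ e A`,
and on such modules `M ↦ M e` is fully faithful, so quasi-inverses lift from `D`. -/
theorem isFreeRegular_of_corner (hD : IsRegular (RMod D)) {Z : C} (s : self A ⟶ ltensor Z P.obj)
    (m : ltensor Z P.obj ⟶ self A) (hs : s ≫ m = 𝟙 _) : IsFreeRegular A := by
  intro c c' f
  have key : ∀ c : C, (whisker c s ≫ (tensorAssoc c Z P.obj).inv) ≫ (tensorAssoc c Z P.obj).hom ≫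
      whisker c m = 𝟙 _ := by
    intro c
    rw [Category.assoc, Iso.inv_hom_id_assoc, ← whisker_comp, hs, whisker_id]
  refine exists_regular_of_retract (key c) (key c') f ?_
  set h := ((tensorAssoc c Z P.obj).hom ≫ whisker c m) ≫ f ≫
    whisker c' s ≫ (tensorAssoc c' Z P.obj).inv
  obtain ⟨g', hg'⟩ := hD (K.fixedMap h)
  obtain ⟨g, rfl⟩ := (fixedMap_bijective P _ _).2 g'
  refine ⟨g, (fixedMap_bijective P _ _).1 ?_⟩
  simpa only [fixedMap_comp] using hg'

theorem fixedMap_bijective' (M : RMod A) :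
    Function.Bijective fun h : P.obj ⟶ M => K.fixedMap h := by
  have h := fixedMap_bijective P (𝟙_ C) M
  let u := tensorUnit P.obj
  constructor
  · intro f g hfg
    have h2 : u.hom ≫ f = u.hom ≫ g := h.1 (by
      simp only [fixedMap_comp]
      exact congrArg _ hfg)
    exact (cancel_epi u.hom).1 h2
  · intro φ
    obtain ⟨t, ht⟩ := h.2 (K.fixedMap u.hom ≫ φ)
    refine ⟨u.inv ≫ t, ?_⟩
    simp only at ht
    simp only [fixedMap_comp, ht]
    rw [← Category.assoc, ← fixedMap_comp, u.inv_hom_id, fixedMap_id, Category.id_comp]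

/-- `(e A) e` is the regular module `e A e`. -/
noncomputable def fixedIso' : K.fixedObj P.obj ≅ self D :=
  K.functor.mapIso (tensorUnit P.obj).symm ≪≫ fixedIso P (𝟙_ C) ≪≫ tensorUnit (self D)

variable [Preadditive C] [MonoidalPreadditive C]

theorem fixedMap_add {M N : RMod A} (f g : M ⟶ N) :
    K.fixedMap (f + g) = K.fixedMap f + K.fixedMap g := K.fixed_hom_ext (by
  rw [fixedMap_incl]
  change _ = ((K.fixedMap f).hom + (K.fixedMap g).hom) ≫ _
  rw [Preadditive.add_comp, fixedMap_incl, fixedMap_incl, add_hom, Preadditive.comp_add])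

instance : K.functor.Additive := ⟨K.fixedMap_add _ _⟩

theorem fixedMap_zero {M N : RMod A} : K.fixedMap (0 : M ⟶ N) = 0 := K.functor.map_zero M N

/-- The functor `M ↦ M e` identifies the endomorphisms of `e A` with those of the regular
`D`-module, and simplicity depends only on idempotent endomorphisms. -/
theorem simple_iff (hA : IsRegular (RMod A)) : Simple P.obj ↔ Simple (self D) := by
  have := RMod.isIdempotentComplete (A := A)
  have := RMod.isIdempotentComplete (A := D)
  have hb := fixedMap_bijective' P P.obj
  rw [← Simple.iff_of_iso (fixedIso' P), hA.simple_iff,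
    (isFreeRegular_corner P hA).isRegular.simple_iff]
  refine and_congr (not_congr ?_) ⟨fun h p hp => ?_, fun h p hp => ?_⟩
  · rw [← fixedMap_id, ← hb.1.eq_iff]
    simp only [fixedMap_zero]
  · obtain ⟨t, rfl⟩ := hb.2 p
    refine (h t (hb.1 ?_)).imp ?_ ?_
    · simpa only [fixedMap_comp] using hp
    · rintro rfl
      exact fixedMap_zero
    · rintro rfl
      exact K.fixedMap_id _
  · refine (h (K.fixedMap p) (by rw [← fixedMap_comp, hp])).imp (fun h0 => hb.1 ?_)
      fun h1 => hb.1 ?_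
    · rw [← fixedMap_zero] at h0
      exact h0
    · rw [← fixedMap_id] at h1
      exact h1

end Regularity

end Corner

/-! ### Indecomposability from a simple module that generates. -/

section Indecomposable

open MonoidalLeftAction

variable {C : Type u} [Category.{v} C] [MonoidalCategory C] [Preadditive C]
  [MonoidalPreadditive C] [IsIdempotentComplete C] [RigidCategory C] {A : Mon C}

/-- A chain of retracts: `N` of `N ⊗ A`, `A` of `Z ⊗ P`, and `P` of `Y' ⊗ M`. The last comes from
duality: `M` embeds in some `Y ⊗ P`, which corresponds to a nonzero map `Y' ⊗ M ⟶ P` onto a simple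
module. -/
theorem exists_ltensor_split_epi (hA : IsFreeRegular A) {P : RMod A} [Simple P] {Z : C}
    (s : self A ⟶ ltensor Z P) (m : ltensor Z P ⟶ self A) (hs : s ≫ m = 𝟙 _) (M N : RMod A)
    (hM : ¬ IsZero M) : ∃ (c : C) (f : ltensor c M ⟶ N) (t : N ⟶ ltensor c M), t ≫ f = 𝟙 N := by
  have := RMod.isIdempotentComplete (A := A)
  obtain ⟨sM, hsM⟩ := hA.exists_section_actHom M
  obtain ⟨sN, hsN⟩ := hA.exists_section_actHom N
  let Y := M.X ⊗ Z
  let x : M ⟶ ltensor Y P := sM ≫ whisker M.X s ≫ (tensorAssoc M.X Z P).inv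
  have hx : x ≠ 0 := by
    intro h0
    apply hM
    rw [IsZero.iff_id_eq_zero, ← hsM]
    have h2 : x ≫ (tensorAssoc M.X Z P).hom ≫ whisker M.X m = sM := by
      simp only [x, Category.assoc, Iso.inv_hom_id_assoc]
      rw [← whisker_comp, hs, whisker_id, Category.comp_id]
    rw [← h2, h0, zero_comp, zero_comp]
  let Y' := HasRightDual.rightDual Y
  let f := (tensorHomEquiv Y Y' M P).symm x
  have hf : f ≠ 0 := by
    intro h0
    apply hx
    rw [← (tensorHomEquiv Y Y' M P).apply_symm_apply x]
    change tensorHomEquiv Y Y' M P f = 0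
    rw [h0]
    apply hom_ext
    simp [tensorHomEquiv]
  obtain ⟨g, hg⟩ := hA.isRegular.exists_section_of_simple f hf
  refine ⟨N.X ⊗ (Z ⊗ Y'), (tensorAssoc _ _ M).hom ≫ whisker N.X ((tensorAssoc _ _ M).hom ≫
    whisker Z f ≫ m) ≫ actHom N, sN ≫ whisker N.X (s ≫ whisker Z g ≫ (tensorAssoc _ _ M).inv) ≫
      (tensorAssoc _ _ M).inv, ?_⟩
  have h3 : (s ≫ whisker Z g ≫ (tensorAssoc Z Y' M).inv) ≫ (tensorAssoc Z Y' M).hom ≫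
      whisker Z f ≫ m = 𝟙 _ := by
    simp only [Category.assoc, Iso.inv_hom_id_assoc]
    rw [← Category.assoc (whisker Z g), ← whisker_comp, hg, whisker_id, Category.id_comp, hs]
  simp only [Category.assoc, Iso.inv_hom_id_assoc]
  rw [← Category.assoc (whisker N.X _), ← whisker_comp, h3, whisker_id, Category.id_comp, hsN]

/-- In a product of two nonzero module categories there are nonzero `x` and `y`, one in each factor.
Every map `c ⊗ x ⟶ y` vanishes, so `y` cannot be a retract of `c ⊗ x`. -/
theorem isIndecomposable_of_simple (k : Type w) [Field k] [Linear k C] [MonoidalLinear k C]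
    [SemisimpleCategory k C] (hA : IsFreeRegular A) {P : RMod A} [Simple P] {Z : C}
    (s : self A ⟶ ltensor Z P) (m : ltensor Z P ⟶ self A) (hs : s ≫ m = 𝟙 _) :
    IsIndecomposable k C (RMod A) := by
  have : SemisimpleCategory k (RMod A) := (isSemisimpleAlgebra_iff k).2 hA
  refine ⟨isFiniteLeftModule k, fun h => Simple.not_isZero P (h P), ?_⟩
  intro M₁ _ _ _ _ M₂ _ _ _ _ h₁ h₂ P₁ _ _ _ P₂ _ _ _ _
  by_contra hcon
  rw [not_or] at hcon
  obtain ⟨hc1, hc2⟩ := hcon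
  simp only [IsZeroCategory, not_forall] at hc1 hc2
  obtain ⟨m₁, hm₁⟩ := hc1
  obtain ⟨m₂, hm₂⟩ := hc2
  have hz : HasFiniteBiproducts (RMod A) :=
    (SemisimpleCategory.isSplitFinite (k := k) (M := RMod A)).hasFiniteBiproducts
  have := hasZeroObject_of_hasFiniteBiproducts (RMod A)
  obtain ⟨O, hO⟩ := HasZeroObject.zero (C := RMod A)
  let F := P₁.prod' P₂
  -- The images of the zero module `O` serve as zero objects of `M₁` and `M₂`.
  let x := F.objPreimage (m₁, P₂.obj O)
  let y := F.objPreimage (P₁.obj O, m₂)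
  let ex : F.obj x ≅ (m₁, P₂.obj O) := F.objObjPreimageIso _
  let ey : F.obj y ≅ (P₁.obj O, m₂) := F.objObjPreimageIso _
  have hx : ¬ IsZero x := fun h =>
    hm₁ ((P₁.map_isZero h).of_iso ((CategoryTheory.Prod.fst M₁ M₂).mapIso ex).symm)
  have hy : ¬ IsZero y := fun h =>
    hm₂ ((P₂.map_isZero h).of_iso ((CategoryTheory.Prod.snd M₁ M₂).mapIso ey).symm)
  have hx2 : IsZero (P₂.obj x) :=
    (P₂.map_isZero hO).of_iso ((CategoryTheory.Prod.snd M₁ M₂).mapIso ex)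
  have hy1 : IsZero (P₁.obj y) :=
    (P₁.map_isZero hO).of_iso ((CategoryTheory.Prod.fst M₁ M₂).mapIso ey)
  obtain ⟨c, f, t, htf⟩ := exists_ltensor_split_epi hA s m hs x y hx
  have : (actionLeft M₂ c).Additive := ⟨h₂.actionHomRight_add c _ _⟩
  have hcx : IsZero (P₂.obj (c ⊙ₗ x)) :=
    ((actionLeft M₂ c).map_isZero hx2).of_iso (Functor.LeftLinear.μₗIso P₂ c x).symm
  have hf : f = 0 := F.map_injective (Prod.ext (hy1.eq_of_tgt _ _) (hcx.eq_of_src _ _))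
  exact hy ((IsZero.iff_id_eq_zero _).2 (by rw [← htf, hf, comp_zero]))

end Indecomposable

end MultiFusion

namespace MultiFusion

open RMod

/-! ### Compatibility of `M ↦ M e` with the action of `C`. -/

section LeftLinear

open MonoidalLeftAction Functor.LaxLeftLinear

variable {C : Type u} [Category.{v} C] [MonoidalCategory C]
  {M : Type*} [Category* M] [MonoidalLeftAction C M]
  {N : Type*} [Category* N] [MonoidalLeftAction C N]

/-- A lax left linear functor with invertible structure maps is left linear. -/
noncomputable abbrev leftLinearOfIsIso (F : M ⥤ N) [F.LaxLeftLinear C]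
    [∀ (c : C) (m : M), IsIso (μₗ F c m)] : F.LeftLinear C where
  δₗ c m := inv (μₗ F c m)
  δₗ_naturality_left f m := by
    rw [IsIso.comp_inv_eq, Category.assoc, μₗ_naturality_left, IsIso.inv_hom_id_assoc]
  δₗ_naturality_right c _ _ f := by
    rw [IsIso.comp_inv_eq, Category.assoc, μₗ_naturality_right, IsIso.inv_hom_id_assoc]
  δₗ_associativity c c' m := by
    have h : c ⊴ₗ μₗ F c' m ≫ c ⊴ₗ inv (μₗ F c' m) = 𝟙 _ := by
      rw [← actionHomRight_comp, IsIso.hom_inv_id, actionHomRight_id]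
    rw [IsIso.inv_comp_eq, μₗ_associativity_assoc, IsIso.hom_inv_id_assoc, h, Category.comp_id]
  δₗ_unitality_inv m := by
    rw [← μₗ_unitality_inv, Category.assoc, IsIso.hom_inv_id, Category.comp_id]
  μₗ_comp_δₗ c m := IsIso.hom_inv_id _
  δₗ_comp_μₗ c m := IsIso.inv_hom_id _

end LeftLinear

namespace Corner

section LeftLinear

open MonoidalLeftAction

variable {C : Type u} [Category.{v} C] [MonoidalCategory C] [IsIdempotentComplete C]
  {A D : Mon C} (K : Corner A D)

/-- The comparison map `c ⊗ M e ⟶ (c ⊗ M) e`. -/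
noncomputable def fixedTensor (c : C) (M : RMod A) :
    c ⊗ (K.fixed M).obj ⟶ (K.fixed (ltensor c M)).obj :=
  c ◁ (K.fixed M).incl ≫ (K.fixed (ltensor c M)).proj

theorem fixedTensor_incl (c : C) (M : RMod A) :
    K.fixedTensor c M ≫ (K.fixed (ltensor c M)).incl = c ◁ (K.fixed M).incl := by
  rw [fixedTensor, Category.assoc, IdemSplitting.proj_incl, mulRight_ltensor,
    ← MonoidalCategory.whiskerLeft_comp, IdemSplitting.incl_idem]

/-- The isomorphism `c ⊗ M e ≅ (c ⊗ M) e`. -/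
noncomputable def fixedTensorIso (c : C) (M : RMod A) :
    ltensor c (K.fixedObj M) ≅ K.fixedObj (ltensor c M) :=
  isoMk
    { hom := K.fixedTensor c M
      inv := (K.fixed (ltensor c M)).incl ≫ c ◁ (K.fixed M).proj
      hom_inv_id := by
        rw [reassoc_of% K.fixedTensor_incl, ← MonoidalCategory.whiskerLeft_comp,
          IdemSplitting.incl_proj, MonoidalCategory.whiskerLeft_id]
      inv_hom_id := by
        rw [← cancel_mono (K.fixed (ltensor c M)).incl, Category.assoc, fixedTensor_incl,
          Category.assoc, ← MonoidalCategory.whiskerLeft_comp, IdemSplitting.proj_incl,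
          ← mulRight_ltensor, IdemSplitting.incl_idem, Category.id_comp] }
    (by
      rw [← cancel_mono (K.fixed (ltensor c M)).incl]
      change (((α_ _ _ _).hom ≫ c ◁ K.fixedAct M) ≫ K.fixedTensor c M) ≫ _ =
        (K.fixedTensor c M ▷ D.X ≫ K.fixedAct (ltensor c M)) ≫ _
      rw [Category.assoc, Category.assoc, Category.assoc, fixedTensor_incl, fixedAct_incl, ← comp_whiskerRight_assoc, fixedTensor_incl,
        ← MonoidalCategory.whiskerLeft_comp, fixedAct_incl]
      simp)

theorem fixedTensorIso_hom_incl (c : C) (M : RMod A) :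
    (K.fixedTensorIso c M).hom.hom ≫ (K.fixed (ltensor c M)).incl = c ◁ (K.fixed M).incl :=
  K.fixedTensor_incl c M

theorem fixedTensorIso_naturality_left {c c' : C} (f : c ⟶ c') (M : RMod A) :
    whiskerHom f (K.fixedObj M) ≫ (K.fixedTensorIso c' M).hom =
      (K.fixedTensorIso c M).hom ≫ K.fixedMap (whiskerHom f M) := K.fixed_hom_ext (by
  rw [comp_hom, comp_hom, Category.assoc, Category.assoc, fixedMap_incl, fixedTensorIso_hom_incl,
    ← Category.assoc, fixedTensorIso_hom_incl]
  exact (whisker_exchange _ _).symm)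

theorem fixedTensorIso_naturality_right (c : C) {M N : RMod A} (f : M ⟶ N) :
    whisker c (K.fixedMap f) ≫ (K.fixedTensorIso c N).hom =
      (K.fixedTensorIso c M).hom ≫ K.fixedMap (whisker c f) := K.fixed_hom_ext (by
  rw [comp_hom, comp_hom, Category.assoc, Category.assoc, fixedMap_incl, fixedTensorIso_hom_incl,
    ← Category.assoc, fixedTensorIso_hom_incl, whisker_hom, whisker_hom,
    ← MonoidalCategory.whiskerLeft_comp, fixedMap_incl, MonoidalCategory.whiskerLeft_comp])

theorem fixedTensorIso_assoc (c c' : C) (M : RMod A) :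
    (K.fixedTensorIso (c ⊗ c') M).hom ≫ K.fixedMap (tensorAssoc c c' M).hom =
      (tensorAssoc c c' (K.fixedObj M)).hom ≫ whisker c (K.fixedTensorIso c' M).hom ≫
        (K.fixedTensorIso c (ltensor c' M)).hom := K.fixed_hom_ext (by
  rw [comp_hom, comp_hom, comp_hom, Category.assoc, Category.assoc, Category.assoc, fixedMap_incl,
    fixedTensorIso_hom_incl, ← Category.assoc, fixedTensorIso_hom_incl, whisker_hom,
    ← MonoidalCategory.whiskerLeft_comp, fixedTensorIso_hom_incl]
  simp)

theorem fixedTensorIso_unit (M : RMod A) :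
    (tensorUnit (K.fixedObj M)).hom =
      (K.fixedTensorIso (𝟙_ C) M).hom ≫ K.fixedMap (tensorUnit M).hom := K.fixed_hom_ext (by
  rw [comp_hom, Category.assoc, fixedMap_incl, ← Category.assoc, fixedTensorIso_hom_incl]
  simp)

noncomputable instance : K.functor.LaxLeftLinear C where
  μₗ c M := (K.fixedTensorIso c M).hom
  μₗ_naturality_left f M := K.fixedTensorIso_naturality_left f M
  μₗ_naturality_right c _ _ f := K.fixedTensorIso_naturality_right c f
  μₗ_associativity c c' M := K.fixedTensorIso_assoc c c' M
  μₗ_unitality M := K.fixedTensorIso_unit M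

instance (c : C) (M : RMod A) : IsIso (Functor.LaxLeftLinear.μₗ K.functor c M) :=
  Iso.isIso_hom (K.fixedTensorIso c M)

noncomputable instance : K.functor.LeftLinear C := leftLinearOfIsIso K.functor

end LeftLinear

end Corner

end MultiFusion

namespace MultiFusion

open RMod

namespace Corner

/-! ### Central corners and block decompositions. -/

section Central

variable {C : Type u} [Category.{v} C] [MonoidalCategory C] {A D : Mon C}

/-- The corner `e A e` is central if `e` is a central idempotent. -/
structure IsCentral (K : Corner A D) : Prop where
  mulLeft_eq : (ofPoint (M := self A) K.e).hom = K.proj ≫ K.incl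
  mulRight_eq : (self A).mulRight K.e = K.proj ≫ K.incl

variable {K : Corner A D}

instance : Mono K.incl := ⟨fun f g h => by
  have := congrArg (fun t => t ≫ K.proj) h
  simpa [K.incl_proj] using this⟩

namespace IsCentral

variable (hK : K.IsCentral)

include hK

theorem one_proj : η[A.X] ≫ K.proj = η[D.X] := by
  rw [← cancel_mono K.incl, Category.assoc, ← hK.mulRight_eq, one_mulRight]
  rfl

theorem mul_proj : μ[A.X] ≫ K.proj = K.proj ▷ A.X ≫ D.X ◁ K.proj ≫ μ[D.X] := by
  have h1 : μ[A.X] ≫ K.proj ≫ K.incl = A.X ◁ (K.proj ≫ K.incl) ≫ μ[A.X] := by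
    rw [← hK.mulRight_eq]
    exact act_mulRight (self A) K.e
  have h2 : μ[A.X] ≫ K.proj ≫ K.incl = (K.proj ≫ K.incl) ▷ A.X ≫ μ[A.X] := by
    rw [← hK.mulLeft_eq]
    exact (ofPoint (M := self A) K.e).act_hom
  have h3 : μ[A.X] ≫ K.proj ≫ K.incl = μ[A.X] ≫ (K.proj ≫ K.incl) ≫ K.proj ≫ K.incl := by
    rw [Category.assoc, reassoc_of% K.incl_proj]
  rw [← cancel_mono K.incl, Category.assoc, Category.assoc, Category.assoc, ← K.whisker_mul_incl,
    h3, ← Category.assoc μ[A.X], h2, Category.assoc, h1, comp_whiskerRight_assoc,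
    MonoidalCategory.whiskerLeft_comp_assoc, ← whisker_exchange_assoc]

/-- A module over the central factor `e A` as a module over `A`. -/
abbrev restrict (N : RMod D) : RMod A where
  X := N.X
  act := N.X ◁ K.proj ≫ N.act
  act_one := by
    rw [← MonoidalCategory.whiskerLeft_comp_assoc, hK.one_proj, N.act_one]
  act_mul := by
    rw [← MonoidalCategory.whiskerLeft_comp_assoc, hK.mul_proj,
      MonoidalCategory.whiskerLeft_comp_assoc, MonoidalCategory.whiskerLeft_comp_assoc, N.act_mul,
      comp_whiskerRight, Category.assoc, ← whisker_exchange_assoc]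
    simp

theorem restrict_mulRight (N : RMod D) : (hK.restrict N).mulRight K.e = 𝟙 _ := by
  rw [mulRight, ← MonoidalCategory.whiskerLeft_comp_assoc, e, Category.assoc, K.incl_proj,
    Category.comp_id, N.act_one, Iso.inv_hom_id]

variable [IsIdempotentComplete C]

/-- Restriction is a section of `M ↦ M e`. -/
noncomputable def fixedRestrict (N : RMod D) : K.fixedObj (hK.restrict N) ≅ N :=
  isoMk
    { hom := (K.fixed (hK.restrict N)).incl
      inv := (K.fixed (hK.restrict N)).proj
      hom_inv_id := IdemSplitting.incl_proj _
      inv_hom_id := by rw [IdemSplitting.proj_incl, restrict_mulRight] }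
    (by
      change K.fixedAct (hK.restrict N) ≫ _ = _
      rw [fixedAct_incl, ← MonoidalCategory.whiskerLeft_comp_assoc, K.incl_proj,
        MonoidalCategory.whiskerLeft_id, Category.id_comp])

theorem act_fixed_proj (M : RMod A) :
    M.act ≫ (K.fixed M).proj =
      (K.fixed M).proj ▷ A.X ≫ (K.fixed M).obj ◁ K.proj ≫ K.fixedAct M := by
  have h1 : M.act ≫ M.mulRight K.e = (M.mulRight K.e) ▷ A.X ≫ M.X ◁ (K.proj ≫ K.incl) ≫ M.act := by
    have h2 : M.mulRight K.e ▷ A.X ≫ M.act = M.X ◁ (K.proj ≫ K.incl) ≫ M.act := by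
      rw [mulRight_whiskerRight_act, hK.mulLeft_eq]
    rw [act_mulRight, hK.mulRight_eq, ← whisker_exchange_assoc, h2,
      ← MonoidalCategory.whiskerLeft_comp_assoc, Category.assoc, reassoc_of% K.incl_proj]
  rw [← cancel_mono (K.fixed M).incl, Category.assoc, IdemSplitting.proj_incl, Category.assoc,
    Category.assoc, fixedAct_incl, whisker_exchange_assoc, ← comp_whiskerRight_assoc,
    IdemSplitting.proj_incl, ← MonoidalCategory.whiskerLeft_comp_assoc, h1]

theorem fixed_incl_act (M : RMod A) :
    (K.fixed M).incl ▷ A.X ≫ M.act =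
      (K.fixed M).obj ◁ K.proj ≫ K.fixedAct M ≫ (K.fixed M).incl := by
  have h : (K.fixed M).incl ▷ A.X = (K.fixed M).incl ▷ A.X ≫ M.mulRight K.e ▷ A.X := by
    rw [← comp_whiskerRight, IdemSplitting.incl_idem]
  rw [fixedAct_incl, h, Category.assoc, mulRight_whiskerRight_act, hK.mulLeft_eq,
    whisker_exchange_assoc, MonoidalCategory.whiskerLeft_comp_assoc]

/-- Extension by zero of a morphism `M e ⟶ N e`. -/
noncomputable def extend {M N : RMod A} (φ : K.fixedObj M ⟶ K.fixedObj N) : M ⟶ N where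
  hom := (K.fixed M).proj ≫ φ.hom ≫ (K.fixed N).incl
  act_hom := by
    have h := φ.act_hom
    change K.fixedAct M ≫ φ.hom = φ.hom ▷ D.X ≫ K.fixedAct N at h
    rw [reassoc_of% hK.act_fixed_proj, reassoc_of% h, comp_whiskerRight, comp_whiskerRight,
      Category.assoc, Category.assoc, hK.fixed_incl_act, whisker_exchange_assoc]

theorem fixedMap_extend {M N : RMod A} (φ : K.fixedObj M ⟶ K.fixedObj N) :
    K.fixedMap (hK.extend φ) = φ := K.fixed_hom_ext (by
  rw [fixedMap_incl, extend, reassoc_of% (K.fixed M).incl_proj])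

end IsCentral

end Central

section Linear

variable {C : Type u} [Category.{v} C] [MonoidalCategory C] [IsIdempotentComplete C]
  {A D : Mon C} (K : Corner A D) [Preadditive C] [MonoidalPreadditive C]
  {k : Type w} [Field k] [Linear k C] [MonoidalLinear k C]

instance : K.functor.Linear k := ⟨fun {M N} f r => K.fixed_hom_ext (by
  change (K.fixedMap (r • f)).hom ≫ _ = (r • (K.fixedMap f).hom) ≫ _
  rw [fixedMap_incl, Linear.smul_comp, fixedMap_incl, smul_hom, Linear.comp_smul])⟩

end Linear

end Corner

section Families

variable {C : Type u} [Category.{v} C] [MonoidalCategory C] [Preadditive C]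
  {A : Mon C} {J : Type*} [Fintype J] {D : J → Mon C}

/-- A family of corners `e A e` for a complete family of orthogonal central idempotents. -/
structure IsBlockDecomposition (K : ∀ c, Corner A (D c)) : Prop where
  central (c : J) : (K c).IsCentral
  orthogonal {c d : J} (h : c ≠ d) : (K c).e ≫ (self A).mulRight (K d).e = 0
  sum_e : ∑ c, (K c).e = η[A.X]

namespace IsBlockDecomposition

variable {K : ∀ c, Corner A (D c)} (hK : IsBlockDecomposition K) [IsIdempotentComplete C]
  [MonoidalPreadditive C]

include hK

omit [IsIdempotentComplete C] in
theorem sum_mulRight (M : RMod A) : ∑ c, M.mulRight (K c).e = 𝟙 _ := by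
  rw [← mulRight_sum, hK.sum_e, mulRight_one]

theorem fixedMap_extend_of_ne {c d : J} (h : c ≠ d) {M N : RMod A}
    (φ : (K d).fixedObj M ⟶ (K d).fixedObj N) :
    (K c).fixedMap ((hK.central d).extend φ) = 0 := Corner.fixed_hom_ext _ (by
  have h0 : ((K c).fixed M).incl ≫ ((K d).fixed M).proj = 0 := by
    have h1 : ((K c).fixed M).incl ≫ M.mulRight (K c).e ≫ M.mulRight (K d).e ≫
        ((K d).fixed M).proj = ((K c).fixed M).incl ≫ ((K d).fixed M).proj := by
      rw [IdemSplitting.idem_proj, reassoc_of% ((K c).fixed M).incl_idem]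
    rw [← h1, reassoc_of% mulRight_mulRight, hK.orthogonal h, mulRight_zero, zero_comp, comp_zero]
  rw [Corner.fixedMap_incl, Corner.IsCentral.extend, reassoc_of% h0, zero_comp, zero_hom,
    zero_comp])

theorem hom_ext {M N : RMod A} {f g : M ⟶ N} (h : ∀ c, (K c).fixedMap f = (K c).fixedMap g) :
    f = g := by
  apply RMod.hom_ext
  rw [← Category.id_comp f.hom, ← Category.id_comp g.hom, ← hK.sum_mulRight,
    Preadditive.sum_comp, Preadditive.sum_comp]
  refine Finset.sum_congr rfl fun c _ => ?_
  rw [← ((K c).fixed M).proj_incl, Category.assoc, Category.assoc, ← Corner.fixedMap_incl, h,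
    Corner.fixedMap_incl]

/-- The blocks are independent: the given morphisms are extended by zero and added. With `hom_ext`,
a morphism of `A`-modules is the same as a family of morphisms on the blocks. -/
theorem exists_fixedMap_eq {M N : RMod A} (φ : ∀ c, (K c).fixedObj M ⟶ (K c).fixedObj N) :
    ∃ f : M ⟶ N, ∀ c, (K c).fixedMap f = φ c := by
  refine ⟨∑ c, (hK.central c).extend (φ c), fun c => ?_⟩
  have h : (K c).fixedMap (∑ d, (hK.central d).extend (φ d)) =
      ∑ d, (K c).fixedMap ((hK.central d).extend (φ d)) := (K c).functor.map_sum _ _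
  rw [h, Finset.sum_eq_single c, Corner.IsCentral.fixedMap_extend]
  · exact fun d _ hd => hK.fixedMap_extend_of_ne hd.symm _
  · exact fun h => absurd (Finset.mem_univ c) h

theorem isRegular (h : ∀ c, IsRegular (RMod (D c))) : IsRegular (RMod A) := by
  intro M N f
  choose g hg using fun c => h c ((K c).fixedMap f)
  obtain ⟨g', hg'⟩ := hK.exists_fixedMap_eq g
  refine ⟨g', hK.hom_ext fun c => ?_⟩
  rw [Corner.fixedMap_comp, Corner.fixedMap_comp, hg', hg]

end IsBlockDecomposition

variable {D : Bool → Mon C} {K : ∀ c, Corner A (D c)} (hK : IsBlockDecomposition K)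
  [IsIdempotentComplete C] [MonoidalPreadditive C]

include hK

theorem IsBlockDecomposition.isZero_fixed_restrict {c d : Bool} (h : c ≠ d) (N : RMod (D c)) :
    IsZero ((K d).fixedObj ((hK.central c).restrict N)) := by
  rw [IsZero.iff_id_eq_zero]
  apply Corner.fixed_hom_ext
  have h1 : ((hK.central c).restrict N).mulRight (K d).e = 0 := by
    have h2 : (K d).e ≫ (K c).proj = 0 := by
      rw [← cancel_mono (K c).incl, Category.assoc, ← (hK.central c).mulRight_eq,
        hK.orthogonal h.symm, zero_comp]
    rw [mulRight, ← MonoidalCategory.whiskerLeft_comp_assoc, h2,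
      MonoidalPreadditive.whiskerLeft_zero, zero_comp, comp_zero]
  have h3 := ((K d).fixed ((hK.central c).restrict N)).incl_idem.symm.trans
    ((congrArg (_ ≫ ·) h1).trans comp_zero)
  rw [h3, comp_zero, comp_zero]

/-- Two blocks suffice here, since this feeds the definition of indecomposability. A pair of modules
is reached by the biproduct of their restrictions to `A`. -/
theorem IsBlockDecomposition.isEquivalence_prod [HasBinaryBiproducts (RMod A)] :
    ((K true).functor.prod' (K false).functor).IsEquivalence where
  faithful := ⟨fun {M N f g} h => hK.hom_ext fun c => by
    cases c
    · exact congrArg Prod.snd h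
    · exact congrArg Prod.fst h⟩
  full := ⟨fun {M N} φ => by
    obtain ⟨f, hf⟩ := hK.exists_fixedMap_eq (M := M) (N := N)
      (fun c => match c with | true => φ.1 | false => φ.2)
    exact ⟨f, Prod.ext (hf true) (hf false)⟩⟩
  essSurj := ⟨fun ⟨N₁, N₂⟩ => by
    let M₁ := (hK.central true).restrict N₁
    let M₂ := (hK.central false).restrict N₂
    have h₁ : IsZero ((K false).functor.obj M₁) := hK.isZero_fixed_restrict (by simp) N₁
    have h₂ : IsZero ((K true).functor.obj M₂) := hK.isZero_fixed_restrict (by simp) N₂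
    have := preservesBinaryBiproducts_of_preservesBiproducts (K true).functor
    have := preservesBinaryBiproducts_of_preservesBiproducts (K false).functor
    refine ⟨M₁ ⊞ M₂, ⟨Iso.prod ?_ ?_⟩⟩
    · exact (K true).functor.mapBiprod M₁ M₂ ≪≫ (isoBiprodZero h₂).symm ≪≫
        (hK.central true).fixedRestrict N₁
    · exact (K false).functor.mapBiprod M₁ M₂ ≪≫ (isoZeroBiprod h₁).symm ≪≫
        (hK.central false).fixedRestrict N₂⟩

end Families

end MultiFusion

namespace MultiFusion

open RMod

variable {C : Type u} [Category.{v} C] [MonoidalCategory C]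

/-! ### Peirce components `e A f` and their relative tensor products. -/

section RelativeTensor

variable [HasCoequalizers C] [RigidCategory C] {R S T : Mon C} (P : Bimod R S) (Q : Bimod S T)

/-- The projection to the relative tensor product. -/
noncomputable def tensorProj : P.X ⊗ Q.X ⟶ (P.tensorBimod Q).X :=
  coequalizer.π (P.actRight ▷ Q.X) ((α_ P.X S.X Q.X).hom ≫ P.X ◁ Q.actLeft)

instance : Epi (tensorProj P Q) := inferInstanceAs (Epi (coequalizer.π _ _))

instance (Z : C) : Epi (Z ◁ tensorProj P Q) :=
  inferInstanceAs (Epi ((tensorLeft Z).map (coequalizer.π _ _)))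

instance (Z : C) : Epi (tensorProj P Q ▷ Z) :=
  inferInstanceAs (Epi ((tensorRight Z).map (coequalizer.π _ _)))

theorem whiskerLeft_tensorProj : R.X ◁ tensorProj P Q ≫ (P.tensorBimod Q).actLeft =
    (α_ _ _ _).inv ≫ P.actLeft ▷ Q.X ≫ tensorProj P Q :=
  Bimod.TensorBimod.whiskerLeft_π_actLeft P Q

theorem tensorProj_whiskerRight : tensorProj P Q ▷ T.X ≫ (P.tensorBimod Q).actRight =
    (α_ _ _ _).hom ≫ P.X ◁ Q.actRight ≫ tensorProj P Q :=
  Bimod.TensorBimod.π_tensor_id_actRight P Q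

end RelativeTensor

section PointAlgebra

variable {A : Mon C}

/-- Left multiplication by a point. -/
abbrev leftMul (e : 𝟙_ C ⟶ A.X) : A.X ⟶ A.X := (ofPoint (M := self A) e).hom

/-- Right multiplication by a point. -/
abbrev rightMul (e : 𝟙_ C ⟶ A.X) : A.X ⟶ A.X := (self A).mulRight e

theorem mul_leftMul (e : 𝟙_ C ⟶ A.X) : μ[A.X] ≫ leftMul e = leftMul e ▷ A.X ≫ μ[A.X] :=
  (ofPoint (M := self A) e).act_hom

theorem mul_rightMul (e : 𝟙_ C ⟶ A.X) : μ[A.X] ≫ rightMul e = A.X ◁ rightMul e ≫ μ[A.X] :=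
  act_mulRight (self A) e

theorem rightMul_whiskerRight_mul (e : 𝟙_ C ⟶ A.X) :
    rightMul e ▷ A.X ≫ μ[A.X] = A.X ◁ leftMul e ≫ μ[A.X] :=
  mulRight_whiskerRight_act (self A) e

theorem leftMul_leftMul (e f : 𝟙_ C ⟶ A.X) : leftMul e ≫ leftMul f = leftMul (e ≫ leftMul f) := by
  rw [leftMul, leftMul, ← comp_hom, ofPoint_comp]

theorem rightMul_rightMul (e f : 𝟙_ C ⟶ A.X) :
    rightMul e ≫ rightMul f = rightMul (e ≫ rightMul f) := mulRight_mulRight (self A) e f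

theorem leftMul_rightMul (e f : 𝟙_ C ⟶ A.X) :
    leftMul e ≫ rightMul f = rightMul f ≫ leftMul e :=
  (mulRight_hom (ofPoint (M := self A) e) f).symm

theorem point_leftMul (e f : 𝟙_ C ⟶ A.X) : e ≫ leftMul f = f ≫ rightMul e := by
  have := point_mulRight (self A) (ofPoint (M := self A) f) e
  rw [point_ofPoint] at this
  exact this.symm

theorem leftMul_one : leftMul η[A.X] = 𝟙 A.X := by simp

theorem leftMul_eq (e : 𝟙_ C ⟶ A.X) : leftMul e = (λ_ A.X).inv ≫ e ▷ A.X ≫ μ[A.X] := rfl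

theorem rightMul_eq (e : 𝟙_ C ⟶ A.X) : rightMul e = (ρ_ A.X).inv ≫ A.X ◁ e ≫ μ[A.X] := rfl

end PointAlgebra

/-- An idempotent point of an algebra. -/
structure IdempotentPoint (A : Mon C) where
  /-- The point. -/
  pt : 𝟙_ C ⟶ A.X
  idem : pt ≫ rightMul pt = pt

section Peirce

variable {A : Mon C}

theorem IdempotentPoint.leftMul_idem (e : IdempotentPoint A) :
    leftMul e.pt ≫ leftMul e.pt = leftMul e.pt := by
  rw [leftMul_leftMul, point_leftMul, e.idem]

theorem IdempotentPoint.rightMul_idem (e : IdempotentPoint A) :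
    rightMul e.pt ≫ rightMul e.pt = rightMul e.pt := by
  rw [rightMul_rightMul, e.idem]

variable [IsIdempotentComplete C]

/-- The Peirce component `e A f`. -/
noncomputable def peirce (e f : IdempotentPoint A) : IdemSplitting (leftMul e.pt ≫ rightMul f.pt) :=
  splitting _ (by
    rw [Category.assoc, ← reassoc_of% leftMul_rightMul e.pt f.pt, reassoc_of% e.leftMul_idem,
      f.rightMul_idem])

theorem peirce_incl_leftMul (e f : IdempotentPoint A) :
    (peirce e f).incl ≫ leftMul e.pt = (peirce e f).incl := by
  have h := (peirce e f).incl_idem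
  rw [← (peirce e f).incl_idem, Category.assoc, Category.assoc, ← leftMul_rightMul,
    reassoc_of% e.leftMul_idem]

theorem peirce_incl_rightMul (e f : IdempotentPoint A) :
    (peirce e f).incl ≫ rightMul f.pt = (peirce e f).incl := by
  rw [← (peirce e f).incl_idem, Category.assoc, Category.assoc, f.rightMul_idem]

/-- The multiplication of Peirce components. -/
noncomputable def peirceMul (e f g : IdempotentPoint A) :
    (peirce e f).obj ⊗ (peirce f g).obj ⟶ (peirce e g).obj :=
  (peirce e f).incl ▷ _ ≫ A.X ◁ (peirce f g).incl ≫ μ[A.X] ≫ (peirce e g).proj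

theorem peirceMul_incl (e f g : IdempotentPoint A) : peirceMul e f g ≫ (peirce e g).incl =
    (peirce e f).incl ▷ _ ≫ A.X ◁ (peirce f g).incl ≫ μ[A.X] := by
  rw [peirceMul, Category.assoc, Category.assoc, Category.assoc, IdemSplitting.proj_incl,
    reassoc_of% mul_leftMul, mul_rightMul, whisker_exchange_assoc,
    ← whisker_exchange_assoc (peirce e f).incl, ← comp_whiskerRight_assoc, peirce_incl_leftMul,
    whisker_exchange_assoc, ← MonoidalCategory.whiskerLeft_comp_assoc, peirce_incl_rightMul]

/-- The unit of `e A e`. -/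
noncomputable def peirceOne (e : IdempotentPoint A) : 𝟙_ C ⟶ (peirce e e).obj :=
  e.pt ≫ (peirce e e).proj

@[simp] theorem peirceOne_incl (e : IdempotentPoint A) :
    peirceOne e ≫ (peirce e e).incl = e.pt := by
  rw [peirceOne, Category.assoc, IdemSplitting.proj_incl, ← Category.assoc, point_leftMul, e.idem,
    e.idem]

theorem one_peirceMul (e f : IdempotentPoint A) :
    peirceOne e ▷ (peirce e f).obj ≫ peirceMul e e f = (λ_ _).hom := by
  rw [← cancel_mono (peirce e f).incl, Category.assoc, peirceMul_incl, ← comp_whiskerRight_assoc,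
    peirceOne_incl, ← whisker_exchange_assoc, ← leftUnitor_naturality]
  conv_rhs => rw [← peirce_incl_leftMul e f]
  change _ = _ ◁ ((peirce e f).incl ≫ (λ_ A.X).inv ≫ e.pt ▷ A.X ≫ μ[A.X]) ≫ _
  simp

theorem peirceMul_one (e f : IdempotentPoint A) :
    (peirce e f).obj ◁ peirceOne f ≫ peirceMul e f f = (ρ_ _).hom := by
  rw [← cancel_mono (peirce e f).incl, Category.assoc, peirceMul_incl, whisker_exchange_assoc,
    ← MonoidalCategory.whiskerLeft_comp_assoc, peirceOne_incl, ← rightUnitor_naturality]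
  conv_rhs => rw [← peirce_incl_rightMul e f]
  change _ = ((peirce e f).incl ≫ (ρ_ A.X).inv ≫ A.X ◁ f.pt ≫ μ[A.X]) ▷ _ ≫ _
  simp

theorem peirceMul_assoc (e f g h : IdempotentPoint A) :
    peirceMul e f g ▷ _ ≫ peirceMul e g h =
      (α_ _ _ _).hom ≫ _ ◁ peirceMul f g h ≫ peirceMul e f h := by
  rw [← cancel_mono (peirce e h).incl, Category.assoc, Category.assoc, Category.assoc,
    peirceMul_incl, peirceMul_incl, ← comp_whiskerRight_assoc, peirceMul_incl,
    whisker_exchange_assoc, ← MonoidalCategory.whiskerLeft_comp_assoc, peirceMul_incl]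
  simp only [comp_whiskerRight, Category.assoc, MonoidalCategory.whiskerLeft_comp]
  rw [← whisker_exchange_assoc, MonObj.mul_assoc]
  simp

/-- The algebra `e A e`. -/
noncomputable abbrev peirceAlg (e : IdempotentPoint A) : Mon C where
  X := (peirce e e).obj
  mon :=
    { one := peirceOne e
      mul := peirceMul e e e
      one_mul := one_peirceMul e e
      mul_one := peirceMul_one e e
      mul_assoc := peirceMul_assoc e e e e }

/-- The bimodule `e A f`. -/
noncomputable abbrev peirceBimod (e f : IdempotentPoint A) : Bimod (peirceAlg e) (peirceAlg f) where
  X := (peirce e f).obj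
  actLeft := peirceMul e e f
  one_actLeft := one_peirceMul e f
  left_assoc := peirceMul_assoc e e e f
  actRight := peirceMul e f f
  actRight_one := peirceMul_one e f
  right_assoc := by rw [Iso.eq_inv_comp]; exact (peirceMul_assoc e f f f).symm
  middle_assoc := peirceMul_assoc e e f f

/-- `e A e` as a corner. -/
noncomputable abbrev peirceCorner (e : IdempotentPoint A) : Corner A (peirceAlg e) where
  incl := (peirce e e).incl
  proj := (peirce e e).proj
  incl_proj := (peirce e e).incl_proj
  mul_incl := by
    rw [MonoidalCategory.tensorHom_def, Category.assoc]
    exact (peirceMul_incl e e e).symm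
  proj_incl := by
    change _ = leftMul (peirceOne e ≫ _) ≫ rightMul (peirceOne e ≫ _)
    rw [peirceOne_incl, IdemSplitting.proj_incl]

theorem peirceCorner_e (e : IdempotentPoint A) : (peirceCorner e).e = e.pt := peirceOne_incl e

/-- A copairing between `e A f` and `f A e` with product `e`. -/
structure PeirceDual (e f : IdempotentPoint A) where
  /-- The copairing. -/
  copairing : 𝟙_ C ⟶ (peirce e f).obj ⊗ (peirce f e).obj
  copairing_mul : copairing ≫ peirceMul e f e = peirceOne e

namespace PeirceDual

variable {l j : IdempotentPoint A} (d : PeirceDual l j)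

/-- A section of the multiplication. -/
noncomputable def sec (i : IdempotentPoint A) :
    (peirce i l).obj ⟶ (peirce i j).obj ⊗ (peirce j l).obj :=
  (ρ_ _).inv ≫ (peirce i l).obj ◁ d.copairing ≫ (α_ _ _ _).inv ≫ peirceMul i l j ▷ _

/-- If the copairing is `∑ a ⊗ b`, then `sec` sends `x` to `∑ x a ⊗ b`, and `∑ x a b = x`. -/
theorem sec_mul (i : IdempotentPoint A) : d.sec i ≫ peirceMul i j l = 𝟙 _ := by
  simp only [sec, Category.assoc]
  rw [peirceMul_assoc, Iso.inv_hom_id_assoc, ← MonoidalCategory.whiskerLeft_comp_assoc,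
    d.copairing_mul, peirceMul_one, Iso.inv_hom_id]

theorem mul_sec (i h : IdempotentPoint A) : peirceMul i h l ≫ d.sec i =
    (peirce i h).obj ◁ d.sec h ≫ (α_ _ _ _).inv ≫ peirceMul i h j ▷ (peirce j l).obj := by
  simp only [sec, MonoidalCategory.whiskerLeft_comp, Category.assoc]
  rw [rightUnitor_inv_naturality_assoc, ← whisker_exchange_assoc,
    associator_inv_naturality_left_assoc, ← comp_whiskerRight, peirceMul_assoc]
  simp

/-- The Peirce multiplication is a split coequalizer. -/
noncomputable def isSplitCoequalizer (i : IdempotentPoint A) :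
    IsSplitCoequalizer ((peirceBimod i j).actRight ▷ (peirceBimod j l).X)
      ((α_ (peirceBimod i j).X (peirceAlg j).X (peirceBimod j l).X).hom ≫
        (peirceBimod i j).X ◁ (peirceBimod j l).actLeft) (peirceMul i j l) where
  rightSection := d.sec i
  -- The same copairing applied to the second tensor factor; `mul_sec` is the compatibility of the
  -- two sections.
  leftSection := (peirce i j).obj ◁ d.sec j ≫ (α_ _ _ _).inv
  condition := by rw [Category.assoc]; exact peirceMul_assoc i j j l
  rightSection_π := d.sec_mul i
  leftSection_bottom := by
    rw [Category.assoc, Iso.inv_hom_id_assoc, ← MonoidalCategory.whiskerLeft_comp]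
    exact (congrArg _ (d.sec_mul j)).trans (MonoidalCategory.whiskerLeft_id _ _)
  leftSection_top := by rw [Category.assoc]; exact (d.mul_sec i j).symm

variable [HasCoequalizers C] [RigidCategory C]

/-- The comparison map between the relative tensor product and the Peirce component, as an
isomorphism in `C`. -/
noncomputable def tensorObjIso (i : IdempotentPoint A) :
    ((peirceBimod i j).tensorBimod (peirceBimod j l)).X ≅ (peirceBimod i l).X :=
  (coequalizerIsCoequalizer _ _).coconePointUniqueUpToIso (d.isSplitCoequalizer i).isCoequalizer

theorem tensorProj_tensorObjIso (i : IdempotentPoint A) :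
    tensorProj (peirceBimod i j) (peirceBimod j l) ≫ (d.tensorObjIso i).hom = peirceMul i j l :=
  (coequalizerIsCoequalizer _ _).comp_coconePointUniqueUpToIso_hom
    (d.isSplitCoequalizer i).isCoequalizer WalkingParallelPair.one

/-- The isomorphism between the relative tensor product of `i A j` and `j A l` and `i A l`. -/
noncomputable def tensorIso (i : IdempotentPoint A) :
    (peirceBimod i j).tensorBimod (peirceBimod j l) ≅ peirceBimod i l :=
  Bimod.isoOfIso (d.tensorObjIso i)
    (by
      rw [← cancel_epi ((peirceAlg i).X ◁ tensorProj (peirceBimod i j) (peirceBimod j l)),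
        reassoc_of% whiskerLeft_tensorProj (peirceBimod i j) (peirceBimod j l),
        tensorProj_tensorObjIso, Iso.inv_comp_eq]
      refine (peirceMul_assoc i i j l).trans (congrArg _ ?_)
      rw [← d.tensorProj_tensorObjIso, MonoidalCategory.whiskerLeft_comp_assoc])
    (by
      rw [← cancel_epi (tensorProj (peirceBimod i j) (peirceBimod j l) ▷ (peirceAlg l).X),
        reassoc_of% tensorProj_whiskerRight (peirceBimod i j) (peirceBimod j l),
        tensorProj_tensorObjIso]
      refine (peirceMul_assoc i j l l).symm.trans ?_
      rw [← d.tensorProj_tensorObjIso, comp_whiskerRight_assoc])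

theorem tensorProj_tensorIso (i : IdempotentPoint A) :
    tensorProj (peirceBimod i j) (peirceBimod j l) ≫ (d.tensorIso i).hom.hom = peirceMul i j l :=
  d.tensorProj_tensorObjIso i

end PeirceDual

end Peirce

end MultiFusion

namespace MultiFusion

open RMod

/-! ### Simple decompositions and primitive idempotents. -/

section SimpleDecomposition

variable {k : Type w} [Field k] {M : Type u} [Category.{v} M] [Preadditive M] [Linear k M]

/-- Endomorphisms of the image embed in those of `X`, and the embedding reaches `𝟙 X` only if `p = 𝟙
X`. This drives the induction in the simple decomposition. -/
theorem finrank_end_lt [∀ X Y : M, Module.Finite k (X ⟶ Y)] {X : M} {p : X ⟶ X}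
    (S : IdemSplitting p) (hp : p ≠ 𝟙 X) :
    Module.finrank k (S.obj ⟶ S.obj) < Module.finrank k (X ⟶ X) := by
  let Φ : (S.obj ⟶ S.obj) →ₗ[k] (X ⟶ X) :=
    Linear.leftComp k X S.proj ∘ₗ Linear.rightComp k S.obj S.incl
  have hΦ : ∀ f, Φ f = S.proj ≫ f ≫ S.incl := fun _ => rfl
  have hinj : Function.Injective Φ := fun f g h => by
    rw [hΦ, hΦ] at h
    have h2 := congrArg (fun t => S.incl ≫ t ≫ S.proj) h
    simpa only [Category.assoc, S.incl_proj, reassoc_of% S.incl_proj, Category.comp_id] using h2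
  rw [← LinearMap.finrank_range_of_inj hinj]
  refine Submodule.finrank_lt fun htop => hp ?_
  obtain ⟨f, hf⟩ := LinearMap.range_eq_top.1 htop (𝟙 X)
  rw [hΦ] at hf
  rw [← Category.id_comp p, ← hf, Category.assoc, Category.assoc, S.incl_idem]

/-- In a split finite category, every object is a finite direct sum of simple objects. -/
theorem IsSplitFinite.exists_simple_decomposition (h : IsSplitFinite k M) (X : M) :
    ∃ (J : Type) (_ : Fintype J) (Y : J → M) (i : ∀ j, Y j ⟶ X) (r : ∀ j, X ⟶ Y j),
      (∀ j, Simple (Y j)) ∧ (∀ j, i j ≫ r j = 𝟙 _) ∧ (∀ j l, j ≠ l → i j ≫ r l = 0) ∧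
      ∑ j, r j ≫ i j = 𝟙 X := by
  have := h.finite_hom
  have := h.isIdempotentComplete
  induction hN : Module.finrank k (X ⟶ X) using Nat.strong_induction_on generalizing X with
  | _ N ih =>
  subst hN
  by_cases h0 : 𝟙 X = 0
  · exact ⟨Empty, inferInstance, Empty.elim, nofun, nofun, nofun, nofun, nofun, by simp [h0]⟩
  by_cases hX : Simple X
  · exact ⟨Unit, inferInstance, fun _ => X, fun _ => 𝟙 X, fun _ => 𝟙 X, fun _ => hX, by simp,
      fun _ _ h => absurd rfl h, by simp⟩
  rw [h.regular.simple_iff] at hX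
  push Not at hX
  obtain ⟨p, hp, hp0, hp1⟩ := hX h0
  -- Both `p` and its complement differ from `𝟙 X`, so both images have smaller endomorphism spaces.
  have hq : (𝟙 X - p) ≫ (𝟙 X - p) = 𝟙 X - p := by simp [hp]
  let S := splitting p hp
  let T := splitting (𝟙 X - p) hq
  have hq1 : 𝟙 X - p ≠ 𝟙 X := fun h => hp0 (by simpa using h)
  obtain ⟨J, _, Y, i, r, hY, h1, h2, h3⟩ := ih _ (finrank_end_lt (k := k) S hp1) S.obj rfl
  obtain ⟨J', _, Y', i', r', hY', h1', h2', h3'⟩ := ih _ (finrank_end_lt (k := k) T hq1) T.obj rfl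
  have hST : S.incl ≫ T.proj = 0 := by
    rw [← S.incl_idem, ← T.idem_proj, Category.assoc]
    have : p ≫ (𝟙 X - p) ≫ T.proj = 0 := by rw [← Category.assoc]; simp [hp]
    rw [this, comp_zero]
  have hTS : T.incl ≫ S.proj = 0 := by
    rw [← T.incl_idem, ← S.idem_proj, Category.assoc]
    have : (𝟙 X - p) ≫ p ≫ S.proj = 0 := by rw [← Category.assoc]; simp [hp]
    rw [this, comp_zero]
  refine ⟨J ⊕ J', inferInstance, Sum.elim Y Y',
    Sum.rec (fun j => i j ≫ S.incl) (fun j => i' j ≫ T.incl),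
    Sum.rec (fun j => S.proj ≫ r j) (fun j => T.proj ≫ r' j), ?_, ?_, ?_, ?_⟩
  · rintro (j | j)
    exacts [hY j, hY' j]
  · rintro (j | j)
    · simp [reassoc_of% S.incl_proj, h1]
    · simp [reassoc_of% T.incl_proj, h1']
  · rintro (j | j) (l | l) hjl
    · change (i j ≫ S.incl) ≫ S.proj ≫ r l = 0
      rw [Category.assoc, reassoc_of% S.incl_proj, h2 j l (by simpa using hjl)]
    · change (i j ≫ S.incl) ≫ T.proj ≫ r' l = 0
      rw [Category.assoc, reassoc_of% hST, zero_comp, comp_zero]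
    · change (i' j ≫ T.incl) ≫ S.proj ≫ r l = 0
      rw [Category.assoc, reassoc_of% hTS, zero_comp, comp_zero]
    · change (i' j ≫ T.incl) ≫ T.proj ≫ r' l = 0
      rw [Category.assoc, reassoc_of% T.incl_proj, h2' j l (by simpa using hjl)]
  · rw [Fintype.sum_sum_type]
    have e1 : ∑ j, (S.proj ≫ r j) ≫ i j ≫ S.incl = p := by
      have h4 : ∑ j, (S.proj ≫ r j) ≫ i j ≫ S.incl =
          S.proj ≫ (∑ j, r j ≫ i j) ≫ S.incl := by
        simp only [Preadditive.sum_comp, Preadditive.comp_sum, Category.assoc]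
      rw [h4, h3, Category.id_comp, S.proj_incl]
    have e2 : ∑ j, (T.proj ≫ r' j) ≫ i' j ≫ T.incl = 𝟙 X - p := by
      have h4 : ∑ j, (T.proj ≫ r' j) ≫ i' j ≫ T.incl =
          T.proj ≫ (∑ j, r' j ≫ i' j) ≫ T.incl := by
        simp only [Preadditive.sum_comp, Preadditive.comp_sum, Category.assoc]
      rw [h4, h3', Category.id_comp, T.proj_incl]
    exact (congrArg₂ (· + ·) e1 e2).trans (by simp)

end SimpleDecomposition

section Sums

variable {C : Type u} [Category.{v} C] [MonoidalCategory C] [Preadditive C]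
  [MonoidalPreadditive C] {A : Mon C}

theorem leftMul_sum {J : Type*} (s : Finset J) (e : J → (𝟙_ C ⟶ A.X)) :
    leftMul (∑ j ∈ s, e j) = ∑ j ∈ s, leftMul (e j) := by
  simp only [leftMul_eq, sum_whiskerRight, Preadditive.sum_comp, Preadditive.comp_sum]

theorem rightMul_sum {J : Type*} (s : Finset J) (e : J → (𝟙_ C ⟶ A.X)) :
    rightMul (∑ j ∈ s, e j) = ∑ j ∈ s, rightMul (e j) := mulRight_sum _ _ _

theorem leftMul_zero : leftMul (0 : 𝟙_ C ⟶ A.X) = 0 := by simp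

theorem rightMul_zero : rightMul (0 : 𝟙_ C ⟶ A.X) = 0 := mulRight_zero _

end Sums

section Primitive

variable {C : Type u} [Category.{v} C] [MonoidalCategory C] [Preadditive C]
  [IsIdempotentComplete C] {A : Mon C}

/-- A complete family of orthogonal primitive idempotents. -/
structure IsPrimitiveFamily [MonoidalPreadditive C] {J : Type*} [Fintype J]
    (e : J → IdempotentPoint A) : Prop where
  simple (j : J) : ∃ P : (peirceCorner (e j)).Projective, Simple P.obj
  orthogonal {j l : J} (h : j ≠ l) : (e j).pt ≫ rightMul (e l).pt = 0
  sum_pt : ∑ j, (e j).pt = η[A.X]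

/-- Endomorphisms of the regular module are left multiplications by points, so its projections onto
simple summands become idempotent points of `A`. -/
theorem exists_isPrimitiveFamily [MonoidalPreadditive C] {k : Type w} [Field k] [Linear k C]
    [MonoidalLinear k C] (h : IsSplitFinite k (RMod A)) :
    ∃ (J : Type) (_ : Fintype J) (e : J → IdempotentPoint A), IsPrimitiveFamily e := by
  obtain ⟨J, _, Y, i, r, hY, h1, h2, h3⟩ := h.exists_simple_decomposition (self A)
  have key : ∀ j l, point (r j ≫ i j) ≫ rightMul (point (r l ≫ i l)) =
      point (r l ≫ (i l ≫ r j) ≫ i j) := by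
    intro j l
    rw [← point_leftMul, leftMul, ofPoint_point, ← point_comp]
    simp
  refine ⟨J, inferInstance, fun j => ⟨point (r j ≫ i j), ?_⟩, fun j => ?_, fun {j l} hjl => ?_, ?_⟩
  · rw [key, h1, Category.id_comp]
  · exact ⟨⟨Y j, i j, r j, h1 j, by rw [peirceCorner_e, ofPoint_point]⟩, hY j⟩
  · rw [key, h2 l j hjl.symm]
    simp [point]
  · simp only [point]
    rw [← Preadditive.comp_sum, ← sum_hom, h3]
    simp

/-- The Peirce component `e A f` is nonzero. -/
def Linked (e f : IdempotentPoint A) : Prop := leftMul e.pt ≫ rightMul f.pt ≠ 0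

theorem Linked.incl_ne_zero {e f : IdempotentPoint A} (h : Linked e f) : (peirce e f).incl ≠ 0 :=
  fun h0 => h (by rw [← (peirce e f).proj_incl, h0, comp_zero])

theorem linked_of_not_isZero {e f : IdempotentPoint A} (h : ¬ IsZero (peirce e f).obj) :
    Linked e f := fun h0 => h (by
  have h1 : (peirce e f).incl = 0 :=
    (peirce e f).incl_idem.symm.trans ((congrArg (_ ≫ ·) h0).trans comp_zero)
  rw [IsZero.iff_id_eq_zero, ← (peirce e f).incl_proj, h1, zero_comp])

variable [MonoidalPreadditive C]

namespace PeirceDual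

variable {l j : IdempotentPoint A} (d : PeirceDual l j)

include d

/-- The section `sec` passes through `i A j ⊗ j A l`, so the vanishing of `i A j` would force `i A l
= 0`. -/
theorem linked_trans {i : IdempotentPoint A} (h : Linked i l) : Linked i j := by
  refine linked_of_not_isZero fun h0 => h.incl_ne_zero ?_
  have h1 : peirceMul i l j = 0 := h0.eq_of_tgt _ _
  rw [← Category.id_comp (peirce i l).incl, ← d.sec_mul i, sec, h1]
  simp

theorem linked_symm (hl : l.pt ≠ 0) : Linked j l := by
  refine linked_of_not_isZero fun h0 => hl ?_
  have h1 : peirceMul l j l = 0 := by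
    rw [← Category.id_comp (peirceMul l j l), ← MonoidalCategory.whiskerLeft_id,
      (IsZero.iff_id_eq_zero _).1 h0]
    simp
  rw [← peirceOne_incl, ← d.copairing_mul, h1]
  simp

end PeirceDual

/-- Multiplication gives a nonzero map from `e A f ⊗ A` to the simple module `e A`, hence a split
epimorphism. Applying a section to `e` expresses `e` as a product of elements of `e A f` and `A`. -/
theorem Linked.nonempty_peirceDual (hA : IsRegular (RMod A)) {e f : IdempotentPoint A}
    (h : Linked e f) (P : (peirceCorner e).Projective) [Simple P.obj] :
    Nonempty (PeirceDual e f) := by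
  have := RMod.isIdempotentComplete (A := A)
  let φ : ltensor (peirce e f).obj (self A) ⟶ self A := freeDesc (peirce e f).incl
  have hri : (P.r ≫ P.i).hom = leftMul e.pt := by rw [P.r_i, peirceCorner_e]
  have h1 : (φ ≫ P.r) ≫ P.i = φ := by
    refine free_hom_ext ?_
    rw [Category.assoc, comp_hom, hri, freeDesc_hom]
    simp only [Category.assoc]
    rw [reassoc_of% freeUnit_freeDesc (M := self A), freeUnit_freeDesc (M := self A),
      peirce_incl_leftMul]
  have hφ : φ ≠ 0 := fun h0 => h.incl_ne_zero (by
    rw [← freeUnit_freeDesc (M := self A) (peirce e f).incl]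
    change freeUnit A _ ≫ φ.hom = 0
    rw [h0, zero_hom, comp_zero])
  obtain ⟨g, hg⟩ := hA.exists_section_of_simple (φ ≫ P.r)
    (fun h0 => hφ (by rw [← h1, h0, zero_comp]))
  have h2 : point (P.r ≫ g) ≫ (peirce e f).incl ▷ A.X ≫ μ[A.X] = e.pt := by
    have h3 : (P.r ≫ g) ≫ φ = P.r ≫ P.i := by
      conv_lhs => rw [← h1]
      rw [Category.assoc, Category.assoc φ, reassoc_of% hg]
    have h4 := congrArg point h3
    rw [point_comp, P.r_i, point_ofPoint, peirceCorner_e] at h4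
    exact h4
  -- The point is an element `∑ a ⊗ b` of `e A f ⊗ A` with `∑ a b = e`. Replacing `b` by `f b e`
  -- does not change the product, since `a f = a` and `e e = e`.
  refine ⟨⟨point (P.r ≫ g) ≫ _ ◁ (peirce f e).proj, ?_⟩⟩
  rw [← cancel_mono (peirce e e).incl, Category.assoc, Category.assoc, peirceMul_incl,
    peirceOne_incl, whisker_exchange_assoc, ← MonoidalCategory.whiskerLeft_comp_assoc,
    IdemSplitting.proj_incl, ← whisker_exchange_assoc]
  have h5 : A.X ◁ (leftMul f.pt ≫ rightMul e.pt) ≫ μ[A.X] =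
      rightMul f.pt ▷ A.X ≫ μ[A.X] ≫ rightMul e.pt := by
    rw [mul_rightMul, ← whisker_exchange_assoc, rightMul_whiskerRight_mul, leftMul_rightMul,
      MonoidalCategory.whiskerLeft_comp_assoc]
  rw [whisker_exchange_assoc]
  refine (congrArg (fun t => point (P.r ≫ g) ≫ (peirce e f).incl ▷ A.X ≫ t) h5).trans ?_
  rw [← comp_whiskerRight_assoc, peirce_incl_rightMul, reassoc_of% h2, e.idem]

end Primitive

end MultiFusion

namespace MultiFusion

open RMod

/-! ### Matrix presentations from orthogonal families of idempotents. -/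

section Families

/-- A bicone from orthogonal retracts. -/
abbrev biconeMk {M : Type*} [Category* M] [HasZeroMorphisms M] {J : Type*} {F : J → M} (X : M)
    (i : ∀ j, F j ⟶ X) (r : ∀ j, X ⟶ F j) (h1 : ∀ j, i j ≫ r j = 𝟙 _)
    (h2 : ∀ j l, j ≠ l → i j ≫ r l = 0) : Bicone F :=
  ⟨X, r, i, fun j l => by
    split_ifs with h
    · subst h
      simpa using h1 j
    · exact h2 j l h⟩

variable {C : Type u} [Category.{v} C] [Preadditive C] [MonoidalCategory C] {A : Mon C}

/-- A family of orthogonal idempotents with sum the unit of a corner. -/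
structure IsOrthogonalFamily {A D : Mon C} (K : Corner A D) {J : Type*} [Fintype J]
    (f : J → IdempotentPoint A) : Prop where
  orthogonal {i j : J} (h : i ≠ j) : (f i).pt ≫ rightMul (f j).pt = 0
  sum_pt : ∑ i, (f i).pt = K.e

namespace IsOrthogonalFamily

variable {D : Mon C} {K : Corner A D} {J : Type*} [Fintype J]
  {f : J → IdempotentPoint A} (hf : IsOrthogonalFamily K f)

include hf

theorem pt_leftMul (i : J) : (f i).pt ≫ leftMul K.e = (f i).pt := by
  rw [point_leftMul, ← hf.sum_pt, Preadditive.sum_comp, Finset.sum_eq_single i, (f i).idem]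
  · exact fun j _ hj => hf.orthogonal hj
  · exact fun h => absurd (Finset.mem_univ i) h

variable [MonoidalPreadditive C]

theorem pt_rightMul (i : J) : (f i).pt ≫ rightMul K.e = (f i).pt := by
  rw [← hf.sum_pt, rightMul_sum, Preadditive.comp_sum, Finset.sum_eq_single i, (f i).idem]
  · exact fun j _ hj => hf.orthogonal hj.symm
  · exact fun h => absurd (Finset.mem_univ i) h

variable [IsIdempotentComplete C]

theorem incl_proj_incl (i j : J) :
    (peirce (f i) (f j)).incl ≫ K.proj ≫ K.incl = (peirce (f i) (f j)).incl := by
  have h1 : (peirce (f i) (f j)).incl ≫ leftMul K.e = (peirce (f i) (f j)).incl := by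
    rw [← peirce_incl_leftMul, Category.assoc, leftMul_leftMul, hf.pt_leftMul]
  have h2 : (peirce (f i) (f j)).incl ≫ rightMul K.e = (peirce (f i) (f j)).incl := by
    rw [← peirce_incl_rightMul, Category.assoc, rightMul_rightMul, hf.pt_rightMul]
  rw [K.proj_incl', reassoc_of% h1, h2]

theorem incl_rightMul_of_ne {i j l : J} (h : j ≠ l) :
    (peirce (f i) (f j)).incl ≫ rightMul (f l).pt = 0 := by
  rw [← peirce_incl_rightMul, Category.assoc, rightMul_rightMul, hf.orthogonal h, rightMul_zero,
    comp_zero]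

theorem incl_leftMul_of_ne {i j l : J} (h : i ≠ l) :
    (peirce (f i) (f j)).incl ≫ leftMul (f l).pt = 0 := by
  rw [← peirce_incl_leftMul, Category.assoc, leftMul_leftMul, point_leftMul,
    hf.orthogonal h.symm, leftMul_zero, comp_zero]

theorem incl_proj_of_ne {i j i' j' : J} (h : (i, j) ≠ (i', j')) :
    (peirce (f i) (f j)).incl ≫ (peirce (f i') (f j')).proj = 0 := by
  have h0 : (peirce (f i) (f j)).incl ≫ leftMul (f i').pt ≫ rightMul (f j').pt = 0 := by
    by_cases hi : i = i'
    · have hj : j ≠ j' := fun hj => h (by rw [hi, hj])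
      rw [leftMul_rightMul (f i').pt (f j').pt, reassoc_of% hf.incl_rightMul_of_ne hj, zero_comp]
    · rw [reassoc_of% hf.incl_leftMul_of_ne hi, zero_comp]
  rw [← (peirce (f i') (f j')).idem_proj, ← Category.assoc, h0, zero_comp]

theorem incl_mul_incl_of_ne {i j j' l : J} (h : j ≠ j') :
    (peirce (f i) (f j)).incl ▷ _ ≫ A.X ◁ (peirce (f j') (f l)).incl ≫ μ[A.X] = 0 := by
  rw [← peirce_incl_rightMul, comp_whiskerRight_assoc, ← whisker_exchange_assoc,
    rightMul_whiskerRight_mul, ← MonoidalCategory.whiskerLeft_comp_assoc,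
    hf.incl_leftMul_of_ne h.symm]
  simp

/-- The Peirce components of a corner, as a bicone. -/
noncomputable abbrev bicone :
    Bicone fun p : J × J => (peirce (f p.1) (f p.2)).obj :=
  biconeMk D.X (fun p => (peirce (f p.1) (f p.2)).incl ≫ K.proj)
    (fun p => K.incl ≫ (peirce (f p.1) (f p.2)).proj)
    (fun p => by
      rw [Category.assoc, reassoc_of% hf.incl_proj_incl, IdemSplitting.incl_proj])
    (fun p q h => by
      rw [Category.assoc, reassoc_of% hf.incl_proj_incl, hf.incl_proj_of_ne h])

/-- Expanding `e = ∑ f_i` on both sides gives `e a e = ∑ f_i a f_j`. -/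
theorem bicone_total : ∑ p, hf.bicone.π p ≫ hf.bicone.ι p = 𝟙 hf.bicone.pt := by
  have h1 : ∀ p, hf.bicone.π p ≫ hf.bicone.ι p =
      K.incl ≫ (leftMul (f p.1).pt ≫ rightMul (f p.2).pt) ≫ K.proj := fun p => by
    have h := (peirce (f p.1) (f p.2)).proj_incl
    change (K.incl ≫ (peirce (f p.1) (f p.2)).proj) ≫ (peirce (f p.1) (f p.2)).incl ≫ K.proj = _
    rw [Category.assoc, reassoc_of% h, Category.assoc]
  have h2 : ∑ p : J × J, leftMul (f p.1).pt ≫ rightMul (f p.2).pt = K.proj ≫ K.incl := by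
    rw [K.proj_incl', ← hf.sum_pt, mulRight_sum]
    change _ = leftMul _ ≫ _
    rw [leftMul_sum, Preadditive.sum_comp, Fintype.sum_prod_type]
    simp only [Preadditive.comp_sum]
  simp only [h1]
  rw [← Preadditive.comp_sum, ← Preadditive.sum_comp, h2, Category.assoc, K.incl_proj,
    Category.comp_id, K.incl_proj]

theorem ι_mul_incl (i j i' l : J) :
    (hf.bicone.ι (i, j) ⊗ₘ hf.bicone.ι (i', l)) ≫ μ[D.X] ≫ K.incl =
      (peirce (f i) (f j)).incl ▷ _ ≫ A.X ◁ (peirce (f i') (f l)).incl ≫ μ[A.X] := by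
  rw [← K.mul_incl, ← Category.assoc, MonoidalCategory.tensorHom_comp_tensorHom, Category.assoc,
    Category.assoc, hf.incl_proj_incl, hf.incl_proj_incl, MonoidalCategory.tensorHom_def,
    Category.assoc]

theorem ι_mul [RigidCategory C] [HasCoequalizers C] {i j l : J}
    (d : PeirceDual (f l) (f j)) :
    (hf.bicone.ι (i, j) ⊗ₘ hf.bicone.ι (j, l)) ≫ μ[D.X] =
      tensorProj (peirceBimod (f i) (f j)) (peirceBimod (f j) (f l)) ≫
        (d.tensorIso (f i)).hom.hom ≫ hf.bicone.ι (i, l) := by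
  have h := hf.incl_proj_incl i l
  rw [← cancel_mono K.incl, Category.assoc, hf.ι_mul_incl, ← Category.assoc (tensorProj _ _),
    d.tensorProj_tensorIso, ← peirceMul_incl, Category.assoc, Category.assoc, h]

end IsOrthogonalFamily

end Families

variable (k : Type w) [Field k] {C : Type u} [Category.{v} C] [Preadditive C] [Linear k C]
  [MonoidalCategory C] [MonoidalPreadditive C] [MonoidalLinear k C] [RigidCategory C]
  [SemisimpleCategory k C] {A : Mon C}

omit [RigidCategory C] [SemisimpleCategory k C] [MonoidalLinear k C] [Linear k C] in
theorem isDivisionAlgebra_of_simple [IsIdempotentComplete C] {D : Mon C} {K : Corner A D}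
    (hA : IsRegular (RMod A)) (P : K.Projective) [Simple P.obj] : IsDivisionAlgebra D :=
  (Corner.simple_iff P hA).1 inferInstance

/-- The regular module itself is the simple generator, with `Z = 𝟙_ C`. -/
theorem isSimpleAlgebra_of_isDivisionAlgebra [IsIdempotentComplete C] (hA : IsFreeRegular A)
    (h : IsDivisionAlgebra A) : IsSimpleAlgebra k A :=
  have : Simple (self A) := h
  ⟨(isSemisimpleAlgebra_iff k).2 hA,
    isIndecomposable_of_simple k hA (P := self A) (Z := 𝟙_ C) (tensorUnit (self A)).inv
      (tensorUnit (self A)).hom (tensorUnit (self A)).inv_hom_id⟩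

/-- A matrix presentation from orthogonal idempotents with Peirce components in duality. -/
noncomputable def IsOrthogonalFamily.matrixPresentation [IsIdempotentComplete C]
    [HasCoequalizers C] {D : Mon C} {K : Corner A D} {n : ℕ} {f : Fin n → IdempotentPoint A}
    (hf : IsOrthogonalFamily K f) (hA : IsFreeRegular A)
    (hs : ∀ i, ∃ P : (peirceCorner (f i)).Projective, Simple P.obj)
    (d : ∀ i j, PeirceDual (f i) (f j)) : MatrixPresentation k D n where
  diag i := peirceAlg (f i)
  simple i := by
    obtain ⟨P, _⟩ := hs i
    exact isSimpleAlgebra_of_isDivisionAlgebra k (Corner.isFreeRegular_corner P hA.isRegular)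
      (isDivisionAlgebra_of_simple hA.isRegular P)
  division i := by
    obtain ⟨P, _⟩ := hs i
    exact isDivisionAlgebra_of_simple hA.isRegular P
  entry i j := peirceBimod (f i) (f j)
  entryDiag i := Iso.refl _
  -- The inverse of `f_i A f_j` is `f_j A f_i`; the two copairings give the two isomorphisms.
  invertible i j := ⟨peirceBimod (f j) (f i), ⟨(d i j).tensorIso (f i)⟩, ⟨(d j i).tensorIso (f j)⟩⟩
  sum := hf.bicone
  isBilimit := isBilimitOfTotal _ hf.bicone_total
  iso := Iso.refl _
  -- The multiplication onto `f_i A f_l` is split by writing `f_l` as an element of `f_l A f_j ⊗ f_j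
  -- A f_l`, hence the order of the indices.
  comp i j l := (d l j).tensorIso (f i)
  mul_eq i j l := by
    simp only [Iso.refl_hom, Category.comp_id]
    exact hf.ι_mul (d l j)
  mul_eq_zero i j j' l h := by
    rw [← cancel_mono K.incl]
    simp only [Iso.refl_hom, Category.comp_id, Category.assoc]
    rw [hf.ι_mul_incl, hf.incl_mul_incl_of_ne h, zero_comp]

end MultiFusion

namespace MultiFusion

open RMod

/-! ### Linkage classes, blocks, and the passage to matrix algebras. -/

section Blocks

variable {C : Type u} [Category.{v} C] [MonoidalCategory C] {A : Mon C}

/-- The algebra as a corner of itself. -/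
abbrev Corner.refl (A : Mon C) : Corner A A where
  incl := 𝟙 _
  proj := 𝟙 _
  incl_proj := Category.comp_id _
  mul_incl := by simp
  proj_incl := by simp

theorem Corner.refl_e : (Corner.refl A).e = η[A.X] := Category.comp_id _

variable [Preadditive C]

theorem linked_self {t : IdempotentPoint A} (h : t.pt ≠ 0) : Linked t t := fun h0 => h (by
  have h1 : t.pt ≫ leftMul t.pt ≫ rightMul t.pt = t.pt := by
    rw [← Category.assoc, point_leftMul, t.idem, t.idem]
  rw [← h1, h0, comp_zero])

variable [MonoidalPreadditive C] [IsIdempotentComplete C]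
  {J : Type*} [Fintype J] {e : J → IdempotentPoint A}

theorem Corner.Projective.pt_ne_zero {t : IdempotentPoint A} (P : (peirceCorner t).Projective)
    [Simple P.obj] : t.pt ≠ 0 := fun h0 => id_nonzero P.obj (by
  have h1 : P.r ≫ P.i = 0 := by
    rw [P.r_i, peirceCorner_e, h0]
    exact RMod.hom_ext (by simp)
  rw [← Category.id_comp (𝟙 _), ← P.i_r, Category.assoc, reassoc_of% h1, zero_comp, comp_zero])

namespace IsPrimitiveFamily

variable (he : IsPrimitiveFamily e)

include he

theorem pt_ne_zero (j : J) : (e j).pt ≠ 0 := by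
  obtain ⟨P, _⟩ := he.simple j
  exact P.pt_ne_zero

theorem nonempty_peirceDual (hA : IsRegular (RMod A)) {i j : J} (h : Linked (e i) (e j)) :
    Nonempty (PeirceDual (e i) (e j)) := by
  obtain ⟨P, _⟩ := he.simple i
  exact h.nonempty_peirceDual hA P

/-- Being linked is an equivalence relation on a family of primitive idempotents. -/
def linkedSetoid (hA : IsRegular (RMod A)) : Setoid J where
  r i j := Linked (e i) (e j)
  iseqv :=
    { refl := fun j => linked_self (he.pt_ne_zero j)
      symm := fun {i j} h => by
        obtain ⟨d⟩ := he.nonempty_peirceDual hA h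
        exact d.linked_symm (he.pt_ne_zero i)
      trans := fun {i j l} h h' => by
        obtain ⟨d⟩ := he.nonempty_peirceDual hA h'
        exact d.linked_trans h }

theorem pt_rightMul_sum [DecidableEq J] (s : Finset J) (j : J) :
    (e j).pt ≫ rightMul (∑ i ∈ s, (e i).pt) = if j ∈ s then (e j).pt else 0 := by
  rw [rightMul_sum, Preadditive.comp_sum]
  split_ifs with h
  · rw [Finset.sum_eq_single_of_mem j h fun i _ hi => he.orthogonal hi.symm, (e j).idem]
  · exact Finset.sum_eq_zero fun i hi => he.orthogonal fun hij => h (hij ▸ hi)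

theorem sum_pt_rightMul (s t : Finset J) [DecidableEq J] :
    (∑ i ∈ s, (e i).pt) ≫ rightMul (∑ i ∈ t, (e i).pt) = ∑ i ∈ s ∩ t, (e i).pt := by
  rw [Preadditive.sum_comp, Finset.sum_congr rfl fun j _ => he.pt_rightMul_sum t j,
    ← Finset.sum_filter, Finset.filter_mem_eq_inter]

/-- The idempotent which is the sum of a subfamily. -/
def subIdem (s : Finset J) : IdempotentPoint A where
  pt := ∑ i ∈ s, (e i).pt
  idem := by
    classical
    rw [he.sum_pt_rightMul, Finset.inter_self]

variable {Q : Type*} [DecidableEq Q] (b : J → Q)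

/-- The idempotents belonging to the fibres of a map. -/
def fiberIdem (q : Q) : IdempotentPoint A := he.subIdem (Finset.univ.filter fun j => b j = q)

theorem fiberIdem_pt (q : Q) :
    (he.fiberIdem b q).pt = ∑ j ∈ Finset.univ.filter fun j => b j = q, (e j).pt := rfl

theorem isOrthogonalFamily_fiber (q : Q) :
    IsOrthogonalFamily (peirceCorner (he.fiberIdem b q)) fun j : {j // b j = q} => e j where
  orthogonal h := he.orthogonal fun h0 => h (Subtype.ext h0)
  sum_pt := by
    rw [peirceCorner_e, fiberIdem_pt]
    exact (Finset.sum_subtype _ (fun j => by simp) fun j => (e j).pt).symm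

variable {b}

/-- In `e_q a = ∑ e_i a e_j`, with `i` in the fibre of `q` and `j` arbitrary, the terms with `j`
outside the fibre vanish because linked indices share a fibre. The symmetric expansion of `a e_q` is
the same sum, so `e_q` is central. -/
theorem leftMul_fiberIdem (h : ∀ i j, Linked (e i) (e j) → b i = b j) (q : Q) :
    leftMul (he.fiberIdem b q).pt =
      ∑ i ∈ Finset.univ.filter fun j => b j = q, ∑ j ∈ Finset.univ.filter fun j => b j = q,
        leftMul (e i).pt ≫ rightMul (e j).pt := by
  rw [fiberIdem_pt, leftMul_sum]
  refine Finset.sum_congr rfl fun i hi => ?_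
  have h1 : leftMul (e i).pt = ∑ j, leftMul (e i).pt ≫ rightMul (e j).pt := by
    rw [← Preadditive.comp_sum, ← rightMul_sum, he.sum_pt, rightMul, mulRight_one,
      Category.comp_id]
  refine h1.trans (Finset.sum_subset (Finset.filter_subset _ _) fun j _ hj => ?_).symm
  by_contra h0
  simp only [Finset.mem_filter, Finset.mem_univ, true_and] at hi hj
  exact hj ((h i j h0).symm.trans hi)

theorem rightMul_fiberIdem (h : ∀ i j, Linked (e i) (e j) → b i = b j) (q : Q) :
    rightMul (he.fiberIdem b q).pt =
      ∑ i ∈ Finset.univ.filter fun j => b j = q, ∑ j ∈ Finset.univ.filter fun j => b j = q,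
        leftMul (e i).pt ≫ rightMul (e j).pt := by
  rw [fiberIdem_pt, rightMul_sum, Finset.sum_comm]
  refine Finset.sum_congr rfl fun j hj => ?_
  have h1 : rightMul (e j).pt = ∑ i, leftMul (e i).pt ≫ rightMul (e j).pt := by
    rw [← Preadditive.sum_comp, ← leftMul_sum, he.sum_pt, leftMul_one, Category.id_comp]
  refine h1.trans (Finset.sum_subset (Finset.filter_subset _ _) fun i _ hi => ?_).symm
  by_contra h0
  simp only [Finset.mem_filter, Finset.mem_univ, true_and] at hi hj
  exact hi ((h i j h0).trans hj)

theorem isBlockDecomposition [Fintype Q] (h : ∀ i j, Linked (e i) (e j) → b i = b j) :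
    IsBlockDecomposition fun q => peirceCorner (he.fiberIdem b q) where
  central q := by
    have h1 : leftMul (he.fiberIdem b q).pt = rightMul (he.fiberIdem b q).pt :=
      (he.leftMul_fiberIdem h q).trans (he.rightMul_fiberIdem h q).symm
    have h2 := (peirce (he.fiberIdem b q) (he.fiberIdem b q)).proj_incl
    refine ⟨?_, ?_⟩
    · rw [peirceCorner_e]
      refine Eq.trans ?_ h2.symm
      rw [← h1, IdempotentPoint.leftMul_idem]
    · rw [peirceCorner_e]
      refine Eq.trans ?_ h2.symm
      rw [h1, IdempotentPoint.rightMul_idem]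
  orthogonal {c d} hcd := by
    classical
    rw [peirceCorner_e, peirceCorner_e]
    refine (he.sum_pt_rightMul _ _).trans ?_
    rw [← Finset.filter_and, Finset.filter_false_of_mem, Finset.sum_empty]
    rintro j _ ⟨h1, h2⟩
    exact hcd (h1.symm.trans h2)
  sum_e := by
    simp only [peirceCorner_e, fiberIdem_pt]
    rw [Finset.sum_fiberwise, he.sum_pt]

end IsPrimitiveFamily

end Blocks

section Algebras

variable (k : Type w) [Field k] {C : Type u} [Category.{v} C] [Preadditive C] [Linear k C]
  [MonoidalCategory C] [MonoidalPreadditive C] [MonoidalLinear k C] [RigidCategory C]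
  [SemisimpleCategory k C] {A : Mon C}

theorem isMatrixAlgebra_of_linked [IsIdempotentComplete C] (hA : IsFreeRegular A) {D : Mon C}
    {K : Corner A D} {J : Type*} [Fintype J] [Nonempty J] {f : J → IdempotentPoint A}
    (hf : IsOrthogonalFamily K f) (hs : ∀ i, ∃ P : (peirceCorner (f i)).Projective, Simple P.obj)
    (hl : ∀ i j, Linked (f i) (f j)) : IsMatrixAlgebra k D := by
  have := SemisimpleCategory.hasCoequalizers k C
  let ε := Fintype.equivFin J
  refine ⟨Fintype.card J, Fintype.card_pos, ⟨IsOrthogonalFamily.matrixPresentation k (K := K)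
    (f := fun i => f (ε.symm i)) ⟨fun h => hf.orthogonal (ε.symm.injective.ne h), ?_⟩ hA
    (fun i => hs _) (fun i j => Nonempty.some ?_)⟩⟩
  · rw [← hf.sum_pt]
    exact ε.symm.sum_comp fun j => (f j).pt
  · obtain ⟨P, _⟩ := hs (ε.symm i)
    exact (hl _ _).nonempty_peirceDual hA.isRegular P

omit [RigidCategory C] [SemisimpleCategory k C] [MonoidalLinear k C] [Linear k C] in
theorem IsBlockDecomposition.isDirectSumOfAlgebras [IsIdempotentComplete C] {m : ℕ}
    {D : Fin m → Mon C} {K : ∀ c, Corner A (D c)} (hK : IsBlockDecomposition K) :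
    IsDirectSumOfAlgebras A D := by
  refine ⟨biconeMk A.X (fun c => (K c).incl) (fun c => (K c).proj) (fun c => (K c).incl_proj)
    (fun c d h => ?_), isBilimitOfTotal _ ?_, Iso.refl _, fun c => ?_⟩
  · rw [← cancel_mono (K d).incl, zero_comp, Category.assoc, ← (hK.central d).mulRight_eq,
      ← (K c).incl_mulRight, Category.assoc]
    change _ ≫ rightMul _ ≫ rightMul _ = 0
    rw [rightMul_rightMul, hK.orthogonal h, rightMul_zero, comp_zero]
  · change ∑ c, (K c).proj ≫ (K c).incl = 𝟙 A.X
    rw [← hK.sum_mulRight (self A)]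
    exact Finset.sum_congr rfl fun c _ => (hK.central c).mulRight_eq.symm
  · change IsMonHom (𝟙 A.X ≫ (K c).proj)
    rw [Category.id_comp]
    exact ⟨(hK.central c).one_proj, by
      rw [(hK.central c).mul_proj, MonoidalCategory.tensorHom_def, Category.assoc]⟩

/-- The blocks are the linkage classes: within a class all Peirce components are nonzero, between
classes all vanish. -/
theorem isDirectSumOfMatrixAlgebras_of_isSemisimpleAlgebra (h : IsSemisimpleAlgebra k A) :
    IsDirectSumOfMatrixAlgebras k A := by
  classical
  have := (SemisimpleCategory.isSplitFinite (k := k) (M := C)).isIdempotentComplete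
  have hA := (isSemisimpleAlgebra_iff k).1 h
  have hsf : IsSplitFinite k (RMod A) :=
    have : SemisimpleCategory k (RMod A) := h
    SemisimpleCategory.isSplitFinite
  obtain ⟨J, _, e, he⟩ := exists_isPrimitiveFamily hsf
  let S := he.linkedSetoid hA.isRegular
  let ε := Fintype.equivFin (Quotient S)
  let b : J → Fin (Fintype.card (Quotient S)) := fun j => ε (Quotient.mk S j)
  have hb : ∀ i j, Linked (e i) (e j) ↔ b i = b j := fun i j => by
    rw [ε.injective.eq_iff, Quotient.eq]
    rfl
  refine ⟨_, fun q => peirceAlg (he.fiberIdem b q), fun q => ?_,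
    (he.isBlockDecomposition fun i j h => (hb i j).1 h).isDirectSumOfAlgebras⟩
  have : Nonempty {j // b j = q} := by
    obtain ⟨j, hj⟩ := Quotient.exists_rep (ε.symm q)
    exact ⟨⟨j, by rw [← ε.apply_symm_apply q, ← hj]⟩⟩
  exact isMatrixAlgebra_of_linked k hA (he.isOrthogonalFamily_fiber b q) (fun i => he.simple i)
    fun i j => (hb i j).2 (i.2.trans j.2.symm)

/-- Separate the class of one index `j₀` from all other indices. Indecomposability kills one of the
two blocks, which cannot be the block of `j₀`, so a single class remains. -/
theorem isMatrixAlgebra_of_isSimpleAlgebra (h : IsSimpleAlgebra k A) : IsMatrixAlgebra k A := by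
  classical
  have := (SemisimpleCategory.isSplitFinite (k := k) (M := C)).isIdempotentComplete
  have hA := (isSemisimpleAlgebra_iff k).1 h.1
  have hsf : IsSplitFinite k (RMod A) :=
    have : SemisimpleCategory k (RMod A) := h.1
    SemisimpleCategory.isSplitFinite
  have := hsf.hasFiniteBiproducts
  have := hasBinaryBiproducts_of_finite_biproducts (RMod A)
  obtain ⟨J, _, e, he⟩ := exists_isPrimitiveFamily hsf
  let S := he.linkedSetoid hA.isRegular
  -- An empty family would make the unit of `A` zero, and then every module zero.
  have hJ : Nonempty J := by
    by_contra hJ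
    rw [not_nonempty_iff] at hJ
    refine h.2.nonzero fun M => ?_
    rw [IsZero.iff_id_eq_zero]
    apply RMod.hom_ext
    rw [id_hom, ← mulRight_one, ← he.sum_pt, Finset.univ_eq_empty, Finset.sum_empty, mulRight_zero,
      zero_hom]
  obtain ⟨j₀⟩ := hJ
  let b : J → Bool := fun j => decide (Linked (e j₀) (e j))
  have hb : ∀ i j, Linked (e i) (e j) → b i = b j := fun i j hij => by
    have h1 : Linked (e j₀) (e i) ↔ Linked (e j₀) (e j) :=
      ⟨fun h => S.trans' h hij, fun h => S.trans' h (S.symm' hij)⟩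
    exact decide_eq_decide.2 h1
  have hK := he.isBlockDecomposition hb
  have hfin : ∀ c, IsFiniteLeftModule k C (RMod (peirceAlg (he.fiberIdem b c))) := fun c => by
    obtain ⟨P⟩ := (peirceCorner (he.fiberIdem b c)).nonempty_projective
    have : SemisimpleCategory k (RMod (peirceAlg (he.fiberIdem b c))) :=
      (isSemisimpleAlgebra_iff k).2 (Corner.isFreeRegular_corner P hA.isRegular)
    exact isFiniteLeftModule k
  -- If the module category of a block is zero, so is its idempotent, and hence so is each `e j`
  -- contained in it.
  have hzero : ∀ c, IsZeroCategory (RMod (peirceAlg (he.fiberIdem b c))) → ∀ j, b j ≠ c := by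
    intro c hc j hj
    have h1 : IsZero (peirce (he.fiberIdem b c) (he.fiberIdem b c)).obj := by
      have h2 := congrArg Hom.hom
        ((IsZero.iff_id_eq_zero _).1 (hc (self (peirceAlg (he.fiberIdem b c)))))
      exact (IsZero.iff_id_eq_zero _).2 h2
    have h3 : (he.fiberIdem b c).pt = 0 := by
      rw [← peirceOne_incl, h1.eq_of_tgt (peirceOne _) 0, zero_comp]
    refine he.pt_ne_zero j ?_
    have h4 := he.pt_rightMul_sum (Finset.univ.filter fun j => b j = c) j
    rw [← he.fiberIdem_pt, h3, rightMul_zero, comp_zero, if_pos (by simp [hj])] at h4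
    exact h4.symm
  have hlink : ∀ j, Linked (e j₀) (e j) := by
    rcases h.2.isZero_or_isZero _ _ (hfin true) (hfin false) _ _ hK.isEquivalence_prod with h1 | h1
    · exact absurd (decide_eq_true (S.refl' j₀)) (hzero _ h1 j₀)
    · intro j
      have := hzero _ h1 j
      simpa [b] using this
  have : Nonempty J := ⟨j₀⟩
  -- With one class, the whole algebra is the block.
  exact isMatrixAlgebra_of_linked k hA (K := Corner.refl A)
    ⟨fun h => he.orthogonal h, by rw [he.sum_pt, Corner.refl_e]⟩ he.simple
    fun i j => S.trans' (S.symm' (hlink i)) (hlink j)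

end Algebras

end MultiFusion

/-! ### Matrix algebras are simple. -/

namespace MultiFusion

open RMod

/-- Schur's lemma: a section of `f` exists, and it is itself a nonzero monomorphism into a simple
object. -/
theorem IsRegular.isIso_of_simple {C : Type u} [Category.{v} C] [Preadditive C]
    [IsIdempotentComplete C] (h : IsRegular C) {X Y : C} [Simple X] [Simple Y] (f : X ⟶ Y)
    (hf : f ≠ 0) : IsIso f := by
  obtain ⟨s, hs⟩ := h.exists_section_of_simple f hf
  have : Mono s := ⟨fun a b hab => by
    rw [← Category.comp_id a, ← hs, reassoc_of% hab, hs, Category.comp_id]⟩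
  have : IsIso s := isIso_of_mono_of_nonzero fun h0 => id_nonzero Y (by rw [← hs, h0, zero_comp])
  rw [← IsIso.eq_inv_comp, Category.comp_id] at hs
  rw [hs]
  infer_instance

namespace MatrixPresentation

variable {k : Type w} [Field k] {C : Type u} [Category.{v} C] [Preadditive C] [Linear k C]
  [MonoidalCategory C] [MonoidalPreadditive C] [MonoidalLinear k C] [RigidCategory C]
  [HasCoequalizers C] {A : Mon C} {n : ℕ} (Φ : MatrixPresentation k A n)

/-- The inclusion of an entry. -/
def inc (i j : Fin n) : (Φ.entry i j).X ⟶ A.X := Φ.sum.ι (i, j) ≫ Φ.iso.hom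

/-- The projection to an entry. -/
def prj (i j : Fin n) : A.X ⟶ (Φ.entry i j).X := Φ.iso.inv ≫ Φ.sum.π (i, j)

theorem inc_prj (i j : Fin n) : Φ.inc i j ≫ Φ.prj i j = 𝟙 _ := by
  simp [inc, prj]

theorem inc_prj_of_ne {i j i' j' : Fin n} (h : (i, j) ≠ (i', j')) :
    Φ.inc i j ≫ Φ.prj i' j' = 0 := by
  simp only [inc, prj, Category.assoc, Iso.hom_inv_id_assoc]
  exact bicone_ι_π_ne Φ.sum h

theorem sum_prj_inc : ∑ i, ∑ j, Φ.prj i j ≫ Φ.inc i j = 𝟙 A.X := by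
  rw [← Fintype.sum_prod_type' (f := fun i j => Φ.prj i j ≫ Φ.inc i j)]
  have h : ∀ p : Fin n × Fin n, Φ.prj p.1 p.2 ≫ Φ.inc p.1 p.2 =
      Φ.iso.inv ≫ (Φ.sum.π p ≫ Φ.sum.ι p) ≫ Φ.iso.hom := fun p => by simp [inc, prj]
  simp only [h]
  rw [← Preadditive.comp_sum, ← Preadditive.sum_comp, IsBilimit.total Φ.isBilimit]
  simp

/-- The multiplication of entries. -/
noncomputable def mul (i j l : Fin n) :
    (Φ.entry i j).X ⊗ (Φ.entry j l).X ⟶ (Φ.entry i l).X :=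
  tensorProj (Φ.entry i j) (Φ.entry j l) ≫ (Φ.comp i j l).hom.hom

instance (i j l : Fin n) : Epi (Φ.mul i j l) := by
  have : IsIso (Φ.comp i j l).hom.hom :=
    Iso.isIso_hom ((Bimod.forget (Φ.diag i) (B := Φ.diag l)).mapIso (Φ.comp i j l))
  exact epi_comp _ _

theorem inc_mul (i j l : Fin n) :
    Φ.inc i j ▷ _ ≫ A.X ◁ Φ.inc j l ≫ μ[A.X] = Φ.mul i j l ≫ Φ.inc i l := by
  rw [mul, Category.assoc, ← Category.assoc, ← MonoidalCategory.tensorHom_def]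
  exact Φ.mul_eq i j l

theorem inc_mul_of_ne (i l : Fin n) {j j' : Fin n} (h : j ≠ j') :
    Φ.inc i j ▷ _ ≫ A.X ◁ Φ.inc j' l ≫ μ[A.X] = 0 := by
  rw [← Category.assoc, ← MonoidalCategory.tensorHom_def]
  exact Φ.mul_eq_zero i j j' l h

theorem mul_actRight (i j l : Fin n) : Φ.mul i j l ▷ (Φ.diag l).X ≫ (Φ.entry i l).actRight =
    (α_ _ _ _).hom ≫ (Φ.entry i j).X ◁ (Φ.entry j l).actRight ≫ Φ.mul i j l := by
  rw [mul, comp_whiskerRight, Category.assoc, ← (Φ.comp i j l).hom.right_act_hom,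
    reassoc_of% tensorProj_whiskerRight]

/-- The diagonal components of the unit. -/
def unit (i : Fin n) : 𝟙_ C ⟶ (Φ.entry i i).X := η[A.X] ≫ Φ.prj i i

theorem sum_one_prj_inc :
    ∑ i, ∑ j, η[A.X] ≫ Φ.prj i j ≫ Φ.inc i j = η[A.X] := by
  simp only [← Preadditive.comp_sum]
  rw [Φ.sum_prj_inc, Category.comp_id]

/-- Expand `1 · x = x` for `x` in `A_jl` and project to `A_jl`: only the `(j, j)` component of the
unit contributes. No relation between this component and the unit of the algebra `diag j` is part of
the data. -/
theorem unit_mul (j l : Fin n) : Φ.unit j ▷ _ ≫ Φ.mul j j l = (λ_ (Φ.entry j l).X).hom := by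
  have h0 : (λ_ (Φ.entry j l).X).hom ≫ Φ.inc j l =
      η[A.X] ▷ (Φ.entry j l).X ≫ A.X ◁ Φ.inc j l ≫ μ[A.X] := by
    rw [← whisker_exchange_assoc, MonObj.one_mul, leftUnitor_naturality]
  have h1 : (λ_ (Φ.entry j l).X).hom = ∑ i, ∑ i', (η[A.X] ≫ Φ.prj i i') ▷ (Φ.entry j l).X ≫
      (Φ.inc i i' ▷ _ ≫ A.X ◁ Φ.inc j l ≫ μ[A.X]) ≫ Φ.prj j l := by
    rw [← Category.comp_id (λ_ (Φ.entry j l).X).hom, ← Φ.inc_prj, ← Category.assoc, h0]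
    conv_lhs => rw [← Φ.sum_one_prj_inc]
    simp only [sum_whiskerRight, Preadditive.sum_comp, comp_whiskerRight, Category.assoc]
  rw [h1, Finset.sum_eq_single j, Finset.sum_eq_single j, Φ.inc_mul, Category.assoc, Φ.inc_prj,
    Category.comp_id]
  · rfl
  · intro i' _ hi'
    rw [Φ.inc_mul_of_ne _ _ hi', zero_comp, comp_zero]
  · exact fun h => absurd (Finset.mem_univ j) h
  · intro i _ hi
    refine Finset.sum_eq_zero fun i' _ => ?_
    by_cases hi' : i' = j
    · subst hi'
      rw [Φ.inc_mul, Category.assoc, Φ.inc_prj_of_ne (by simp [hi]), comp_zero, comp_zero]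
    · rw [Φ.inc_mul_of_ne _ _ hi', zero_comp, comp_zero]
  · exact fun h => absurd (Finset.mem_univ j) h

theorem mul_unit (j l : Fin n) : _ ◁ Φ.unit l ≫ Φ.mul j l l = (ρ_ (Φ.entry j l).X).hom := by
  have h0 : (ρ_ (Φ.entry j l).X).hom ≫ Φ.inc j l =
      Φ.inc j l ▷ 𝟙_ C ≫ A.X ◁ η[A.X] ≫ μ[A.X] := by
    rw [MonObj.mul_one, rightUnitor_naturality]
  have h1 : (ρ_ (Φ.entry j l).X).hom = ∑ i, ∑ i', (Φ.entry j l).X ◁ (η[A.X] ≫ Φ.prj i i') ≫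
      (Φ.inc j l ▷ _ ≫ A.X ◁ Φ.inc i i' ≫ μ[A.X]) ≫ Φ.prj j l := by
    rw [← Category.comp_id (ρ_ (Φ.entry j l).X).hom, ← Φ.inc_prj, ← Category.assoc, h0]
    conv_lhs => rw [← Φ.sum_one_prj_inc]
    simp only [whiskerLeft_sum, Preadditive.sum_comp, Preadditive.comp_sum,
      MonoidalCategory.whiskerLeft_comp, Category.assoc, whisker_exchange_assoc]
  rw [h1, Finset.sum_eq_single l, Finset.sum_eq_single l, Φ.inc_mul, Category.assoc, Φ.inc_prj,
    Category.comp_id]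
  · rfl
  · intro i' _ hi'
    rw [Φ.inc_mul, Category.assoc, Φ.inc_prj_of_ne (by simp [hi']), comp_zero, comp_zero]
  · exact fun h => absurd (Finset.mem_univ l) h
  · intro i _ hi
    refine Finset.sum_eq_zero fun i' _ => ?_
    rw [Φ.inc_mul_of_ne _ _ (Ne.symm hi), zero_comp, comp_zero]
  · exact fun h => absurd (Finset.mem_univ l) h

/-- The idempotent of a diagonal entry. -/
def idem (i : Fin n) : 𝟙_ C ⟶ A.X := Φ.unit i ≫ Φ.inc i i

theorem inc_leftMul (j l : Fin n) : Φ.inc j l ≫ leftMul (Φ.idem j) = Φ.inc j l := by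
  rw [leftMul_eq, leftUnitor_inv_naturality_assoc, idem, comp_whiskerRight_assoc,
    whisker_exchange_assoc, whisker_exchange_assoc, Φ.inc_mul, reassoc_of% Φ.unit_mul,
    Iso.inv_hom_id_assoc]

theorem inc_rightMul (j l : Fin n) : Φ.inc j l ≫ rightMul (Φ.idem l) = Φ.inc j l := by
  rw [rightMul_eq, rightUnitor_inv_naturality_assoc, idem, MonoidalCategory.whiskerLeft_comp_assoc,
    ← whisker_exchange_assoc, Φ.inc_mul, reassoc_of% Φ.mul_unit, Iso.inv_hom_id_assoc]

theorem inc_leftMul_of_ne {i j : Fin n} (l : Fin n) (h : i ≠ j) :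
    Φ.inc j l ≫ leftMul (Φ.idem i) = 0 := by
  rw [leftMul_eq, leftUnitor_inv_naturality_assoc, idem, comp_whiskerRight_assoc,
    whisker_exchange_assoc, whisker_exchange_assoc, Φ.inc_mul_of_ne _ _ h, comp_zero, comp_zero]

theorem inc_rightMul_of_ne {i l : Fin n} (j : Fin n) (h : l ≠ i) :
    Φ.inc j l ≫ rightMul (Φ.idem i) = 0 := by
  rw [rightMul_eq, rightUnitor_inv_naturality_assoc, idem, MonoidalCategory.whiskerLeft_comp_assoc,
    ← whisker_exchange_assoc, Φ.inc_mul_of_ne _ _ h, comp_zero, comp_zero]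

theorem leftMul_rightMul_idem (i : Fin n) :
    leftMul (Φ.idem i) ≫ rightMul (Φ.idem i) = Φ.prj i i ≫ Φ.inc i i := by
  have h : leftMul (Φ.idem i) ≫ rightMul (Φ.idem i) =
      ∑ j, ∑ l, Φ.prj j l ≫ Φ.inc j l ≫ leftMul (Φ.idem i) ≫ rightMul (Φ.idem i) := by
    conv_lhs => rw [← Category.id_comp (leftMul _ ≫ _), ← Φ.sum_prj_inc]
    simp only [Preadditive.sum_comp, Category.assoc]
  rw [h, Finset.sum_eq_single i, Finset.sum_eq_single i, reassoc_of% Φ.inc_leftMul,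
    Φ.inc_rightMul]
  · intro l _ hl
    rw [reassoc_of% Φ.inc_leftMul, Φ.inc_rightMul_of_ne _ hl, comp_zero]
  · exact fun h => absurd (Finset.mem_univ i) h
  · intro j _ hj
    refine Finset.sum_eq_zero fun l _ => ?_
    rw [reassoc_of% Φ.inc_leftMul_of_ne _ (Ne.symm hj), zero_comp, comp_zero]
  · exact fun h => absurd (Finset.mem_univ i) h

section Diagonal

variable (i : Fin n)

/-- A diagonal entry as a right module. -/
abbrev diagMod : RMod (Φ.diag i) where
  X := (Φ.entry i i).X
  act := (Φ.entry i i).actRight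
  act_one := (Φ.entry i i).actRight_one
  act_mul := (Φ.entry i i).right_assoc

/-- A diagonal entry is isomorphic to the regular module. -/
def diagModIso : Φ.diagMod i ≅ self (Φ.diag i) :=
  isoMk ((Bimod.forget _).mapIso (Φ.entryDiag i)) (Φ.entryDiag i).hom.right_act_hom

/-- The map from the diagonal algebra to the diagonal entry which preserves the unit. -/
def diagHom : self (Φ.diag i) ⟶ Φ.diagMod i := ofPoint (Φ.unit i)

/-- Right multiplication by `diagHom d` is the given action of `d`, as `x (u d) = (x u) d = x d` for
the unit component `u`. Hence the linear map `diagHom` is multiplicative, although the isomorphisms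
`comp` are not assumed associative or unital. -/
theorem diagHom_mul : ((Φ.diagHom i).hom ⊗ₘ (Φ.diagHom i).hom) ≫ Φ.mul i i i =
    μ[(Φ.diag i).X] ≫ (Φ.diagHom i).hom := by
  have h : (Φ.entry i i).X ◁ (Φ.diagHom i).hom ≫ Φ.mul i i i = (Φ.entry i i).actRight := by
    have h2 : (Φ.entry i i).X ◁ (Φ.entry i i).actRight ≫ Φ.mul i i i =
        (α_ _ _ _).inv ≫ Φ.mul i i i ▷ _ ≫ (Φ.entry i i).actRight := by
      rw [Φ.mul_actRight, Iso.inv_hom_id_assoc]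
    rw [diagHom, ofPoint_hom, MonoidalCategory.whiskerLeft_comp, MonoidalCategory.whiskerLeft_comp,
      Category.assoc, Category.assoc, h2, associator_inv_naturality_middle_assoc,
      ← comp_whiskerRight_assoc, Φ.mul_unit]
    simp
  rw [MonoidalCategory.tensorHom_def, Category.assoc, h]
  exact (Φ.diagHom i).act_hom.symm

/-- Source and target are simple modules, and the map is nonzero because the unit component acts as
the identity on the nonzero object `A_ii`. -/
theorem isIso_diagHom [IsIdempotentComplete C] (hD : IsRegular (RMod (Φ.diag i))) :
    IsIso (Φ.diagHom i) := by
  have := RMod.isIdempotentComplete (A := Φ.diag i)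
  have : Simple (self (Φ.diag i)) := Φ.division i
  have := Simple.of_iso (Φ.diagModIso i)
  refine hD.isIso_of_simple _ fun h0 => id_nonzero (Φ.diagMod i) (RMod.hom_ext ?_)
  have h1 : Φ.unit i = 0 := by
    rw [← point_ofPoint (M := Φ.diagMod i) (Φ.unit i), ← diagHom, h0]
    simp [point]
  have h2 := Φ.mul_unit i i
  rw [h1, MonoidalPreadditive.whiskerLeft_zero, zero_comp] at h2
  rw [id_hom, zero_hom, ← Iso.inv_hom_id (ρ_ (Φ.entry i i).X), ← h2, comp_zero]

/-- The diagonal algebra as a corner. -/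
noncomputable def diagCorner [IsIso (Φ.diagHom i)] : Corner A (Φ.diag i) :=
  have h : (inv (Φ.diagHom i)).hom ≫ (Φ.diagHom i).hom = 𝟙 _ := by
    rw [← comp_hom, IsIso.inv_hom_id, id_hom]
  have h' : (Φ.diagHom i).hom ≫ (inv (Φ.diagHom i)).hom = 𝟙 _ := by
    rw [← comp_hom, IsIso.hom_inv_id, id_hom]
  { incl := (Φ.diagHom i).hom ≫ Φ.inc i i
    proj := Φ.prj i i ≫ (inv (Φ.diagHom i)).hom
    incl_proj := by
      rw [Category.assoc, reassoc_of% Φ.inc_prj, h']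
    mul_incl := by
      rw [← MonoidalCategory.tensorHom_comp_tensorHom, Category.assoc,
        MonoidalCategory.tensorHom_def (Φ.inc i i), Category.assoc, Φ.inc_mul,
        reassoc_of% Φ.diagHom_mul]
    proj_incl := by
      have h1 : η[(Φ.diag i).X] ≫ (Φ.diagHom i).hom ≫ Φ.inc i i = Φ.idem i := by
        rw [← Category.assoc]
        exact congrArg (· ≫ Φ.inc i i) (point_ofPoint (M := Φ.diagMod i) (Φ.unit i))
      rw [h1]
      refine Eq.trans ?_ (Φ.leftMul_rightMul_idem i).symm
      rw [Category.assoc, reassoc_of% h] }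

theorem diagCorner_e [IsIso (Φ.diagHom i)] : (Φ.diagCorner i).e = Φ.idem i := by
  change η[(Φ.diag i).X] ≫ (Φ.diagHom i).hom ≫ Φ.inc i i = Φ.idem i
  rw [← Category.assoc]
  exact congrArg (· ≫ Φ.inc i i) (point_ofPoint (M := Φ.diagMod i) (Φ.unit i))

/-- The projective module of a diagonal entry generates. -/
theorem exists_section [IsIdempotentComplete C] (hC : IsRegular C) [IsIso (Φ.diagHom i)]
    (P : (Φ.diagCorner i).Projective) :
    ∃ (s : self A ⟶ ltensor A.X P.obj) (m : ltensor A.X P.obj ⟶ self A), s ≫ m = 𝟙 _ := by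
  -- Each component of the unit of `A` is lifted through `A_ji ⊗ A_il ⟶ A_jl`. The sum `x` of the
  -- lifts is an element of `A ⊗ e A` with product `1`, and `a ↦ x a` is the section.
  choose t ht using fun j l => hC.exists_section_of_epi (Φ.mul j i l)
  let x : 𝟙_ C ⟶ A.X ⊗ P.obj.X := ∑ j, ∑ l,
    η[A.X] ≫ Φ.prj j l ≫ t j l ≫ Φ.inc j i ▷ _ ≫ A.X ◁ (Φ.inc i l ≫ P.r.hom)
  refine ⟨ofPoint (M := ltensor A.X P.obj) x, whisker A.X P.i ≫ actHom (self A), ?_⟩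
  have h1 : P.r.hom ≫ P.i.hom = leftMul (Φ.idem i) := by
    rw [← comp_hom, P.r_i, diagCorner_e]
  have h2 : ∀ j l, (η[A.X] ≫ Φ.prj j l ≫ t j l ≫ Φ.inc j i ▷ _ ≫
      A.X ◁ (Φ.inc i l ≫ P.r.hom)) ≫ A.X ◁ P.i.hom ≫ μ[A.X] =
        η[A.X] ≫ Φ.prj j l ≫ Φ.inc j l := by
    intro j l
    simp only [Category.assoc]
    rw [← MonoidalCategory.whiskerLeft_comp_assoc, Category.assoc, h1, Φ.inc_leftMul, Φ.inc_mul,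
      reassoc_of% ht]
  rw [ofPoint_comp, ← ofPoint_point (𝟙 (self A))]
  congr 1
  change x ≫ A.X ◁ P.i.hom ≫ μ[A.X] = η[A.X] ≫ 𝟙 _
  rw [Category.comp_id, ← Φ.sum_one_prj_inc]
  simp only [x, Preadditive.sum_comp, h2]

end Diagonal

-- One diagonal entry suffices: its corner is full, so both regularity of `A` and the simple
-- generator `e A` come from it.
include Φ in
theorem isSimpleAlgebra [SemisimpleCategory k C] (hn : 1 ≤ n) : IsSimpleAlgebra k A := by
  have hsf : IsSplitFinite k C := SemisimpleCategory.isSplitFinite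
  have := hsf.isIdempotentComplete
  let i : Fin n := ⟨0, hn⟩
  have hD := ((isSemisimpleAlgebra_iff k).1 (Φ.simple i).1).isRegular
  have := Φ.isIso_diagHom i hD
  obtain ⟨P⟩ := (Φ.diagCorner i).nonempty_projective
  obtain ⟨s, m, hsm⟩ := Φ.exists_section i hsf.regular P
  have hA := Corner.isFreeRegular_of_corner P hD s m hsm
  have : Simple P.obj := (Corner.simple_iff P hA.isRegular).2 (Φ.division i)
  exact ⟨(isSemisimpleAlgebra_iff k).2 hA, isIndecomposable_of_simple k hA s m hsm⟩

end MatrixPresentation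

/-! ### Direct sums of algebras and the two equivalences. -/

section Main

variable {k : Type w} [Field k] {C : Type u} [Category.{v} C] [Preadditive C] [Linear k C]
  [MonoidalCategory C] [MonoidalPreadditive C] [MonoidalLinear k C] [RigidCategory C]
  [SemisimpleCategory k C] {A : Mon C}

theorem IsMatrixAlgebra.isSimpleAlgebra (h : IsMatrixAlgebra k A) : IsSimpleAlgebra k A := by
  have := SemisimpleCategory.hasCoequalizers k C
  obtain ⟨n, hn, ⟨Φ⟩⟩ := h
  exact Φ.isSimpleAlgebra hn

-- The block idempotents are the units of the summands. Every identity is checked after the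
-- projections, which are jointly monic algebra homomorphisms.
omit [RigidCategory C] [SemisimpleCategory k C] [MonoidalLinear k C] [Linear k C] in
theorem IsDirectSumOfAlgebras.exists_isBlockDecomposition {m : ℕ} {D : Fin m → Mon C}
    (h : IsDirectSumOfAlgebras A D) :
    ∃ K : ∀ c, Corner A (D c), IsBlockDecomposition K := by
  obtain ⟨b, hb, ε, hπ⟩ := h
  let p : ∀ c, A.X ⟶ (D c).X := fun c => ε.hom ≫ b.π c
  let i : ∀ c, (D c).X ⟶ A.X := fun c => b.ι c ≫ ε.inv
  have hip : ∀ c, i c ≫ p c = 𝟙 _ := fun c => by simp [i, p]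
  have hip' : ∀ c d, c ≠ d → i c ≫ p d = 0 := fun c d h => by
    simp [i, p, bicone_ι_π_ne b h]
  have hext : ∀ {X : C} {f g : X ⟶ A.X}, (∀ c, f ≫ p c = g ≫ p c) → f = g := by
    intro X f g h
    rw [← cancel_mono ε.hom]
    refine hb.isLimit.hom_ext fun c => ?_
    simpa [p] using h c.as
  have hone : ∀ c, η[A.X] ≫ p c = η[(D c).X] := fun c => (hπ c).one_hom
  have hmul : ∀ c, μ[A.X] ≫ p c = p c ▷ _ ≫ _ ◁ p c ≫ μ[(D c).X] := fun c => by
    have h := (hπ c).mul_hom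
    rw [MonoidalCategory.tensorHom_def, Category.assoc] at h
    exact h
  have hL : ∀ c, leftMul (η[(D c).X] ≫ i c) = p c ≫ i c := fun c => hext fun d => by
    rw [leftMul_eq, Category.assoc, Category.assoc, Category.assoc, hmul, ← comp_whiskerRight_assoc,
      Category.assoc]
    by_cases hcd : c = d
    · subst hcd
      rw [hip, Category.comp_id, ← whisker_exchange_assoc, MonObj.one_mul,
        leftUnitor_naturality, Iso.inv_hom_id_assoc]
      simp
    · rw [hip' c d hcd]
      simp
  have hR : ∀ c, rightMul (η[(D c).X] ≫ i c) = p c ≫ i c := fun c => hext fun d => by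
    rw [rightMul_eq, Category.assoc, Category.assoc, Category.assoc, hmul, whisker_exchange_assoc,
      ← MonoidalCategory.whiskerLeft_comp_assoc, Category.assoc]
    by_cases hcd : c = d
    · subst hcd
      rw [hip, Category.comp_id, MonObj.mul_one,
        rightUnitor_naturality, Iso.inv_hom_id_assoc]
      simp
    · rw [hip' c d hcd]
      simp
  refine ⟨fun c => ⟨i c, p c, hip c, hext fun d => ?_, ?_⟩, ⟨fun c => ⟨hL c, hR c⟩,
    fun {c d} hcd => ?_, hext fun d => ?_⟩⟩
  · rw [Category.assoc, Category.assoc, hmul, ← whisker_exchange_assoc, MonoidalCategory.tensorHom_def,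
      Category.assoc, ← MonoidalCategory.whiskerLeft_comp_assoc, whisker_exchange_assoc,
      ← comp_whiskerRight_assoc]
    by_cases hcd : c = d
    · subst hcd
      rw [hip]
      simp
    · rw [hip' c d hcd]
      simp
  · refine Eq.trans ?_ (congrArg₂ (· ≫ ·) (hL c) (hR c)).symm
    simp [reassoc_of% hip]
  · change (η[(D c).X] ≫ i c) ≫ rightMul (η[(D d).X] ≫ i d) = 0
    rw [hR, Category.assoc, reassoc_of% hip' c d hcd, zero_comp, comp_zero]
  · change (∑ c, η[(D c).X] ≫ i c) ≫ p d = η[A.X] ≫ p d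
    rw [hone, Preadditive.sum_comp, Finset.sum_eq_single d, Category.assoc, hip, Category.comp_id]
    · intro c _ hcd
      rw [Category.assoc, hip' c d hcd, comp_zero]
    · exact fun h => absurd (Finset.mem_univ d) h

theorem IsDirectSumOfMatrixAlgebras.isSemisimpleAlgebra (h : IsDirectSumOfMatrixAlgebras k A) :
    IsSemisimpleAlgebra k A := by
  have := (SemisimpleCategory.isSplitFinite (k := k) (M := C)).isIdempotentComplete
  obtain ⟨m, D, hD, hsum⟩ := h
  obtain ⟨K, hK⟩ := hsum.exists_isBlockDecomposition
  have hreg := hK.isRegular fun c =>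
    ((isSemisimpleAlgebra_iff k).1 (hD c).isSimpleAlgebra.1).isRegular
  exact (isSemisimpleAlgebra_iff k).2 fun c c' f => hreg f

end Main

end MultiFusion

theorem theorem3 {k : Type w} [Field k] {C : Type u} [Category.{v} C] [Preadditive C] [Linear k C]
    [MonoidalCategory C] [MonoidalPreadditive C] [MonoidalLinear k C] [RigidCategory C]
    [MultiFusion.SemisimpleCategory k C] (A : Mon C) :
    (MultiFusion.IsSimpleAlgebra k A ↔ MultiFusion.IsMatrixAlgebra k A) ∧
      (MultiFusion.IsSemisimpleAlgebra k A ↔ MultiFusion.IsDirectSumOfMatrixAlgebras k A) :=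
  ⟨⟨MultiFusion.isMatrixAlgebra_of_isSimpleAlgebra k, fun h => h.isSimpleAlgebra⟩,
    ⟨MultiFusion.isDirectSumOfMatrixAlgebras_of_isSemisimpleAlgebra k,
      fun h => h.isSemisimpleAlgebra⟩⟩
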